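/- **Setting.** UPLang is an imperative language with types $\mathit{Int}$ (interpreted by $\mathbb Z$), $\mathit{Addr}$ (interpreted by $\mathbb N$, $\mathbf{null}=0$) and non-recursive algebraic data types; $\mathit{Obj}$ is the type of heap objects, with a distinguished object $\mathit{defObj}$. Expressions are built from constants, variables, integer arithmetic, comparison and logical operators, (in)equality at every type, constructors, selectors and testers (there is no arithmetic and no order on addresses). Statements are $x:=e$, $p:=\mathbf{alloc}(e)$, $x:=\mathbf{read}(p)$, $\mathbf{write}(p,e)$, $\mathbf{skip}$, $C;D$, $\mathbf{if}$, $\mathbf{while}$, and $\mathbf{assume}$ / $\mathbf{assert}$ of an integer expression or of an atom $P(e_1,\dots,e_n)$ with an uninterpreted predicate $P$. A heap is a finite sequence of objects addressed from $1$: $\mathbf{alloc}$ appends an object and returns the new length, reading at an unallocated address gives $\mathit{defObj}$, and writing there has no effect. Relative to an interpretation $\mathcal I$ of the predicates, the big-step semantics is a partial function taking a statement, a stack and a heap to an outcome (success, or a failed assertion), a stack and a heap; it is undefined when an $\mathbf{assume}$ is not satisfied or a loop does not terminate. A program is *safe* if there is an $\mathcal I$ such that, for every initial stack and the empty initial heap,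 the outcome is not a failed assertion. Two programs are *equi-safe* if one is safe if and only if the other is. **Programs considered.** Let $p$ be a UPLang program with an input variable $\mathit{in}:\mathit{Int}$ such that 1. $p$ is *deterministic*: for every $\mathcal I$, its execution from the empty heap is determined by the initial value of $\mathit{in}$, i.e. for two initial stacks that agree on $\mathit{in}$ the same finite sequences of values arise as the operand values (right-hand sides, addresses, conditions, predicate arguments) of the statements executed so far, also for executions that block or do not terminate; 2. $p$ never assigns to $\mathit{in}$ (by $:=$, $\mathbf{alloc}$ or $\mathbf{read}$); 3. in every statement $p':=\mathbf{alloc}(e)$ of $p$, the variable $p'$ does not occur in $e$. **The encoding.** $\mathit{Enc}_{RW}(p)$ is obtained from $p$ by redeclaring $\mathit{Addr}$ as $\mathit{Int}$ (with $\mathbf{null}$ becoming $0$), introducing fresh variables $\mathit{cnt}_{alloc},\mathit{cnt},\mathit{cnt}_{last},\mathit{last}_{Addr},t,\mathit{seed}:\mathit{Int}$ and fresh predicates $R(\mathit{in},\mathit{cnt},\mathit{cnt}_{last})$ over $\mathit{Int}^3$ and $W(\mathit{in},\mathit{cnt},\mathit{obj})$ over $\mathit{Int}^2\times\mathit{Obj}$,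 prepending $$\mathit{cnt}_{alloc}:=0;\ \mathit{cnt}:=0;\ \mathit{cnt}_{last}:=0;\ t:=0;\ \mathbf{assert}(W(\mathit{in},0,\mathit{defObj})),$$ and rewriting heap statements as follows: * $p:=\mathbf{alloc}(e)$ becomes $\mathit{cnt}_{alloc}:=\mathit{cnt}_{alloc}+1;\ p:=\mathit{cnt}_{alloc};\ \mathit{cnt}:=\mathit{cnt}+1;\ \mathbf{assert}(W(\mathit{in},\mathit{cnt},e));\ \mathbf{if}\ \mathit{last}_{Addr}=p\ \{\mathit{cnt}_{last}:=\mathit{cnt}\}$; * $x:=\mathbf{read}(p)$ becomes $\mathit{cnt}:=\mathit{cnt}+1;\ \mathbf{if}\ \mathit{last}_{Addr}=p\ \mathbf{then}\ \{\mathbf{assert}(R(\mathit{in},\mathit{cnt},\mathit{cnt}_{last}));\ t:=\mathit{cnt}_{last}\}\ \mathbf{else}\ \{\mathit{havoc}(t);\ \mathbf{assume}(R(\mathit{in},\mathit{cnt},t))\};\ \mathit{havoc}(x);\ \mathbf{assume}(W(\mathit{in},t,x))$; * $\mathbf{write}(p,e)$ becomes $\mathit{cnt}:=\mathit{cnt}+1;\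 \mathbf{if}\ 0<p\le \mathit{cnt}_{alloc}\ \{\mathbf{assert}(W(\mathit{in},\mathit{cnt},e));\ \mathbf{if}\ \mathit{last}_{Addr}=p\ \{\mathit{cnt}_{last}:=\mathit{cnt}\}\}$. Here $\mathit{havoc}$ is the deterministic macro that sets its argument to an arbitrary value by consuming bits of $\mathit{seed}$: for an integer variable $x$ it is $$x:=-(\mathit{seed}\%2);\ \mathit{seed}:=\mathit{seed}/2;\ \mathbf{while}\ \mathit{seed}\%2=1\ \mathbf{do}\ \{\mathit{seed}:=\mathit{seed}/2;\ x:=2\times x+(\mathit{seed}\%2);\ \mathit{seed}:=\mathit{seed}/2\};\ \mathit{seed}:=\mathit{seed}/2,$$ and for a data type it chooses a constructor and then arbitrary values of its arguments in this way, in fresh temporaries. The variables $\mathit{last}_{Addr}$ and $\mathit{seed}$ are not initialised. **Theorem A.2 (Correctness of $\mathit{Enc}_{RW}$).** For every such $p$, the programs $p$ and $\mathit{Enc}_{RW}(p)$ are equi-safe; that is, the encoding is sound (if $p$ is unsafe, so is $\mathit{Enc}_{RW}(p)$) and complete (if $\mathit{Enc}_{RW}(p)$ is unsafe, so is $p$).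 -/

import Mathlib

namespace UPLang

/-! ### Types and values -/

/-- Types: integers, heap addresses, and non-recursive algebraic data types. The type
`adt n ar fld` has the constructors `0, …, n`; constructor `c` takes `ar c` arguments, the `j`-th
of which has type `fld c j`. (There is at least one constructor, so every type is inhabited;
types are well-founded, so no data type contains itself.) -/
inductive Ty : Type
  | int : Ty
  | addr : Ty
  | adt (n : ℕ) (ar : Fin (n + 1) → ℕ) (fld : (c : Fin (n + 1)) → Fin (ar c) → Ty) : Ty

/-- The sort interpretation: integers, natural numbers, and tagged tuples. -/
abbrev Ty.Val : Ty → Type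
  | .int => ℤ
  | .addr => ℕ
  | .adt _ _ fld => Σ c, ∀ j, (fld c j).Val

/-- The value `0`, `null`, or the first constructor applied to default arguments. -/
def Ty.default : (τ : Ty) → τ.Val
  | .int => (0 : ℤ)
  | .addr => (0 : ℕ)
  | .adt _ _ fld => ⟨0, fun j => (fld 0 j).default⟩

/-- Constructor application. -/
def Ty.mkCtor {n : ℕ} {ar : Fin (n + 1) → ℕ} {fld : (c : Fin (n + 1)) → Fin (ar c) → Ty}
    (c : Fin (n + 1)) (args : ∀ j, (fld c j).Val) : (Ty.adt n ar fld).Val :=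
  ⟨c, args⟩

/-- Selection of the `j`-th argument of constructor `c`. Selectors are total; on a value built
with another constructor the result is the default value of the field's type. -/
def Ty.select {n : ℕ} {ar : Fin (n + 1) → ℕ} {fld : (c : Fin (n + 1)) → Fin (ar c) → Ty}
    (c : Fin (n + 1)) (j : Fin (ar c)) (v : (Ty.adt n ar fld).Val) : (fld c j).Val :=
  if h : v.1 = c then (h ▸ v.2 : ∀ j, (fld c j).Val) j else (fld c j).default

/-! ### Syntax -/

/-- What a program is written over: typed variables, uninterpreted predicate symbols with their
argument types, the type `obj` of heap objects, and the default object. -/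
structure Sig where
  Var : Ty → Type
  Pred : Type
  arity : Pred → ℕ
  argTy : (P : Pred) → Fin (arity P) → Ty
  obj : Ty
  defObj : obj.Val

/-- Unary operators. -/
inductive UnOp : Type
  | neg | not

/-- Binary operators on integers. -/
inductive BinOp : Type
  | add | sub | mul | div | mod | lt | le | gt | ge | and | or

/-- Expressions of each type. Truth values are integers. Arithmetic and order are available on
integers only; (in)equality is available at every type. -/
inductive Expr (S : Sig) : Ty → Type
  | num (n : ℤ) : Expr S .int
  | var {τ : Ty} (x : S.Var τ) : Expr S τ
  | unop (o : UnOp) (a : Expr S .int) : Expr S .int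
  | binop (o : BinOp) (a b : Expr S .int) : Expr S .int
  | eq {τ : Ty} (a b : Expr S τ) : Expr S .int
  | ne {τ : Ty} (a b : Expr S τ) : Expr S .int
  | null : Expr S .addr
  | defObj : Expr S S.obj
  | ctor {n : ℕ} {ar : Fin (n + 1) → ℕ} {fld : (c : Fin (n + 1)) → Fin (ar c) → Ty}
      (c : Fin (n + 1)) (args : ∀ j, Expr S (fld c j)) : Expr S (.adt n ar fld)
  | sel {n : ℕ} {ar : Fin (n + 1) → ℕ} {fld : (c : Fin (n + 1)) → Fin (ar c) → Ty}
      (c : Fin (n + 1)) (j : Fin (ar c)) (a : Expr S (.adt n ar fld)) : Expr S (fld c j)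
  | isCtor {n : ℕ} {ar : Fin (n + 1) → ℕ} {fld : (c : Fin (n + 1)) → Fin (ar c) → Ty}
      (c : Fin (n + 1)) (a : Expr S (.adt n ar fld)) : Expr S .int

/-- Statements. -/
inductive Stmt (S : Sig) : Type
  | assign {τ : Ty} (x : S.Var τ) (e : Expr S τ)
  | alloc (p : S.Var .addr) (e : Expr S S.obj)
  | read (x : S.Var S.obj) (p : S.Var .addr)
  | write (p : S.Var .addr) (e : Expr S S.obj)
  | skip
  | seq (C D : Stmt S)
  | ite (e : Expr S .int) (C D : Stmt S)
  | while (e : Expr S .int) (C : Stmt S)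
  | assume (e : Expr S .int)
  | assert (e : Expr S .int)
  | assumeP (P : S.Pred) (es : ∀ i, Expr S (S.argTy P i))
  | assertP (P : S.Pred) (es : ∀ i, Expr S (S.argTy P i))

infixr:60 " ;; " => Stmt.seq

/-- `if e {C}`. -/
def Stmt.ifThen {S : Sig} (e : Expr S .int) (C : Stmt S) : Stmt S := .ite e C .skip

/-! ### Semantics -/

/-- A stack maps every variable to a value of its type. -/
abbrev Stack (S : Sig) : Type := (x : Σ τ, S.Var τ) → x.1.Val

/-- The value of a variable. -/
def Stack.get {S : Sig} (s : Stack S) {τ : Ty} (x : S.Var τ) : τ.Val := s ⟨τ, x⟩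

open Classical in
/-- The stack `s[x ↦ v]`. -/
noncomputable def Stack.set {S : Sig} (s : Stack S) {τ : Ty} (x : S.Var τ) (v : τ.Val) : Stack S :=
  Function.update s ⟨τ, x⟩ v

open Classical in
/-- The truth values, as integers. -/
noncomputable def truth (q : Prop) : ℤ := if q then 1 else 0

noncomputable def UnOp.eval : UnOp → ℤ → ℤ
  | .neg, a => -a
  | .not, a => truth (a = 0)

noncomputable def BinOp.eval : BinOp → ℤ → ℤ → ℤ
  | .add, a, b => a + b
  | .sub, a, b => a - b
  | .mul, a, b => a * b
  | .div, a, b => a / b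
  | .mod, a, b => a % b
  | .lt, a, b => truth (a < b)
  | .le, a, b => truth (a ≤ b)
  | .gt, a, b => truth (b < a)
  | .ge, a, b => truth (b ≤ a)
  | .and, a, b => truth (a ≠ 0 ∧ b ≠ 0)
  | .or, a, b => truth (a ≠ 0 ∨ b ≠ 0)

/-- The value of an expression under a stack. -/
noncomputable def Expr.eval {S : Sig} (s : Stack S) : {τ : Ty} → Expr S τ → τ.Val
  | _, .num n => (n : ℤ)
  | _, .var x => s.get x
  | _, .unop o a => o.eval (a.eval s)
  | _, .binop o a b => o.eval (a.eval s) (b.eval s)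
  | _, .eq a b => truth (a.eval s = b.eval s)
  | _, .ne a b => truth (a.eval s ≠ b.eval s)
  | _, .null => (0 : ℕ)
  | _, .defObj => S.defObj
  | _, .ctor c args => Ty.mkCtor c fun j => (args j).eval s
  | _, .sel (fld := fld) c j a => Ty.select (fld := fld) c j (a.eval s)
  | _, .isCtor c a => truth (Sigma.fst (a.eval s) = c)

/-- The truth value of an integer expression. -/
def Expr.Holds {S : Sig} (s : Stack S) (e : Expr S .int) : Prop := e.eval s ≠ (0 : ℤ)

/-- A heap is a sequence of objects; the object at address `a` is the entry with index `a - 1`. -/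
abbrev Heap (S : Sig) : Type := List S.obj.Val

/-- The heap after an allocation; the address of the new object is `h.length + 1`. -/
def Heap.allocate {S : Sig} (h : Heap S) (o : S.obj.Val) : Heap S × ℕ := (h ++ [o], h.length + 1)

def Heap.read {S : Sig} (h : Heap S) (a : ℕ) : S.obj.Val :=
  if ha : 0 < a ∧ a ≤ h.length then h[a - 1]'(by omega) else S.defObj

def Heap.write {S : Sig} (h : Heap S) (a : ℕ) (o : S.obj.Val) : Heap S :=
  if 0 < a ∧ a ≤ h.length then List.set h (a - 1) o else h

/-- Tuples of arguments for a predicate symbol. -/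
abbrev Sig.Args (S : Sig) (P : S.Pred) : Type := ∀ i, (S.argTy P i).Val

/-- An interpretation of the uninterpreted predicates. -/
abbrev Interp (S : Sig) : Type := (P : S.Pred) → Set (S.Args P)

/-- `ok` is success, `fail P v` is a failed assertion of `P(v)`, and `failF` is a failed assertion
of an expression. -/
inductive Outcome (S : Sig) : Type
  | ok
  | failF
  | fail (P : S.Pred) (v : S.Args P)

/-- Outcomes other than success. -/
def Outcome.IsError {S : Sig} : Outcome S → Prop
  | .ok => False
  | .failF => True
  | .fail _ _ => True

/-- A value together with its type. -/
abbrev AnyVal : Type := Σ τ : Ty, τ.Val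

/-- The arguments of a predicate, as a list. -/
def Sig.argList {S : Sig} {P : S.Pred} (v : S.Args P) : List AnyVal :=
  List.ofFn fun i => (⟨S.argTy P i, v i⟩ : AnyVal)

/-- The values of the arguments of a predicate. -/
noncomputable def evalArgs {S : Sig} (s : Stack S) {P : S.Pred}
    (es : ∀ i, Expr S (S.argTy P i)) : S.Args P := fun i => (es i).eval s

/-- Big-step semantics: `BigStep I C s h l σ s' h'` says that executing `C` from `(s, h)` under the
interpretation `I` yields `(σ, s', h')`. The list `l` logs the values to which the operands (right
hand sides, addresses, conditions, predicate arguments) of the executed statements evaluate, in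
the order of execution; it has no influence on the execution. There is no result when an `assume`
is not satisfied or a loop does not terminate. -/
inductive BigStep {S : Sig} (I : Interp S) :
    Stmt S → Stack S → Heap S → List AnyVal → Outcome S → Stack S → Heap S → Prop
  | assign {τ : Ty} (x : S.Var τ) (e : Expr S τ) (s : Stack S) (h : Heap S) :
      BigStep I (.assign x e) s h [⟨τ, e.eval s⟩] .ok (s.set x (e.eval s)) h
  | alloc (p : S.Var .addr) (e : Expr S S.obj) (s : Stack S) (h : Heap S) :
      BigStep I (.alloc p e) s h [⟨S.obj, e.eval s⟩] .ok
        (s.set p (h.allocate (e.eval s)).2) (h.allocate (e.eval s)).1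
  | read (x : S.Var S.obj) (p : S.Var .addr) (s : Stack S) (h : Heap S) :
      BigStep I (.read x p) s h [⟨.addr, s.get p⟩] .ok (s.set x (h.read (s.get p))) h
  | write (p : S.Var .addr) (e : Expr S S.obj) (s : Stack S) (h : Heap S) :
      BigStep I (.write p e) s h [⟨.addr, s.get p⟩, ⟨S.obj, e.eval s⟩] .ok
        s (h.write (s.get p) (e.eval s))
  | skip (s : Stack S) (h : Heap S) : BigStep I .skip s h [] .ok s h
  | seq_error {C D : Stmt S} {s s₁ : Stack S} {h h₁ : Heap S} {l : List AnyVal} {σ : Outcome S} :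
      BigStep I C s h l σ s₁ h₁ → σ.IsError → BigStep I (C ;; D) s h l σ s₁ h₁
  | seq_ok {C D : Stmt S} {s s₁ s₂ : Stack S} {h h₁ h₂ : Heap S} {l₁ l₂ : List AnyVal}
      {σ : Outcome S} :
      BigStep I C s h l₁ .ok s₁ h₁ → BigStep I D s₁ h₁ l₂ σ s₂ h₂ →
      BigStep I (C ;; D) s h (l₁ ++ l₂) σ s₂ h₂
  | ite_true {e : Expr S .int} {C D : Stmt S} {s s' : Stack S} {h h' : Heap S} {l : List AnyVal}
      {σ : Outcome S} :
      e.Holds s → BigStep I C s h l σ s' h' →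
      BigStep I (.ite e C D) s h (⟨.int, e.eval s⟩ :: l) σ s' h'
  | ite_false {e : Expr S .int} {C D : Stmt S} {s s' : Stack S} {h h' : Heap S} {l : List AnyVal}
      {σ : Outcome S} :
      ¬ e.Holds s → BigStep I D s h l σ s' h' →
      BigStep I (.ite e C D) s h (⟨.int, e.eval s⟩ :: l) σ s' h'
  | while_done {e : Expr S .int} {C : Stmt S} {s : Stack S} {h : Heap S} :
      ¬ e.Holds s → BigStep I (.while e C) s h [⟨.int, e.eval s⟩] .ok s h
  | while_error {e : Expr S .int} {C : Stmt S} {s s' : Stack S} {h h' : Heap S} {l : List AnyVal}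
      {σ : Outcome S} :
      e.Holds s → BigStep I C s h l σ s' h' → σ.IsError →
      BigStep I (.while e C) s h (⟨.int, e.eval s⟩ :: l) σ s' h'
  | while_next {e : Expr S .int} {C : Stmt S} {s s₁ s₂ : Stack S} {h h₁ h₂ : Heap S}
      {l₁ l₂ : List AnyVal} {σ : Outcome S} :
      e.Holds s → BigStep I C s h l₁ .ok s₁ h₁ → BigStep I (.while e C) s₁ h₁ l₂ σ s₂ h₂ →
      BigStep I (.while e C) s h (⟨.int, e.eval s⟩ :: (l₁ ++ l₂)) σ s₂ h₂
  | assume {e : Expr S .int} {s : Stack S} {h : Heap S} :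
      e.Holds s → BigStep I (.assume e) s h [⟨.int, e.eval s⟩] .ok s h
  | assert_ok {e : Expr S .int} {s : Stack S} {h : Heap S} :
      e.Holds s → BigStep I (.assert e) s h [⟨.int, e.eval s⟩] .ok s h
  | assert_fail {e : Expr S .int} {s : Stack S} {h : Heap S} :
      ¬ e.Holds s → BigStep I (.assert e) s h [⟨.int, e.eval s⟩] .failF s h
  | assumeP {P : S.Pred} {es : ∀ i, Expr S (S.argTy P i)} {s : Stack S} {h : Heap S} :
      evalArgs s es ∈ I P →
      BigStep I (.assumeP P es) s h (Sig.argList (evalArgs s es)) .ok s h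
  | assertP_ok {P : S.Pred} {es : ∀ i, Expr S (S.argTy P i)} {s : Stack S} {h : Heap S} :
      evalArgs s es ∈ I P →
      BigStep I (.assertP P es) s h (Sig.argList (evalArgs s es)) .ok s h
  | assertP_fail {P : S.Pred} {es : ∀ i, Expr S (S.argTy P i)} {s : Stack S} {h : Heap S} :
      evalArgs s es ∉ I P →
      BigStep I (.assertP P es) s h (Sig.argList (evalArgs s es)) (.fail P (evalArgs s es)) s h

/-- A program is safe if, under some interpretation of the predicates, no execution from the empty
heap ends in an error, whatever the initial stack. -/
def Safe {S : Sig} (p : Stmt S) : Prop :=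
  ∃ I : Interp S, ∀ (s s' : Stack S) (h' : Heap S) (l : List AnyVal) (σ : Outcome S),
    BigStep I p s [] l σ s' h' → ¬ σ.IsError

/-- Two programs are equi-safe if one is safe exactly when the other is. -/
def EquiSafe {S S' : Sig} (p : Stmt S) (q : Stmt S') : Prop := Safe p ↔ Safe q

/-! ### Deterministic programs -/

/-- `Partial I C s h l`: the list `l` is the log of a finite initial part of the execution of `C`
from `(s, h)`. Executions that block or do not terminate have such initial parts, too. -/
inductive Partial {S : Sig} (I : Interp S) : Stmt S → Stack S → Heap S → List AnyVal → Prop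
  | start (C : Stmt S) (s : Stack S) (h : Heap S) : Partial I C s h []
  | complete {C : Stmt S} {s s' : Stack S} {h h' : Heap S} {l : List AnyVal} {σ : Outcome S} :
      BigStep I C s h l σ s' h' → Partial I C s h l
  | assume (e : Expr S .int) (s : Stack S) (h : Heap S) :
      Partial I (.assume e) s h [⟨.int, e.eval s⟩]
  | assumeP (P : S.Pred) (es : ∀ i, Expr S (S.argTy P i)) (s : Stack S) (h : Heap S) :
      Partial I (.assumeP P es) s h (Sig.argList (evalArgs s es))
  | seq_left {C D : Stmt S} {s : Stack S} {h : Heap S} {l : List AnyVal} :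
      Partial I C s h l → Partial I (C ;; D) s h l
  | seq_right {C D : Stmt S} {s s₁ : Stack S} {h h₁ : Heap S} {l₁ l₂ : List AnyVal} :
      BigStep I C s h l₁ .ok s₁ h₁ → Partial I D s₁ h₁ l₂ → Partial I (C ;; D) s h (l₁ ++ l₂)
  | ite_true {e : Expr S .int} {C D : Stmt S} {s : Stack S} {h : Heap S} {l : List AnyVal} :
      e.Holds s → Partial I C s h l → Partial I (.ite e C D) s h (⟨.int, e.eval s⟩ :: l)
  | ite_false {e : Expr S .int} {C D : Stmt S} {s : Stack S} {h : Heap S} {l : List AnyVal} :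
      ¬ e.Holds s → Partial I D s h l → Partial I (.ite e C D) s h (⟨.int, e.eval s⟩ :: l)
  | while_body {e : Expr S .int} {C : Stmt S} {s : Stack S} {h : Heap S} {l : List AnyVal} :
      e.Holds s → Partial I C s h l → Partial I (.while e C) s h (⟨.int, e.eval s⟩ :: l)
  | while_next {e : Expr S .int} {C : Stmt S} {s s₁ : Stack S} {h h₁ : Heap S}
      {l₁ l₂ : List AnyVal} :
      e.Holds s → BigStep I C s h l₁ .ok s₁ h₁ → Partial I (.while e C) s₁ h₁ l₂ →
      Partial I (.while e C) s h (⟨.int, e.eval s⟩ :: (l₁ ++ l₂))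

/-- A program is deterministic with respect to the input variable `inp` if its execution from the
empty heap is determined by the initial value of `inp`: two executions whose initial stacks give
`inp` the same value compute the same values in the same order. -/
def Deterministic {S : Sig} (inp : S.Var .int) (p : Stmt S) : Prop :=
  ∀ (I : Interp S) (s s' : Stack S), s.get inp = s'.get inp →
    ∀ l, Partial I p s [] l ↔ Partial I p s' [] l

/-! ### Syntactic conditions -/

/-- The variable `y` occurs in an expression. -/
def Expr.Occurs {S : Sig} {σ : Ty} (y : S.Var σ) : {τ : Ty} → Expr S τ → Prop
  | _, .num _ => False
  | τ, .var x => (⟨τ, x⟩ : Σ τ, S.Var τ) = ⟨σ, y⟩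
  | _, .unop _ a => a.Occurs y
  | _, .binop _ a b => a.Occurs y ∨ b.Occurs y
  | _, .eq a b => a.Occurs y ∨ b.Occurs y
  | _, .ne a b => a.Occurs y ∨ b.Occurs y
  | _, .null => False
  | _, .defObj => False
  | _, .ctor _ args => ∃ j, (args j).Occurs y
  | _, .sel (fld := _) _ _ a => a.Occurs y
  | _, .isCtor _ a => a.Occurs y

/-- The variable `y` is the target of an assignment, an allocation or a read in a statement. -/
def Stmt.Assigns {S : Sig} {σ : Ty} (y : S.Var σ) : Stmt S → Prop
  | .assign (τ := τ) x _ => (⟨τ, x⟩ : Σ τ, S.Var τ) = ⟨σ, y⟩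
  | .alloc p _ => (⟨_, p⟩ : Σ τ, S.Var τ) = ⟨σ, y⟩
  | .read x _ => (⟨_, x⟩ : Σ τ, S.Var τ) = ⟨σ, y⟩
  | .seq C D => C.Assigns y ∨ D.Assigns y
  | .ite _ C D => C.Assigns y ∨ D.Assigns y
  | .while _ C => C.Assigns y
  | _ => False

/-- In every allocation `p := alloc(e)` of the statement, `p` does not occur in `e`. -/
def Stmt.AllocNormal {S : Sig} : Stmt S → Prop
  | .alloc p e => ¬ e.Occurs p
  | .seq C D => C.AllocNormal ∧ D.AllocNormal
  | .ite _ C D => C.AllocNormal ∧ D.AllocNormal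
  | .while _ C => C.AllocNormal
  | _ => True

/-! ### The RW encoding -/

/-- Addresses are redeclared as integers. -/
abbrev Ty.redeclare : Ty → Ty
  | .int => .int
  | .addr => .int
  | .adt n ar fld => .adt n ar fun c j => (fld c j).redeclare

/-- A value, seen as a value of the redeclared type. -/
def Ty.embed : (τ : Ty) → τ.Val → τ.redeclare.Val
  | .int, v => v
  | .addr, v => Int.ofNat v
  | .adt _ _ fld, v => ⟨v.1, fun j => (fld v.1 j).embed (v.2 j)⟩

/-- The variables of the encoded program: the redeclared variables of the program, the auxiliary
variables of the encoding, and the variables of the macro `havoc` (the source `seed` of arbitrary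
values, and temporaries for the constructor and the fields of an arbitrary data type value). -/
inductive RWVar (S : Sig) : Ty → Type
  | orig {τ : Ty} (x : S.Var τ) : RWVar S τ.redeclare
  | cntAlloc : RWVar S .int
  | cnt : RWVar S .int
  | cntLast : RWVar S .int
  | lastAddr : RWVar S .int
  | t : RWVar S .int
  | seed : RWVar S .int
  | tag : RWVar S .int
  | field {n : ℕ} {ar : Fin (n + 1) → ℕ} (fld : (c : Fin (n + 1)) → Fin (ar c) → Ty)
      (c : Fin (n + 1)) (j : Fin (ar c)) : RWVar S (fld c j).redeclare

/-- The predicates of the encoded program: those of the program, and the new ones `R`, `W`. -/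
inductive RWPred (S : Sig) : Type
  | orig (P : S.Pred)
  | R
  | W

abbrev RWPred.arity {S : Sig} : RWPred S → ℕ
  | .orig P => S.arity P
  | .R => 3
  | .W => 3

/-- `R(in : Int, cnt : Int, cntLast : Int)` and `W(in : Int, cnt : Int, o : Obj)`. -/
abbrev RWPred.argTy {S : Sig} : (P : RWPred S) → Fin P.arity → Ty
  | .orig P => fun i => (S.argTy P i).redeclare
  | .R => (![.int, .int, .int] : Fin 3 → Ty)
  | .W => (![.int, .int, S.obj.redeclare] : Fin 3 → Ty)

/-- The signature of the encoded program. -/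
abbrev Sig.rw (S : Sig) : Sig where
  Var := RWVar S
  Pred := RWPred S
  arity := RWPred.arity
  argTy := RWPred.argTy
  obj := S.obj.redeclare
  defObj := S.obj.embed S.defObj

/-- An expression of the program, with addresses redeclared as integers. -/
def Expr.redeclare {S : Sig} : {τ : Ty} → Expr S τ → Expr S.rw τ.redeclare
  | _, .num n => .num n
  | _, .var x => .var (S := S.rw) (RWVar.orig x)
  | _, .unop o a => .unop o a.redeclare
  | _, .binop o a b => .binop o a.redeclare b.redeclare
  | _, .eq a b => .eq a.redeclare b.redeclare
  | _, .ne a b => .ne a.redeclare b.redeclare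
  | _, .null => .num 0
  | _, .defObj => Expr.defObj (S := S.rw)
  | _, .ctor c args => .ctor c fun j => (args j).redeclare
  | _, .sel (fld := fld) c j a =>
      .sel (S := S.rw) (fld := fun c j => (fld c j).redeclare) c j a.redeclare
  | _, .isCtor (fld := fld) c a =>
      .isCtor (S := S.rw) (fld := fun c j => (fld c j).redeclare) c a.redeclare

section Encoding

variable {S : Sig}

/-- The integer variable `v`, as an expression. -/
def iv (v : RWVar S .int) : Expr S.rw .int := .var (S := S.rw) v

/-- `v := e` for an integer variable `v`. -/
def iassign (v : RWVar S .int) (e : Expr S.rw .int) : Stmt S.rw := .assign (S := S.rw) v e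

/-- The arguments of `R`. -/
def argsR (a b c : Expr S.rw .int) :
    (i : Fin (S.rw.arity RWPred.R)) → Expr S.rw (S.rw.argTy RWPred.R i) :=
  Fin.cons (α := fun i : Fin 3 => Expr S.rw ((![.int, .int, .int] : Fin 3 → Ty) i)) a
    (Fin.cons b (Fin.cons c fun i => i.elim0))

/-- The arguments of `W`. -/
def argsW (a b : Expr S.rw .int) (o : Expr S.rw S.obj.redeclare) :
    (i : Fin (S.rw.arity RWPred.W)) → Expr S.rw (S.rw.argTy RWPred.W i) :=
  Fin.cons (α := fun i : Fin 3 => Expr S.rw ((![.int, .int, S.obj.redeclare] : Fin 3 → Ty) i)) a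
    (Fin.cons b (Fin.cons o fun i => i.elim0))

/-- The macro `havoc(x)` for an integer variable:
```
x := -(seed % 2);  seed := seed / 2;
while seed % 2 = 1 do
  { seed := seed / 2;  x := 2 * x + (seed % 2);  seed := seed / 2 };
seed := seed / 2
```
-/
def havocInt (x : RWVar S .int) : Stmt S.rw :=
  iassign x (.unop .neg (.binop .mod (iv .seed) (.num 2))) ;;
  iassign .seed (.binop .div (iv .seed) (.num 2)) ;;
  .while (.eq (.binop .mod (iv .seed) (.num 2)) (.num 1))
    (iassign .seed (.binop .div (iv .seed) (.num 2)) ;;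
     iassign x (.binop .add (.binop .mul (.num 2) (iv x)) (.binop .mod (iv .seed) (.num 2))) ;;
     iassign .seed (.binop .div (iv .seed) (.num 2))) ;;
  iassign .seed (.binop .div (iv .seed) (.num 2))

/-- The macro `havoc(x)` at a redeclared type. A data type value is obtained by choosing a
constructor and then its arguments. -/
def havoc : (τ : Ty) → RWVar S τ.redeclare → Stmt S.rw
  | .int, x => havocInt x
  | .addr, x => havocInt x
  | .adt n ar fld, x =>
      havocInt .tag ;;
      (List.finRange (n + 1)).foldr
        (fun (c : Fin (n + 1)) rest =>
          .ite (.eq (iv .tag) (.num (c.val : ℤ)))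
            ((List.finRange (ar c)).foldr
              (fun j rest' => havoc (fld c j) (.field fld c j) ;; rest')
              (.assign (S := S.rw) (τ := .adt n ar fun c j => (fld c j).redeclare) x
                (.ctor c fun j => .var (S := S.rw) (RWVar.field fld c j))))
            rest)
        .skip

/-- The statement put at the start of the program:
```
cntAlloc := 0;  cnt := 0;  cntLast := 0;  t := 0;  assert(W(in, 0, defObj))
```
-/
def rwInit (inp : RWVar S .int) : Stmt S.rw :=
  iassign .cntAlloc (.num 0) ;; iassign .cnt (.num 0) ;; iassign .cntLast (.num 0) ;;
  iassign .t (.num 0) ;;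
  .assertP (S := S.rw) RWPred.W (argsW (iv inp) (.num 0) (Expr.defObj (S := S.rw)))

/-- The rewriting of `p := alloc(e)`:
```
cntAlloc := cntAlloc + 1;  p := cntAlloc;  cnt := cnt + 1;  assert(W(in, cnt, e));
if lastAddr = p { cntLast := cnt }
```
-/
def rwAlloc (inp p : RWVar S .int) (e : Expr S.rw S.obj.redeclare) : Stmt S.rw :=
  iassign .cntAlloc (.binop .add (iv .cntAlloc) (.num 1)) ;;
  iassign p (iv .cntAlloc) ;;
  iassign .cnt (.binop .add (iv .cnt) (.num 1)) ;;
  .assertP (S := S.rw) RWPred.W (argsW (iv inp) (iv .cnt) e) ;;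
  .ifThen (.eq (iv .lastAddr) (iv p)) (iassign .cntLast (iv .cnt))

/-- The rewriting of `x := read(p)`:
```
cnt := cnt + 1;
if lastAddr = p then { assert(R(in, cnt, cntLast));  t := cntLast }
else { havoc(t);  assume(R(in, cnt, t)) };
havoc(x);  assume(W(in, t, x))
```
-/
def rwRead (inp : RWVar S .int) (x : RWVar S S.obj.redeclare) (p : RWVar S .int) : Stmt S.rw :=
  iassign .cnt (.binop .add (iv .cnt) (.num 1)) ;;
  .ite (.eq (iv .lastAddr) (iv p))
    (.assertP (S := S.rw) RWPred.R (argsR (iv inp) (iv .cnt) (iv .cntLast)) ;;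
     iassign .t (iv .cntLast))
    (havocInt .t ;;
     .assumeP (S := S.rw) RWPred.R (argsR (iv inp) (iv .cnt) (iv .t))) ;;
  havoc S.obj x ;;
  .assumeP (S := S.rw) RWPred.W (argsW (iv inp) (iv .t) (.var (S := S.rw) x))

/-- The rewriting of `write(p, e)`:
```
cnt := cnt + 1;
if 0 < p ≤ cntAlloc { assert(W(in, cnt, e));  if lastAddr = p { cntLast := cnt } }
```
-/
def rwWrite (inp p : RWVar S .int) (e : Expr S.rw S.obj.redeclare) : Stmt S.rw :=
  iassign .cnt (.binop .add (iv .cnt) (.num 1)) ;;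
  .ifThen (.binop .and (.binop .lt (.num 0) (iv p)) (.binop .le (iv p) (iv .cntAlloc)))
    (.assertP (S := S.rw) RWPred.W (argsW (iv inp) (iv .cnt) e) ;;
     .ifThen (.eq (iv .lastAddr) (iv p)) (iassign .cntLast (iv .cnt)))

/-- The rewriting of all statements of a program. -/
def rwStmt (inp : RWVar S .int) : Stmt S → Stmt S.rw
  | .assign x e => .assign (S := S.rw) (RWVar.orig x) e.redeclare
  | .alloc p e => rwAlloc inp (RWVar.orig p) e.redeclare
  | .read x p => rwRead inp (RWVar.orig x) (RWVar.orig p)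
  | .write p e => rwWrite inp (RWVar.orig p) e.redeclare
  | .skip => .skip
  | .seq C D => rwStmt inp C ;; rwStmt inp D
  | .ite e C D => .ite e.redeclare (rwStmt inp C) (rwStmt inp D)
  | .while e C => .while e.redeclare (rwStmt inp C)
  | .assume e => .assume e.redeclare
  | .assert e => .assert e.redeclare
  | .assumeP P es => .assumeP (S := S.rw) (RWPred.orig P) fun i => (es i).redeclare
  | .assertP P es => .assertP (S := S.rw) (RWPred.orig P) fun i => (es i).redeclare

/-- The RW encoding of the program `p` with input variable `inp`. -/
def encRW (inp : S.Var .int) (p : Stmt S) : Stmt S.rw :=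
  rwInit (RWVar.orig inp) ;; rwStmt (RWVar.orig inp) p

end Encoding

end UPLang

namespace UPLang

/-! ### Stacks -/

section Stack

variable {S : Sig}

/-! Each run of the encoding follows a single address `lastAddr`. At that address the read relation
`R` is asserted, at every other address it is guessed by `havoc` and assumed, and the heap contents
survive only in the predicate `W`, indexed by the number of the heap operation. The two implications
need different arguments, joined by the relation `Matches`, which compares states up to a renaming
`e : ℕ → ℤ` of addresses.

If the encoding is safe under `I`, interpret the predicates of the program by pulling `I` back along
`ℕ → ℤ`. Along a run of the program keep the invariant `Describes`: for every address `q`, the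
object at `q` belongs to `W` at the number of the last operation that wrote to `q`.
`BigStep.follows_or_fails` shows that either the encoding can copy the run for every tracked address
and a suitable seed, or it fails for some tracked address and seed. The decisive case is a read. If
`R` lacks the right write number, tracking the address being read violates the assertion. Otherwise
every run can guess that number and then the object, because a seed can be made to produce any
values (`exists_seed_havoc`). Seeds are composed from the end of the run backwards. An error of the
program thus becomes an error of the encoding.

If the program is safe under `I`, interpret `W` and `R` by its actual writes and reads
(`Interp.push`). By determinism these are functions of the input and the operation number
(`Deterministic.writes_unique`, `Deterministic.reads_unique`), so the guesses in the encoding are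
forced to be right and `simulates` turns a run of the encoding into a run of the program. Initial
values of address variables are the difficulty: an integer such as `-1` is no address. For one
finite run of the encoding take a bound `N` and a bijection `ℕ → ℤ` that is the identity up to `N`
(`exists_bijective_fixing`), and pull the initial stack back along it. Equality tests survive
because the renaming is injective. Allocation, bounds checks and predicate arguments survive because
the addresses that matter there are at most `N`. For the last point, determinism allows a comparison
with the run from default values, in which every address is an initial constant or has been
allocated (`Deterministic.run_bdd`). Allocations are bounded by the length of the log of the
program, and this in turn by the length of the log of the encoding, which is why lower bounds on log
lengths are carried along.

Determinism is stated with logs of partial runs. The machine `Config.step` makes it usable: it gives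
every step a number, and `Deterministic.run_agrees` compares two runs step by step. -/

theorem Stack.get_set_same (s : Stack S) {τ : Ty} (x : S.Var τ) (v : τ.Val) :
    (s.set x v).get x = v := by
  simp [Stack.get, Stack.set]

theorem Stack.get_set_of_ne (s : Stack S) {τ σ : Ty} {x : S.Var τ} {y : S.Var σ} (v : τ.Val)
    (h : (⟨τ, x⟩ : Σ τ, S.Var τ) ≠ ⟨σ, y⟩) : (s.set x v).get y = s.get y := by
  classical
  exact Function.update_of_ne (Ne.symm h) _ _

/-- Executions do not change variables that are not assigned. -/
theorem BigStep.get_of_not_assigns {I : Interp S} {C : Stmt S} {s s' : Stack S} {h h' : Heap S}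
    {l : List AnyVal} {σ : Outcome S} (H : BigStep I C s h l σ s' h') {τ : Ty} (y : S.Var τ)
    (hy : ¬ C.Assigns y) : s'.get y = s.get y := by
  induction H with
  | assign x e s h => exact Stack.get_set_of_ne _ _ hy
  | alloc p e s h => exact Stack.get_set_of_ne _ _ hy
  | read x p s h => exact Stack.get_set_of_ne _ _ hy
  | seq_error _ _ ih => exact ih fun h => hy (Or.inl h)
  | seq_ok _ _ ih₁ ih₂ =>
    exact (ih₂ fun h => hy (Or.inr h)).trans (ih₁ fun h => hy (Or.inl h))
  | ite_true _ _ ih => exact ih fun h => hy (Or.inl h)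
  | ite_false _ _ ih => exact ih fun h => hy (Or.inr h)
  | while_error _ _ _ ih => exact ih hy
  | while_next _ _ _ ih₁ ih₂ => exact (ih₂ hy).trans (ih₁ hy)
  | _ => rfl

theorem truth_ne_zero {q : Prop} : truth q ≠ 0 ↔ q := by
  by_cases h : q <;> simp [truth, h]

end Stack

/-! ### Renaming addresses as integers -/

/-- The value in which every address `a` is replaced by the integer `e a`. -/
def Ty.map (e : ℕ → ℤ) : (τ : Ty) → τ.Val → τ.redeclare.Val
  | .int, v => v
  | .addr, v => e v
  | .adt _ _ fld, v => ⟨v.1, fun j => (fld v.1 j).map e (v.2 j)⟩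

theorem Ty.map_ofNat : ∀ (τ : Ty) (v : τ.Val), τ.map Int.ofNat v = τ.embed v
  | .int, _ => rfl
  | .addr, _ => rfl
  | .adt _ _ fld, v => by
    simp only [Ty.map, Ty.embed]
    congr 1
    funext j
    exact Ty.map_ofNat _ _

theorem Ty.map_injective {e : ℕ → ℤ} (he : Function.Injective e) :
    ∀ τ : Ty, Function.Injective (τ.map e)
  | .int => fun _ _ h => h
  | .addr => fun _ _ h => he h
  | .adt _ _ fld => by
    rintro ⟨c, v⟩ ⟨d, w⟩ h
    simp only [Ty.map] at h
    obtain ⟨rfl, h⟩ := Sigma.mk.inj h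
    congr 1
    funext j
    exact Ty.map_injective he _ (congrFun (eq_of_heq h) j)

/-- Surjectivity is what allows an arbitrary integer stack, with negative values in address
variables, to be read as a stack of the program. -/
theorem Ty.map_surjective {e : ℕ → ℤ} (he : Function.Surjective e) :
    ∀ τ : Ty, Function.Surjective (τ.map e)
  | .int => fun v => ⟨v, rfl⟩
  | .addr => he
  | .adt _ _ fld => by
    rintro ⟨c, v⟩
    choose f hf using fun j => Ty.map_surjective he (fld c j) (v j)
    refine ⟨⟨c, f⟩, ?_⟩
    simp only [Ty.map]
    congr 1
    funext j
    exact hf j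

/-- A selector applied to the wrong constructor returns a default value, whose addresses are `null`;
hence the condition that the renaming fixes `0`. -/
theorem Ty.map_default {e : ℕ → ℤ} (he : e 0 = 0) :
    ∀ τ : Ty, τ.map e τ.default = τ.redeclare.default
  | .int => rfl
  | .addr => he
  | .adt _ _ fld => by
    simp only [Ty.map, Ty.default]
    congr 1
    funext j
    exact Ty.map_default he _

theorem Ty.map_select {e : ℕ → ℤ} (he : e 0 = 0) {n : ℕ} {ar : Fin (n + 1) → ℕ}
    {fld : (c : Fin (n + 1)) → Fin (ar c) → Ty} (c : Fin (n + 1)) (j : Fin (ar c))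
    (v : (Ty.adt n ar fld).Val) :
    (fld c j).map e (Ty.select c j v) =
      Ty.select (fld := fun c j => (fld c j).redeclare) c j ((Ty.adt n ar fld).map e v) := by
  obtain ⟨d, w⟩ := v
  by_cases h : d = c
  · subst h
    simp [Ty.select, Ty.map]
  · simp [Ty.select, Ty.map, h, Ty.map_default he]

/-- Evaluation commutes with renaming addresses. -/
theorem Expr.eval_redeclare {S : Sig} {e : ℕ → ℤ} (he : Function.Injective e) (he0 : e 0 = 0)
    (hdef : S.obj.map e S.defObj = S.obj.embed S.defObj) {s : Stack S} {t : Stack S.rw}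
    {τ : Ty} (a : Expr S τ)
    (h : ∀ {σ : Ty} (y : S.Var σ), a.Occurs y →
      t.get (S := S.rw) (RWVar.orig y) = σ.map e (s.get y)) :
    a.redeclare.eval t = τ.map e (a.eval s) := by
  induction a with
  | num n => rfl
  | var x => exact h x rfl
  | unop o a ih =>
    have := ih fun y hy => h y hy
    simp only [Expr.redeclare, Expr.eval, Ty.map] at this ⊢
    rw [this]
  | binop o a b iha ihb =>
    have ha := iha fun y hy => h y (Or.inl hy)
    have hb := ihb fun y hy => h y (Or.inr hy)
    simp only [Expr.redeclare, Expr.eval, Ty.map] at ha hb ⊢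
    rw [ha, hb]
  | eq a b iha ihb =>
    have ha := iha fun y hy => h y (Or.inl hy)
    have hb := ihb fun y hy => h y (Or.inr hy)
    simp only [Expr.redeclare, Expr.eval, Ty.map]
    -- Addresses can only be compared for equality, so injectivity is all that is needed of the
    -- renaming here.
    rw [ha, hb, (Ty.map_injective he _).eq_iff]
  | ne a b iha ihb =>
    have ha := iha fun y hy => h y (Or.inl hy)
    have hb := ihb fun y hy => h y (Or.inr hy)
    simp only [Expr.redeclare, Expr.eval, Ty.map]
    rw [ha, hb, (Ty.map_injective he _).ne_iff]
  | null => exact he0.symm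
  | defObj => exact hdef.symm
  | ctor c args ih =>
    simp only [Expr.redeclare, Expr.eval, Ty.map, Ty.mkCtor]
    congr 1
    funext j
    exact ih j fun y hy => h y ⟨j, hy⟩
  | sel c j a ih =>
    have := ih fun y hy => h y hy
    simp only [Expr.redeclare, Expr.eval]
    rw [Ty.map_select he0, ← this]
  | isCtor c a ih =>
    have := ih fun y hy => h y hy
    simp only [Expr.redeclare, Expr.eval, Ty.map] at this ⊢
    rw [this]

/-! ### Bounds on the addresses in a value -/

/-- All addresses in the value are at most `N`. -/
def Ty.Bdd (N : ℕ) : (τ : Ty) → τ.Val → Prop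
  | .int, _ => True
  | .addr, v => (show ℕ from v) ≤ N
  | .adt _ _ fld, v => ∀ j, (fld v.1 j).Bdd N (v.2 j)

theorem Ty.Bdd.mono {M N : ℕ} (h : M ≤ N) : ∀ {τ : Ty} {v : τ.Val}, τ.Bdd M v → τ.Bdd N v
  | .int, _, _ => trivial
  | .addr, _, hv => le_trans (show (_ : ℕ) ≤ M from hv) h
  | .adt _ _ _, _, hv => fun j => Ty.Bdd.mono h (hv j)

theorem Ty.exists_bdd : ∀ (τ : Ty) (v : τ.Val), ∃ N, τ.Bdd N v
  | .int, _ => ⟨0, trivial⟩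
  | .addr, v => ⟨v, le_refl (show ℕ from v)⟩
  | .adt _ _ fld, v => by
    choose f hf using fun j => Ty.exists_bdd (fld v.1 j) (v.2 j)
    exact ⟨Finset.univ.sup f, fun j => (hf j).mono (Finset.le_sup (Finset.mem_univ j))⟩

theorem Ty.bdd_default (N : ℕ) : ∀ τ : Ty, τ.Bdd N τ.default
  | .int => trivial
  | .addr => Nat.zero_le N
  | .adt _ _ _ => fun _ => Ty.bdd_default N _

theorem Ty.bdd_select {N : ℕ} {n : ℕ} {ar : Fin (n + 1) → ℕ}
    {fld : (c : Fin (n + 1)) → Fin (ar c) → Ty} (c : Fin (n + 1)) (j : Fin (ar c))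
    {v : (Ty.adt n ar fld).Val} (hv : (Ty.adt n ar fld).Bdd N v) :
    (fld c j).Bdd N (Ty.select c j v) := by
  obtain ⟨d, w⟩ := v
  by_cases h : d = c
  · subst h
    simpa [Ty.select] using hv j
  · simpa [Ty.select, h] using Ty.bdd_default N _

/-- A renaming that fixes the addresses up to `N` does not affect values bounded by `N`. -/
theorem Ty.map_eq_embed {e : ℕ → ℤ} {N : ℕ} (he : ∀ a ≤ N, e a = a) :
    ∀ {τ : Ty} {v : τ.Val}, τ.Bdd N v → τ.map e v = τ.embed v
  | .int, _, _ => rfl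
  | .addr, v, hv => he v hv
  | .adt _ _ fld, v, hv => by
    simp only [Ty.map, Ty.embed]
    congr 1
    funext j
    exact Ty.map_eq_embed he (hv j)

/-- Expressions create no new addresses: there is no arithmetic on them, `null` is `0`, and
selectors return a component or a default value. -/
theorem Expr.bdd_eval {S : Sig} {N : ℕ} (hdef : S.obj.Bdd N S.defObj) {s : Stack S}
    (h : ∀ {σ : Ty} (y : S.Var σ), σ.Bdd N (s.get y)) {τ : Ty} (a : Expr S τ) :
    τ.Bdd N (a.eval s) := by
  induction a with
  | var x => exact h x
  | null => exact Nat.zero_le N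
  | defObj => exact hdef
  | ctor c args ih => exact ih
  | sel c j a ih => exact Ty.bdd_select c j ih
  | _ => trivial

/-- There is a bijection from addresses to integers that fixes any given initial segment. -/
theorem exists_bijective_fixing (N : ℕ) :
    ∃ e : ℕ → ℤ, Function.Bijective e ∧ ∀ a ≤ N, e a = a := by
  -- Beyond `N`, odd offsets enumerate `N + 1, N + 2, …` and even offsets enumerate `-1, -2, …`.
  refine ⟨fun a => if a ≤ N then a else
    if (a - N) % 2 = 1 then N + 1 + (a - N : ℕ) / 2 else -((a - N : ℕ) / 2), ⟨?_, ?_⟩, ?_⟩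
  · intro a b h
    simp only at h
    split_ifs at h <;> omega
  · intro z
    rcases lt_or_ge z 0 with hz | hz
    · refine ⟨N + 2 * z.natAbs, ?_⟩
      simp only
      split_ifs <;> omega
    · rcases le_or_gt z N with hN | hN
      · refine ⟨z.natAbs, ?_⟩
        simp only
        split_ifs <;> omega
      · refine ⟨N + 2 * (z.natAbs - N - 1) + 1, ?_⟩
        simp only
        split_ifs <;> omega
  · intro a ha
    simp [ha]

/-! ### Variables of the encoded program -/

section RWVar

variable {S : Sig}

/-- A number that tells apart the kinds of variables of the encoded program. -/
def RWVar.kind : {τ : Ty} → RWVar S τ → ℕ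
  | _, .orig _ => 0
  | _, .cntAlloc => 1
  | _, .cnt => 2
  | _, .cntLast => 3
  | _, .lastAddr => 4
  | _, .t => 5
  | _, .seed => 6
  | _, .tag => 7
  | _, .field _ _ _ => 8

/-- An invariant in `ℕ` separates variables without a case analysis on types of the form
`τ.redeclare`. -/
theorem RWVar.ne_of_kind {τ σ : Ty} {x : RWVar S τ} {y : RWVar S σ} (h : x.kind ≠ y.kind) :
    (⟨τ, x⟩ : Σ τ, S.rw.Var τ) ≠ ⟨σ, y⟩ := by
  intro he
  exact h (congrArg (fun z : Σ τ, RWVar S τ => z.2.kind) he)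

theorem Stack.get_set_of_kind (s : Stack S.rw) {τ σ : Ty} {x : RWVar S τ} {y : RWVar S σ}
    (v : τ.Val) (h : x.kind ≠ y.kind) :
    (Stack.set (S := S.rw) s x v).get (S := S.rw) y = s.get (S := S.rw) y :=
  Stack.get_set_of_ne s v (RWVar.ne_of_kind h)

theorem Stack.get_set_rw_same (s : Stack S.rw) {τ : Ty} (x : RWVar S τ) (v : τ.Val) :
    (Stack.set (S := S.rw) s x v).get (S := S.rw) x = v :=
  Stack.get_set_same (S := S.rw) s x v

/-- The original variable, for a variable that comes from the program. -/
def RWVar.source : {τ : Ty} → RWVar S τ → Option (Σ τ, S.Var τ)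
  | _, .orig (τ := τ) x => some ⟨τ, x⟩
  | _, _ => none

/-- Integer and address variables of the program get the same type after redeclaration, so they are
told apart by recovering the original variable together with its type. -/
theorem RWVar.orig_ne {τ σ : Ty} {x : S.Var τ} {y : S.Var σ}
    (h : (⟨τ, x⟩ : Σ τ, S.Var τ) ≠ ⟨σ, y⟩) :
    (⟨τ.redeclare, RWVar.orig x⟩ : Σ τ, S.rw.Var τ) ≠ ⟨σ.redeclare, RWVar.orig y⟩ := by
  intro he
  have := congrArg (fun z : Σ τ, RWVar S τ => z.2.source) he
  exact h (Option.some.inj this)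

/-- The nesting depth of data types. -/
def Ty.height : Ty → ℕ
  | .int => 0
  | .addr => 0
  | .adt _ _ fld => (Finset.univ.sup fun c => Finset.univ.sup fun j => (fld c j).height) + 1

/-- The height measures which field temporaries a nested `havoc` may overwrite: those for the fields
of a data type are out of reach of the `havoc` of any one of its fields. -/
theorem Ty.height_lt {n : ℕ} {ar : Fin (n + 1) → ℕ}
    (fld : (c : Fin (n + 1)) → Fin (ar c) → Ty) (c : Fin (n + 1)) (j : Fin (ar c)) :
    (fld c j).height < (Ty.adt n ar fld).height := by
  have h₁ := Finset.le_sup (f := fun j => (fld c j).height) (Finset.mem_univ j)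
  have h₂ := Finset.le_sup (f := fun c => Finset.univ.sup fun j => (fld c j).height)
    (Finset.mem_univ c)
  rw [Ty.height]
  exact Nat.lt_succ_of_le (h₁.trans h₂)

/-- The temporaries of `havoc` at types of height at most `d`. -/
def RWVar.IsTemp (d : ℕ) : {τ : Ty} → RWVar S τ → Prop
  | _, .seed => True
  | _, .tag => True
  | _, .field (n := n) (ar := ar) fld _ _ => (Ty.adt n ar fld).height ≤ d
  | _, _ => False

theorem RWVar.IsTemp.mono {d d' : ℕ} (h : d ≤ d') {τ : Ty} {y : RWVar S τ} (hy : y.IsTemp d) :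
    y.IsTemp d' := by
  cases y <;> first | trivial | exact le_trans hy h

theorem RWVar.isTemp_of_kind {d : ℕ} {τ : Ty} {y : RWVar S τ} (h : y.kind = 6) :
    y.IsTemp d := by
  cases y <;> first | exact trivial | cases h

/-- The position of a field temporary among the arguments of the constructor. -/
def RWVar.fieldIdx : {τ : Ty} → RWVar S τ → ℕ
  | _, .field _ _ j => j
  | _, _ => 0

theorem RWVar.field_ne {n : ℕ} {ar : Fin (n + 1) → ℕ}
    (fld : (c : Fin (n + 1)) → Fin (ar c) → Ty) (c : Fin (n + 1)) {j j' : Fin (ar c)}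
    (h : j ≠ j') :
    (⟨(fld c j).redeclare, RWVar.field fld c j⟩ : Σ τ, S.rw.Var τ) ≠
      ⟨(fld c j').redeclare, RWVar.field fld c j'⟩ := by
  intro he
  have := congrArg (fun z : Σ τ, RWVar S τ => z.2.fieldIdx) he
  exact h (Fin.ext this)

end RWVar

/-! ### The macro `havoc` -/

section Havoc

variable {S : Sig}

theorem havocInt_assigns {x : RWVar S .int} {τ : Ty} {y : RWVar S τ}
    (h : (havocInt x).Assigns (S := S.rw) y) :
    (⟨.int, x⟩ : Σ τ, S.rw.Var τ) = ⟨τ, y⟩ ∨ y.IsTemp 0 := by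
  have key : (⟨.int, RWVar.seed⟩ : Σ τ, S.rw.Var τ) = ⟨τ, y⟩ → y.IsTemp 0 := by
    intro he
    exact (congrArg (fun z : Σ τ, RWVar S τ => z.2.IsTemp 0) he).mp trivial
  simp only [havocInt, iassign, Stmt.Assigns] at h
  tauto

/-- This is the frame property of `havoc`. The height bound protects the fields already chosen while
the remaining ones are being chosen; outside `havoc`, it suffices that program variables and
counters are never temporaries. -/
theorem havoc_assigns : ∀ (σ : Ty) (x : RWVar S σ.redeclare) {τ : Ty} {y : RWVar S τ},
    (havoc σ x).Assigns (S := S.rw) y →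
    (⟨σ.redeclare, x⟩ : Σ τ, S.rw.Var τ) = ⟨τ, y⟩ ∨ y.IsTemp σ.height
  | .int, _, _, _, h => havocInt_assigns h
  | .addr, _, _, _, h => havocInt_assigns h
  | .adt n ar fld, x, τ, y, h => by
    rw [havoc] at h
    rcases h with h | h
    · right
      rcases havocInt_assigns h with h | h
      · exact (congrArg (fun z : Σ τ, RWVar S τ => z.2.IsTemp (Ty.adt n ar fld).height) h).mp
          trivial
      · exact h.mono (Nat.zero_le _)
    · have hfld : ∀ c (js : List (Fin (ar c))) (T : Stmt S.rw),
          (js.foldr (fun j rest' => havoc (fld c j) (.field fld c j) ;; rest') T).Assigns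
            (S := S.rw) y → T.Assigns (S := S.rw) y ∨ y.IsTemp (Ty.adt n ar fld).height := by
        intro c js T
        induction js with
        | nil => exact Or.inl
        | cons j js ih =>
          rintro (h | h)
          · right
            rcases havoc_assigns _ _ h with h | h
            · exact (congrArg (fun z : Σ τ, RWVar S τ =>
                z.2.IsTemp (Ty.adt n ar fld).height) h).mp (le_refl _)
            · exact h.mono (Ty.height_lt fld c j).le
          · exact ih h
      generalize List.finRange (n + 1) = cs at h
      induction cs with
      | nil => exact h.elim
      | cons c cs ih =>
        rcases h with h | h
        · exact hfld _ _ _ h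
        · exact ih h

/-- The statement contains no assertions and does not change the heap. -/
def Stmt.Quiet : Stmt S → Prop
  | .seq C D => C.Quiet ∧ D.Quiet
  | .ite _ C D => C.Quiet ∧ D.Quiet
  | .while _ C => C.Quiet
  | .assert _ => False
  | .assertP _ _ => False
  | .alloc _ _ => False
  | .write _ _ => False
  | _ => True

/-- Applied to `havoc`, this disposes of the error cases when nothing is known about the seed. -/
theorem BigStep.eq_of_quiet {I : Interp S} {C : Stmt S} {s s' : Stack S} {h h' : Heap S}
    {l : List AnyVal} {σ : Outcome S} (H : BigStep I C s h l σ s' h') (hC : C.Quiet) :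
    σ = .ok ∧ h' = h := by
  induction H with
  | seq_error _ _ ih => exact ih hC.1
  | seq_ok _ _ ih₁ ih₂ => exact ⟨(ih₂ hC.2).1, (ih₂ hC.2).2.trans (ih₁ hC.1).2⟩
  | ite_true _ _ ih => exact ih hC.1
  | ite_false _ _ ih => exact ih hC.2
  | while_error _ _ _ ih => exact ih hC
  | while_next _ _ _ ih₁ ih₂ => exact ⟨(ih₂ hC).1, (ih₂ hC).2.trans (ih₁ hC).2⟩
  | alloc => exact hC.elim
  | write => exact hC.elim
  | assert_fail => exact hC.elim
  | assertP_fail => exact hC.elim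
  | _ => exact ⟨rfl, rfl⟩

theorem havocInt_quiet (x : RWVar S .int) : (havocInt x).Quiet := by
  simp [havocInt, iassign, Stmt.Quiet]

theorem havoc_quiet : ∀ (σ : Ty) (x : RWVar S σ.redeclare), (havoc σ x).Quiet
  | .int, x => havocInt_quiet x
  | .addr, x => havocInt_quiet x
  | .adt n ar fld, x => by
    rw [havoc]
    refine ⟨havocInt_quiet _, ?_⟩
    induction List.finRange (n + 1) with
    | nil => trivial
    | cons c cs ih =>
      refine ⟨?_, ih⟩
      induction List.finRange (ar c) with
      | nil => trivial
      | cons j js ih' => exact ⟨havoc_quiet _ _, ih'⟩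

variable {I : Interp S.rw} {h : Heap S.rw}

/-- Execution of an integer assignment. -/
theorem BigStep.iassign (v : RWVar S .int) {e : Expr S.rw .int} {s : Stack S.rw} {z : ℤ}
    (hz : e.eval s = z) :
    BigStep I (iassign v e) s h [⟨.int, z⟩] .ok (Stack.set (S := S.rw) s v z) h := by
  subst hz
  exact BigStep.assign (S := S.rw) v e s h

theorem Expr.eval_iv {s : Stack S.rw} {v : RWVar S .int} {z : ℤ}
    (hz : s.get (S := S.rw) v = z) : (iv v).eval s = z :=
  hz

theorem Expr.eval_num (s : Stack S.rw) (z : ℤ) : (Expr.num z : Expr S.rw .int).eval s = z :=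
  rfl

theorem Expr.eval_binop {s : Stack S.rw} {a b : Expr S.rw .int} {x y : ℤ} (o : BinOp)
    (ha : a.eval s = x) (hb : b.eval s = y) : (Expr.binop o a b).eval s = o.eval x y := by
  subst ha hb
  rfl

/-- The loop of `havocInt`. -/
abbrev havocLoop (x : RWVar S .int) : Stmt S.rw :=
  .while (.eq (.binop .mod (iv .seed) (.num 2)) (.num 1))
    (UPLang.iassign .seed (.binop .div (iv .seed) (.num 2)) ;;
     UPLang.iassign x
      (.binop .add (.binop .mul (.num 2) (iv x)) (.binop .mod (iv .seed) (.num 2))) ;;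
     UPLang.iassign .seed (.binop .div (iv .seed) (.num 2)))

/-- The loop of `havocInt` takes the values `u` of its variable and `r` of the seed
to `v` and `r'`. -/
def HavocLoops (I : Interp S.rw) (h : Heap S.rw) (x : RWVar S .int) (u r v r' : ℤ) : Prop :=
  ∀ s : Stack S.rw, s.get (S := S.rw) x = u → s.get (S := S.rw) RWVar.seed = r →
    ∃ l s', BigStep I (havocLoop x) s h l .ok s' h ∧
      s'.get (S := S.rw) x = v ∧ s'.get (S := S.rw) RWVar.seed = r'

theorem holds_seed_odd {s : Stack S.rw} {z : ℤ} (hz : s.get (S := S.rw) RWVar.seed = z) :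
    (Expr.eq (.binop .mod (iv .seed) (.num 2)) (.num 1) : Expr S.rw .int).Holds s ↔
      z % 2 = 1 := by
  subst hz
  exact truth_ne_zero

theorem havocLoops_done (x : RWVar S .int) (v r : ℤ) :
    HavocLoops I h x v (2 * r) v (2 * r) := by
  intro s hx hs
  refine ⟨_, s, BigStep.while_done ?_, hx, hs⟩
  rw [holds_seed_odd hs]
  omega

/-- The lowest bit `1` of the seed tells the loop to go on, the next bit `b` is the digit appended
to `x`, and `r` remains. -/
theorem havocLoops_next (x : RWVar S .int) (hx : x.kind ≠ 6) {u r v r' b : ℤ}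
    (hb : b = 0 ∨ b = 1) (H : HavocLoops I h x (2 * u + b) r v r') :
    HavocLoops I h x u (4 * r + 2 * b + 1) v r' := by
  intro s hu hs
  have hc := (holds_seed_odd hs).mpr (by omega)
  have hx' : (RWVar.seed : RWVar S .int).kind ≠ x.kind := fun h => hx h.symm
  have hx'' : x.kind ≠ (RWVar.seed : RWVar S .int).kind := hx
  have B₁ : BigStep I (UPLang.iassign .seed (.binop .div (iv .seed) (.num 2)))
      s h [⟨.int, (2 * r + b : ℤ)⟩] .ok
      (Stack.set (S := S.rw) s .seed (2 * r + b)) h := by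
    refine BigStep.iassign _ ((Expr.eval_binop .div (Expr.eval_iv hs) (Expr.eval_num _ _)).trans ?_)
    simp only [BinOp.eval]
    change @Eq ℤ _ _
    omega
  have hs₁ := Stack.get_set_rw_same s RWVar.seed (2 * r + b)
  have hu₁ := (Stack.get_set_of_kind s (2 * r + b) hx').trans hu
  generalize Stack.set (S := S.rw) s .seed (2 * r + b) = s₁ at B₁ hs₁ hu₁
  have B₂ : BigStep I (UPLang.iassign x
      (.binop .add (.binop .mul (.num 2) (iv x)) (.binop .mod (iv .seed) (.num 2))))
      s₁ h [⟨.int, (2 * u + b : ℤ)⟩] .ok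
      (Stack.set (S := S.rw) s₁ x (2 * u + b)) h := by
    refine BigStep.iassign _ ((Expr.eval_binop .add 
      (Expr.eval_binop .mul (Expr.eval_num _ _) (Expr.eval_iv hu₁))
      (Expr.eval_binop .mod (Expr.eval_iv hs₁) (Expr.eval_num _ _))).trans ?_)
    simp only [BinOp.eval]
    change @Eq ℤ _ _
    omega
  have hu₂ := Stack.get_set_rw_same s₁ x (2 * u + b)
  have hs₂ := (Stack.get_set_of_kind s₁ (2 * u + b) hx'').trans hs₁
  generalize Stack.set (S := S.rw) s₁ x (2 * u + b) = s₂ at B₂ hs₂ hu₂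
  have B₃ : BigStep I (UPLang.iassign .seed (.binop .div (iv .seed) (.num 2)))
      s₂ h [⟨.int, (r : ℤ)⟩] .ok
      (Stack.set (S := S.rw) s₂ .seed r) h := by
    refine BigStep.iassign _ ((Expr.eval_binop .div (Expr.eval_iv hs₂)
      (Expr.eval_num _ _)).trans ?_)
    simp only [BinOp.eval]
    change @Eq ℤ _ _
    omega
  obtain ⟨l, s', H', h₁, h₂⟩ := H _ ((Stack.get_set_of_kind s₂ r hx').trans hu₂)
    (Stack.get_set_rw_same s₂ RWVar.seed r)
  exact ⟨_, s', BigStep.while_next hc (BigStep.seq_ok B₁ (BigStep.seq_ok B₂ B₃)) H', h₁, h₂⟩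

/-- Integers are read in two's complement: halving with rounding down leads from any `w` to `0` or
`-1`, and the discarded digits `w % 2`, each preceded by a continuation bit, are put in front of the
given seed. Only the sign `u` is left as the initial value. -/
theorem exists_havocLoops (n : ℕ) : ∀ (w : ℤ), w.natAbs ≤ n → ∀ r : ℤ,
    ∃ u r₀ : ℤ, (u = 0 ∨ u = -1) ∧ ∀ {I : Interp S.rw} {h : Heap S.rw} {x : RWVar S .int}
      {v r' : ℤ}, x.kind ≠ 6 → HavocLoops I h x w r v r' → HavocLoops I h x u r₀ v r' := by
  induction n with
  | zero =>
    intro w hw r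
    exact ⟨w, r, Or.inl (by omega), fun _ H => H⟩
  | succ n ih =>
    intro w hw r
    by_cases hw' : w = 0 ∨ w = -1
    · exact ⟨w, r, hw', fun _ H => H⟩
    -- The last digit of `w` is appended last, so its two bits are placed directly before `r`, and
    -- the induction hypothesis produces the leading digits.
    · obtain ⟨u, r₀, hu, H⟩ := ih (w / 2) (by omega) (4 * r + 2 * (w % 2) + 1)
      refine ⟨u, r₀, hu, fun hx H' => H hx (havocLoops_next _ hx (by omega) ?_)⟩
      rwa [show 2 * (w / 2) + w % 2 = w by omega]

/-- With a suitable seed, `havocInt` produces any given value and leaves any given seed. -/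
theorem exists_seed_havocInt (v r' : ℤ) : ∃ r : ℤ, ∀ (I : Interp S.rw) (h : Heap S.rw)
    (x : RWVar S .int), x.kind ≠ 6 → ∀ s : Stack S.rw, s.get (S := S.rw) RWVar.seed = r →
    ∃ l s', BigStep I (havocInt x) s h l .ok s' h ∧
      s'.get (S := S.rw) x = v ∧ s'.get (S := S.rw) RWVar.seed = r' := by
  -- The seed left by the loop is `2 * r'`: its even parity stops the loop, and the final halving
  -- removes that bit.
  obtain ⟨u, r₀, hu, H⟩ := exists_havocLoops (S := S) v.natAbs v le_rfl (2 * r')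
  -- As `u` is `0` or `-1`, the lowest bit of this seed is `-u`, which is the sign that the first
  -- assignment reads.
  refine ⟨2 * r₀ - u, fun I h x hx s hs => ?_⟩
  have hx' : (RWVar.seed : RWVar S .int).kind ≠ x.kind := fun h => hx h.symm
  have hx'' : x.kind ≠ (RWVar.seed : RWVar S .int).kind := hx
  obtain ⟨l, s', B, h₁, h₂⟩ := H hx (havocLoops_done (I := I) (h := h) x v r')
    (Stack.set (S := S.rw) (Stack.set (S := S.rw) s x u) RWVar.seed r₀)
    (by rw [Stack.get_set_of_kind _ _ hx', Stack.get_set_rw_same])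
    (by rw [Stack.get_set_rw_same])
  have B₁ : BigStep I (UPLang.iassign x (.unop .neg (.binop .mod (iv .seed) (.num 2))))
      s h [⟨.int, (u : ℤ)⟩]
      .ok (Stack.set (S := S.rw) s x u) h := by
    refine BigStep.iassign _ ((congrArg UnOp.neg.eval
      (Expr.eval_binop .mod (Expr.eval_iv hs) (Expr.eval_num _ _))).trans ?_)
    simp only [BinOp.eval, UnOp.eval]
    omega
  have B₂ : BigStep I (UPLang.iassign .seed (.binop .div (iv .seed) (.num 2)))
      (Stack.set (S := S.rw) s x u) h [⟨.int, (r₀ : ℤ)⟩] .ok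
      (Stack.set (S := S.rw) (Stack.set (S := S.rw) s x u) .seed r₀) h := by
    refine BigStep.iassign _ ((Expr.eval_binop .div
      (Expr.eval_iv ((Stack.get_set_of_kind s u hx'').trans hs)) (Expr.eval_num _ _)).trans ?_)
    simp only [BinOp.eval]
    change @Eq ℤ _ _
    omega
  have B₃ : BigStep I (UPLang.iassign .seed (.binop .div (iv .seed) (.num 2)))
      s' h [⟨.int, (r' : ℤ)⟩] .ok
      (Stack.set (S := S.rw) s' .seed r') h := by
    refine BigStep.iassign _ ((Expr.eval_binop .div (Expr.eval_iv h₂) (Expr.eval_num _ _)).trans ?_)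
    simp only [BinOp.eval]
    change @Eq ℤ _ _
    omega
  exact ⟨_, _, BigStep.seq_ok B₁ (BigStep.seq_ok B₂ (BigStep.seq_ok B B₃)),
    (Stack.get_set_of_kind s' r' hx').trans h₁, Stack.get_set_rw_same s' RWVar.seed r'⟩

/-- With a suitable seed, `havoc` produces any given value and leaves any given seed. -/
theorem exists_seed_havoc : ∀ (τ : Ty) (v : τ.redeclare.Val) (r' : ℤ), ∃ r : ℤ,
    ∀ (I : Interp S.rw) (h : Heap S.rw) (x : RWVar S τ.redeclare), ¬ x.IsTemp τ.height →
    ∀ s : Stack S.rw, s.get (S := S.rw) RWVar.seed = r →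
    ∃ l s', BigStep I (havoc τ x) s h l .ok s' h ∧
      s'.get (S := S.rw) x = v ∧ s'.get (S := S.rw) RWVar.seed = r'
  | .int, v, r' => by
    obtain ⟨r, H⟩ := exists_seed_havocInt (S := S) v r'
    exact ⟨r, fun I h x hx => H I h x fun hk => hx (RWVar.isTemp_of_kind hk)⟩
  | .addr, v, r' => by
    obtain ⟨r, H⟩ := exists_seed_havocInt (S := S) v r'
    exact ⟨r, fun I h x hx => H I h x fun hk => hx (RWVar.isTemp_of_kind hk)⟩
  | .adt n ar fld, ⟨c, w⟩, r' => by
    -- The statement `T` after the fields is kept general because the fold nests to the right. The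
    -- seed is found from the last field to the first, each field leaving the seed that the rest
    -- needs. The clause on `j ∉ js` says that fields chosen earlier are kept.
    have hfields : ∀ js : List (Fin (ar c)), js.Nodup → ∃ r : ℤ, ∀ (I : Interp S.rw)
        (h : Heap S.rw) (s : Stack S.rw), s.get (S := S.rw) RWVar.seed = r → ∃ s' : Stack S.rw,
        s'.get (S := S.rw) RWVar.seed = r' ∧
        (∀ j ∈ js, s'.get (S := S.rw) (RWVar.field fld c j) = w j) ∧
        (∀ j ∉ js, s'.get (S := S.rw) (RWVar.field fld c j) =
          s.get (S := S.rw) (RWVar.field fld c j)) ∧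
        ∀ T l s'', BigStep I T s' h l .ok s'' h → ∃ l', BigStep I
          (js.foldr (fun j rest' => havoc (fld c j) (.field fld c j) ;; rest') T)
          s h l' .ok s'' h := by
      intro js
      induction js with
      | nil =>
        exact fun _ => ⟨r', fun I h s hs => ⟨s, hs, by simp, fun _ _ => rfl,
          fun T l s'' B => ⟨l, B⟩⟩⟩
      | cons j js ih =>
        intro hnd
        obtain ⟨hj, hnd⟩ := List.nodup_cons.mp hnd
        obtain ⟨r₁, H₁⟩ := ih hnd
        obtain ⟨r, H⟩ := exists_seed_havoc (fld c j) (w j) r₁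
        refine ⟨r, fun I h s hs => ?_⟩
        -- The temporary is admissible as a target because it belongs to a type of greater height
        -- than the field itself.
        obtain ⟨l₁, s₁, B₁, hv, hr⟩ := H I h (.field fld c j)
          (fun hle => absurd (Ty.height_lt fld c j) (not_lt.mpr hle)) s hs
        obtain ⟨s₂, hr₂, hin, hout, B₂⟩ := H₁ I h s₁ hr
        refine ⟨s₂, hr₂, ?_, ?_, ?_⟩
        · intro k hk
          rcases List.mem_cons.mp hk with rfl | hk
          · rw [hout _ hj, hv]
          · exact hin k hk
        · intro k hk
          rw [List.mem_cons, not_or] at hk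
          rw [hout k hk.2]
          refine B₁.get_of_not_assigns (S := S.rw) _ fun hA => ?_
          rcases havoc_assigns _ _ hA with hA | hA
          · exact RWVar.field_ne fld c (Ne.symm hk.1) hA
          · exact absurd (Ty.height_lt fld c j) (not_lt.mpr hA)
        · intro T l s'' B
          obtain ⟨l', B'⟩ := B₂ T l s'' B
          exact ⟨_, BigStep.seq_ok B₁ B'⟩
    obtain ⟨r₁, H₁⟩ := hfields (List.finRange (ar c)) (List.nodup_finRange _)
    obtain ⟨r, H⟩ := exists_seed_havocInt (S := S) (c.val : ℤ) r₁
    refine ⟨r, fun I h x hx s hs => ?_⟩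
    obtain ⟨l₁, s₁, B₁, htag, hr⟩ := H I h .tag (by simp [RWVar.kind]) s hs
    obtain ⟨s₂, hr₂, hin, -, B₂⟩ := H₁ I h s₁ hr
    obtain ⟨l₂, B₂⟩ := B₂ _ _ _ (BigStep.assign (S := S.rw)
      (τ := .adt n ar fun c j => (fld c j).redeclare) x
      (.ctor c fun j => .var (S := S.rw) (RWVar.field fld c j)) s₂ h)
    -- With `tag` equal to the index of `c`, the cascade of conditionals skips the other
    -- constructors and runs the branch of `c`.
    have hchain : ∀ (b : Fin (n + 1) → Stmt S.rw) (s' : Stack S.rw) (l : List AnyVal),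
        BigStep I (b c) s₁ h l .ok s' h → ∀ cs : List (Fin (n + 1)), c ∈ cs → ∃ l',
        BigStep I (cs.foldr (fun c rest => .ite (.eq (iv .tag) (.num (c.val : ℤ))) (b c) rest)
          .skip) s₁ h l' .ok s' h := by
      intro b s' l B cs
      induction cs with
      | nil => simp
      | cons d cs ih =>
        intro hc
        by_cases hd : d = c
        · subst hd
          refine ⟨_, BigStep.ite_true ?_ B⟩
          simp only [Expr.Holds, Expr.eval, iv, truth_ne_zero]
          exact htag
        · obtain ⟨l', B'⟩ := ih ((List.mem_cons.mp hc).resolve_left (Ne.symm hd))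
          refine ⟨_, BigStep.ite_false ?_ B'⟩
          simp only [Expr.Holds, Expr.eval, iv, truth_ne_zero]
          rw [htag]
          intro he
          exact hd (Fin.ext (Int.ofNat.inj he).symm)
    obtain ⟨l₃, B₃⟩ := hchain (fun c => (List.finRange (ar c)).foldr
      (fun j rest' => havoc (fld c j) (.field fld c j) ;; rest')
      (.assign (S := S.rw) (τ := .adt n ar fun c j => (fld c j).redeclare) x
        (.ctor c fun j => .var (S := S.rw) (RWVar.field fld c j)))) _ _ B₂ (List.finRange (n + 1)) (List.mem_finRange c)
    rw [havoc]
    refine ⟨_, _, BigStep.seq_ok B₁ B₃, ?_, ?_⟩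
    · refine (Stack.get_set_same (S := S.rw) _ _ _).trans ?_
      simp only [Expr.eval, Ty.mkCtor]
      congr 1
      funext j
      exact hin j (List.mem_finRange j)
    · refine (Stack.get_set_of_ne (S := S.rw) _ _ ?_).trans hr₂
      intro he
      exact hx ((congrArg (fun z : Σ τ, RWVar S τ =>
        z.2.IsTemp (Ty.adt n ar fld).height) he).mpr trivial)

end Havoc

/-! ### Heaps -/

section Heap

variable {S : Sig}

/-- The address is allocated. -/
abbrev Heap.Valid (h : Heap S) (a : ℕ) : Prop := 0 < a ∧ a ≤ h.length

theorem Heap.read_allocate (h : Heap S) (o : S.obj.Val) (q : ℕ) :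
    Heap.read (h ++ [o]) q = if q = h.length + 1 then o else h.read q := by
  unfold Heap.read
  split_ifs with h₁ h₂ h₃ h₂ h₃
  · subst h₂
    simp
  · rw [List.getElem_append_left]
  · simp at h₁
    omega
  · simp at h₁
    omega
  · simp at h₁
    omega
  · rfl

theorem Heap.read_write (h : Heap S) (o : S.obj.Val) {a : ℕ} (ha : Heap.Valid h a) (q : ℕ) :
    (h.write a o).read q = if q = a then o else h.read q := by
  unfold Heap.read Heap.write
  unfold Heap.Valid at ha
  simp only [ha, and_self, if_true, List.length_set]
  by_cases hq : q = a
  · subst hq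
    simp [ha]
  · simp only [hq, if_false]
    split_ifs with h₁
    · rw [List.getElem_set_ne]
      omega
    · rfl

theorem Heap.length_write (h : Heap S) (a : ℕ) (o : S.obj.Val) :
    (h.write a o).length = h.length := by
  unfold Heap.write
  split_ifs <;> simp

end Heap

/-! ### Executions of statements that do not use the heap -/

section Exec

variable {S : Sig} {I : Interp S}

/-- Some execution of `C` from `s` succeeds with the stack `s'`. -/
def Runs (I : Interp S) (C : Stmt S) (s s' : Stack S) : Prop :=
  ∃ l, BigStep I C s [] l .ok s' []

/-- Some execution of `C` from `s` ends in an error. -/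
def Errs (I : Interp S) (C : Stmt S) (s : Stack S) : Prop :=
  ∃ l σ s' h', BigStep I C s [] l σ s' h' ∧ σ.IsError

/-- The only execution of `C` from `s` succeeds with the stack `s'`, and logs at least `n`
values. -/
def RunsOnly (I : Interp S) (C : Stmt S) (s s' : Stack S) (n : ℕ) : Prop :=
  ∃ l₀ : List AnyVal, n ≤ l₀.length ∧ ∀ l σ s₁ h₁, BigStep I C s [] l σ s₁ h₁ ↔
    l = l₀ ∧ σ = .ok ∧ s₁ = s' ∧ h₁ = []

theorem RunsOnly.runs {C : Stmt S} {s s' : Stack S} {n : ℕ} (H : RunsOnly I C s s' n) :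
    Runs I C s s' := by
  obtain ⟨l₀, -, H⟩ := H
  exact ⟨l₀, (H _ _ _ _).mpr ⟨rfl, rfl, rfl, rfl⟩⟩

theorem RunsOnly.eq {C : Stmt S} {s s' : Stack S} {n : ℕ} (H : RunsOnly I C s s' n)
    {l : List AnyVal} {σ : Outcome S} {s₁ : Stack S} {h₁ : Heap S}
    (B : BigStep I C s [] l σ s₁ h₁) : n ≤ l.length ∧ σ = .ok ∧ s₁ = s' ∧ h₁ = [] := by
  obtain ⟨l₀, hn, H⟩ := H
  obtain ⟨rfl, h⟩ := (H _ _ _ _).mp B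
  exact ⟨hn, h⟩

theorem Runs.seq {C D : Stmt S} {s s₁ s₂ : Stack S} (h₁ : Runs I C s s₁) (h₂ : Runs I D s₁ s₂) :
    Runs I (C ;; D) s s₂ := by
  obtain ⟨l₁, B₁⟩ := h₁
  obtain ⟨l₂, B₂⟩ := h₂
  exact ⟨_, BigStep.seq_ok B₁ B₂⟩

theorem Runs.seq_errs {C D : Stmt S} {s s₁ : Stack S} (h₁ : Runs I C s s₁) (h₂ : Errs I D s₁) :
    Errs I (C ;; D) s := by
  obtain ⟨l₁, B₁⟩ := h₁
  obtain ⟨l₂, σ, s', h', B₂, hσ⟩ := h₂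
  exact ⟨_, _, _, _, BigStep.seq_ok B₁ B₂, hσ⟩

theorem Errs.seq {C D : Stmt S} {s : Stack S} (H : Errs I C s) : Errs I (C ;; D) s := by
  obtain ⟨l, σ, s', h', B, hσ⟩ := H
  exact ⟨_, _, _, _, BigStep.seq_error B hσ, hσ⟩

theorem Errs.ite_true {e : Expr S .int} {C D : Stmt S} {s : Stack S} (he : e.Holds s)
    (H : Errs I C s) : Errs I (.ite e C D) s := by
  obtain ⟨l, σ, s', h', B, hσ⟩ := H
  exact ⟨_, _, _, _, BigStep.ite_true he B, hσ⟩

theorem Errs.ite_false {e : Expr S .int} {C D : Stmt S} {s : Stack S} (he : ¬ e.Holds s)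
    (H : Errs I D s) : Errs I (.ite e C D) s := by
  obtain ⟨l, σ, s', h', B, hσ⟩ := H
  exact ⟨_, _, _, _, BigStep.ite_false he B, hσ⟩

theorem errs_assertP {P : S.Pred} {es : ∀ i, Expr S (S.argTy P i)} {s : Stack S}
    (h : evalArgs s es ∉ I P) : Errs I (.assertP P es) s :=
  ⟨_, _, _, _, BigStep.assertP_fail h, trivial⟩

theorem runs_assumeP {P : S.Pred} {es : ∀ i, Expr S (S.argTy P i)} {s : Stack S}
    (h : evalArgs s es ∈ I P) : Runs I (.assumeP P es) s s :=
  ⟨_, BigStep.assumeP h⟩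

theorem Runs.ite_true {e : Expr S .int} {C D : Stmt S} {s s' : Stack S} (he : e.Holds s)
    (H : Runs I C s s') : Runs I (.ite e C D) s s' := by
  obtain ⟨l, B⟩ := H
  exact ⟨_, BigStep.ite_true he B⟩

theorem Runs.ite_false {e : Expr S .int} {C D : Stmt S} {s s' : Stack S} (he : ¬ e.Holds s)
    (H : Runs I D s s') : Runs I (.ite e C D) s s' := by
  obtain ⟨l, B⟩ := H
  exact ⟨_, BigStep.ite_false he B⟩

theorem runsOnly_assign {τ : Ty} (x : S.Var τ) {e : Expr S τ} {s : Stack S} {v : τ.Val}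
    (hv : e.eval s = v) : RunsOnly I (.assign x e) s (s.set x v) 1 := by
  subst hv
  refine ⟨[⟨τ, e.eval s⟩], le_rfl, fun l σ s₁ h₁ => ⟨fun B => ?_, ?_⟩⟩
  · cases B
    exact ⟨rfl, rfl, rfl, rfl⟩
  · rintro ⟨rfl, rfl, rfl, rfl⟩
    exact BigStep.assign x e s []

theorem runsOnly_skip (s : Stack S) : RunsOnly I .skip s s 0 := by
  refine ⟨[], le_rfl, fun l σ s₁ h₁ => ⟨fun B => ?_, ?_⟩⟩
  · cases B
    exact ⟨rfl, rfl, rfl, rfl⟩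
  · rintro ⟨rfl, rfl, rfl, rfl⟩
    exact BigStep.skip _ _

/-- The bound is `0` because a predicate without arguments logs nothing. -/
theorem runsOnly_assertP {P : S.Pred} {es : ∀ i, Expr S (S.argTy P i)} {s : Stack S}
    (h : evalArgs s es ∈ I P) : RunsOnly I (.assertP P es) s s 0 := by
  refine ⟨Sig.argList (evalArgs s es), Nat.zero_le _, fun l σ s₁ h₁ => ⟨fun B => ?_, ?_⟩⟩
  · cases B with
    | assertP_ok => exact ⟨rfl, rfl, rfl, rfl⟩
    | assertP_fail h' => exact absurd h h'
  · rintro ⟨rfl, rfl, rfl, rfl⟩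
    exact BigStep.assertP_ok h

theorem RunsOnly.seq {C D : Stmt S} {s s₁ s₂ : Stack S} {m n : ℕ} (H₁ : RunsOnly I C s s₁ m)
    (H₂ : RunsOnly I D s₁ s₂ n) : RunsOnly I (C ;; D) s s₂ (m + n) := by
  obtain ⟨l₁, hm, H₁⟩ := H₁
  obtain ⟨l₂, hn, H₂⟩ := H₂
  refine ⟨l₁ ++ l₂, by simp; omega, fun l σ s' h' => ⟨fun B => ?_, ?_⟩⟩
  · cases B with
    | seq_error B hσ =>
      obtain ⟨-, rfl, -⟩ := (H₁ _ _ _ _).mp B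
      exact hσ.elim
    | seq_ok B₁ B₂ =>
      obtain ⟨rfl, -, rfl, rfl⟩ := (H₁ _ _ _ _).mp B₁
      obtain ⟨rfl, h⟩ := (H₂ _ _ _ _).mp B₂
      exact ⟨rfl, h⟩
  · rintro ⟨rfl, rfl, rfl, rfl⟩
    exact BigStep.seq_ok ((H₁ _ _ _ _).mpr ⟨rfl, rfl, rfl, rfl⟩)
      ((H₂ _ _ _ _).mpr ⟨rfl, rfl, rfl, rfl⟩)

theorem RunsOnly.ite_true {e : Expr S .int} {C D : Stmt S} {s s' : Stack S} {n : ℕ}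
    (he : e.Holds s) (H : RunsOnly I C s s' n) : RunsOnly I (.ite e C D) s s' (n + 1) := by
  obtain ⟨l₀, hn, H⟩ := H
  refine ⟨⟨.int, e.eval s⟩ :: l₀, by simpa using hn, fun l σ s₁ h₁ => ⟨fun B => ?_, ?_⟩⟩
  · cases B with
    | ite_true _ B =>
      obtain ⟨rfl, h⟩ := (H _ _ _ _).mp B
      exact ⟨rfl, h⟩
    | ite_false he' _ => exact absurd he he'
  · rintro ⟨rfl, rfl, rfl, rfl⟩
    exact BigStep.ite_true he ((H _ _ _ _).mpr ⟨rfl, rfl, rfl, rfl⟩)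

theorem RunsOnly.ite_false {e : Expr S .int} {C D : Stmt S} {s s' : Stack S} {n : ℕ}
    (he : ¬ e.Holds s) (H : RunsOnly I D s s' n) : RunsOnly I (.ite e C D) s s' (n + 1) := by
  obtain ⟨l₀, hn, H⟩ := H
  refine ⟨⟨.int, e.eval s⟩ :: l₀, by simpa using hn, fun l σ s₁ h₁ => ⟨fun B => ?_, ?_⟩⟩
  · cases B with
    | ite_true he' _ => exact absurd he' he
    | ite_false _ B =>
      obtain ⟨rfl, h⟩ := (H _ _ _ _).mp B
      exact ⟨rfl, h⟩
  · rintro ⟨rfl, rfl, rfl, rfl⟩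
    exact BigStep.ite_false he ((H _ _ _ _).mpr ⟨rfl, rfl, rfl, rfl⟩)

/-- `if e {C}` when the effect of `C` is known. -/
theorem RunsOnly.ifThen {e : Expr S .int} {C : Stmt S} {s s' : Stack S} {n : ℕ} {q : Prop}
    [Decidable q] (he : e.Holds s ↔ q) (H : q → RunsOnly I C s s' n) :
    RunsOnly I (.ifThen e C) s (if q then s' else s) 1 := by
  have weaken : ∀ {C s s' m}, RunsOnly I C s s' (m + 1) → RunsOnly I C s s' 1 :=
    fun ⟨l, hl, H⟩ => ⟨l, by omega, H⟩
  split_ifs with hq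
  · exact weaken (RunsOnly.ite_true (he.mpr hq) (H hq))
  · exact weaken (RunsOnly.ite_false (fun h => hq (he.mp h)) (runsOnly_skip s))

end Exec

/-! ### Correspondence of states -/

section Matches

variable {S : Sig}

/-- The arguments of the predicate `W`. -/
def wArgs (i k : ℤ) (o : S.obj.redeclare.Val) : S.rw.Args RWPred.W :=
  Fin.cons (α := fun i : Fin 3 => ((![.int, .int, S.obj.redeclare] : Fin 3 → Ty) i).Val) i
    (Fin.cons k (Fin.cons o fun i => i.elim0))

/-- The arguments of the predicate `R`. -/
def rArgs (i k c : ℤ) : S.rw.Args RWPred.R :=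
  Fin.cons (α := fun i : Fin 3 => ((![.int, .int, .int] : Fin 3 → Ty) i).Val) i
    (Fin.cons k (Fin.cons c fun i => i.elim0))

theorem evalArgs_argsW (t : Stack S.rw) (a b : Expr S.rw .int) (o : Expr S.rw S.obj.redeclare) :
    evalArgs t (P := RWPred.W) (argsW a b o) = wArgs (a.eval t) (b.eval t) (o.eval t) := by
  funext i
  change Fin 3 at i
  match i with
  | 0 => rfl
  | 1 => rfl
  | 2 => rfl

theorem evalArgs_argsR (t : Stack S.rw) (a b c : Expr S.rw .int) :
    evalArgs t (P := RWPred.R) (argsR a b c) = rArgs (a.eval t) (b.eval t) (c.eval t) := by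
  funext i
  change Fin 3 at i
  match i with
  | 0 => rfl
  | 1 => rfl
  | 2 => rfl

/-- The state `t` of the encoded program corresponds to the stack `s` and the heap `h` of the
program after `k` heap operations, with addresses renamed by `e`. The encoded program tracks the
address `a`; the latest operation that wrote to an address is given by `last`. -/
structure Matches (e : ℕ → ℤ) (s : Stack S) (h : Heap S) (k : ℕ) (last : ℕ → ℕ) (a : ℕ)
    (t : Stack S.rw) : Prop where
  orig : ∀ {τ : Ty} (x : S.Var τ), t.get (S := S.rw) (RWVar.orig x) = τ.map e (s.get x)
  cntAlloc : t.get (S := S.rw) RWVar.cntAlloc = (h.length : ℤ)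
  cnt : t.get (S := S.rw) RWVar.cnt = (k : ℤ)
  cntLast : t.get (S := S.rw) RWVar.cntLast = (last a : ℤ)
  lastAddr : t.get (S := S.rw) RWVar.lastAddr = e a

/-- The conditions on a renaming of addresses under which expressions keep their values. -/
structure IsRenaming (S : Sig) (e : ℕ → ℤ) : Prop where
  inj : Function.Injective e
  zero : e 0 = 0
  defObj : S.obj.map e S.defObj = S.obj.embed S.defObj

variable {e : ℕ → ℤ} {s : Stack S} {h : Heap S} {k : ℕ} {last : ℕ → ℕ} {a : ℕ}
  {t t' : Stack S.rw}

theorem IsRenaming.eval (he : IsRenaming S e) (M : Matches e s h k last a t) {τ : Ty}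
    (b : Expr S τ) : b.redeclare.eval t = τ.map e (b.eval s) :=
  Expr.eval_redeclare he.inj he.zero he.defObj b fun y _ => M.orig y

theorem IsRenaming.holds (he : IsRenaming S e) (M : Matches e s h k last a t)
    (b : Expr S .int) : b.redeclare.Holds t ↔ b.Holds s := by
  unfold Expr.Holds
  rw [he.eval M b]
  rfl

/-- The kinds up to `4` are exactly the variables that `Matches` constrains; `t`, the seed and the
temporaries may change freely. -/
theorem Matches.of_agree (M : Matches e s h k last a t)
    (H : ∀ {τ : Ty} (y : RWVar S τ), y.kind ≤ 4 →
      t'.get (S := S.rw) y = t.get (S := S.rw) y) : Matches e s h k last a t' where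
  orig x := (H (RWVar.orig x) (Nat.zero_le 4)).trans (M.orig x)
  cntAlloc := (H RWVar.cntAlloc (by simp [RWVar.kind])).trans M.cntAlloc
  cnt := (H RWVar.cnt (by simp [RWVar.kind])).trans M.cnt
  cntLast := (H RWVar.cntLast (by simp [RWVar.kind])).trans M.cntLast
  lastAddr := (H RWVar.lastAddr (by simp [RWVar.kind])).trans M.lastAddr

theorem Matches.of_agree_except (M : Matches e s h k last a t) {τ : Ty} (x : S.Var τ) {v : τ.Val}
    (hx : t'.get (S := S.rw) (RWVar.orig x) = τ.map e v)
    (H : ∀ {σ : Ty} (y : RWVar S σ), y.kind ≤ 4 →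
      (⟨_, RWVar.orig x⟩ : Σ τ, S.rw.Var τ) ≠ ⟨_, y⟩ →
      t'.get (S := S.rw) y = t.get (S := S.rw) y) : Matches e (s.set x v) h k last a t' := by
  have aux : ∀ y : RWVar S .int, y.kind ≠ 0 → y.kind ≤ 4 →
      t'.get (S := S.rw) y = t.get (S := S.rw) y := fun y hy hy' =>
    H y hy' (RWVar.ne_of_kind fun h => hy h.symm)
  refine ⟨fun {σ} y => ?_, ?_, ?_, ?_, ?_⟩
  · by_cases hy : (⟨τ, x⟩ : Σ τ, S.Var τ) = ⟨σ, y⟩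
    · cases hy
      rw [Stack.get_set_same, hx]
    · rw [Stack.get_set_of_ne _ _ hy, H (RWVar.orig y) (Nat.zero_le 4) (RWVar.orig_ne hy), M.orig]
  · exact (aux .cntAlloc (by simp [RWVar.kind]) (by simp [RWVar.kind])).trans M.cntAlloc
  · exact (aux .cnt (by simp [RWVar.kind]) (by simp [RWVar.kind])).trans M.cnt
  · exact (aux .cntLast (by simp [RWVar.kind]) (by simp [RWVar.kind])).trans M.cntLast
  · exact (aux .lastAddr (by simp [RWVar.kind]) (by simp [RWVar.kind])).trans M.lastAddr

theorem Matches.set_orig (M : Matches e s h k last a t) {τ : Ty} (x : S.Var τ) (v : τ.Val) :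
    Matches e (s.set x v) h k last a
      (Stack.set (S := S.rw) t (RWVar.orig x) (τ.map e v)) :=
  M.of_agree_except x (Stack.get_set_same (S := S.rw) _ _ _)
    fun _ _ hy => Stack.get_set_of_ne (S := S.rw) _ _ hy

theorem Matches.set_cnt (M : Matches e s h k last a t) :
    Matches e s h (k + 1) last a (Stack.set (S := S.rw) t RWVar.cnt ((k + 1 : ℕ) : ℤ)) where
  orig x := (Stack.get_set_of_kind _ _ (by simp [RWVar.kind])).trans (M.orig x)
  cntAlloc := (Stack.get_set_of_kind _ _ (by simp [RWVar.kind])).trans M.cntAlloc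
  cnt := Stack.get_set_rw_same _ _ _
  cntLast := (Stack.get_set_of_kind _ _ (by simp [RWVar.kind])).trans M.cntLast
  lastAddr := (Stack.get_set_of_kind _ _ (by simp [RWVar.kind])).trans M.lastAddr

/-- The new heap is arbitrary: `Matches` sees only its length, as the contents are recorded in `W`
alone. -/
theorem Matches.set_cntAlloc (M : Matches e s h k last a t) (h' : Heap S) :
    Matches e s h' k last a (Stack.set (S := S.rw) t RWVar.cntAlloc (h'.length : ℤ)) where
  orig x := (Stack.get_set_of_kind _ _ (by simp [RWVar.kind])).trans (M.orig x)
  cntAlloc := Stack.get_set_rw_same _ _ _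
  cnt := (Stack.get_set_of_kind _ _ (by simp [RWVar.kind])).trans M.cnt
  cntLast := (Stack.get_set_of_kind _ _ (by simp [RWVar.kind])).trans M.cntLast
  lastAddr := (Stack.get_set_of_kind _ _ (by simp [RWVar.kind])).trans M.lastAddr

theorem Matches.update_last (M : Matches e s h k last a t) (q : ℕ) :
    Matches e s h k (Function.update last q k) a
      (if a = q then Stack.set (S := S.rw) t RWVar.cntLast (k : ℤ) else t) := by
  split_ifs with hq
  · subst hq
    exact
    { orig := fun x => (Stack.get_set_of_kind _ _ (by simp [RWVar.kind])).trans (M.orig x)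
      cntAlloc := (Stack.get_set_of_kind _ _ (by simp [RWVar.kind])).trans M.cntAlloc
      cnt := (Stack.get_set_of_kind _ _ (by simp [RWVar.kind])).trans M.cnt
      cntLast := by
        rw [Function.update_self]
        exact Stack.get_set_rw_same _ _ _
      lastAddr := (Stack.get_set_of_kind _ _ (by simp [RWVar.kind])).trans M.lastAddr }
  · exact
    { M with
      cntLast := by
        rw [Function.update_of_ne hq]
        exact M.cntLast }

theorem Matches.of_heap_length (M : Matches e s h k last a t) {h' : Heap S}
    (hh : h'.length = h.length) : Matches e s h' k last a t :=
  { M with cntAlloc := by rw [hh]; exact M.cntAlloc }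

theorem Matches.holds_lastAddr (he : Function.Injective e) (M : Matches e s h k last a t)
    (p : S.Var .addr) :
    (Expr.eq (iv .lastAddr) (iv (RWVar.orig p)) : Expr S.rw .int).Holds t ↔ a = s.get p := by
  have h₁ : (iv (RWVar.orig p)).eval t = e (s.get p) := M.orig p
  have h₂ : (iv (S := S) .lastAddr).eval t = e a := M.lastAddr
  refine truth_ne_zero.trans ?_
  rw [h₁, h₂]
  exact he.eq_iff

theorem Matches.runsOnly_cnt {I : Interp S.rw} (M : Matches e s h k last a t) :
    RunsOnly I (iassign .cnt (.binop .add (iv .cnt) (.num 1))) t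
      (Stack.set (S := S.rw) t RWVar.cnt ((k + 1 : ℕ) : ℤ)) 1 :=
  runsOnly_assign (S := S.rw) _
    ((Expr.eval_binop .add (Expr.eval_iv M.cnt) (Expr.eval_num _ _)).trans
      (by simp only [BinOp.eval]; push_cast; rfl))

end Matches

/-! ### The rewritten heap statements -/

section HeapStatements

variable {S : Sig} {I : Interp S.rw} {e : ℕ → ℤ} {s : Stack S} {h : Heap S} {k : ℕ}
  {last : ℕ → ℕ} {a : ℕ} {t : Stack S.rw}

theorem RunsOnly.mono {S : Sig} {I : Interp S} {C : Stmt S} {s s' : Stack S} {m n : ℕ}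
    (H : RunsOnly I C s s' n) (hmn : m ≤ n) : RunsOnly I C s s' m :=
  let ⟨l, hl, H⟩ := H
  ⟨l, hmn.trans hl, H⟩

theorem Matches.runsOnly_cntLast (he : Function.Injective e) (M : Matches e s h k last a t)
    (p : S.Var .addr) :
    RunsOnly I (.ifThen (.eq (iv .lastAddr) (iv (RWVar.orig p))) (iassign .cntLast (iv .cnt))) t
      (if a = s.get p then Stack.set (S := S.rw) t RWVar.cntLast (k : ℤ) else t) 1 :=
  RunsOnly.ifThen (q := a = (show ℕ from s.get p)) (M.holds_lastAddr he p)
    fun _ => runsOnly_assign (S := S.rw) _ (Expr.eval_iv M.cnt)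

theorem get_seed_ite (q : Prop) [Decidable q] (t : Stack S.rw) (z : ℤ) :
    (if q then Stack.set (S := S.rw) t RWVar.cntLast z else t).get (S := S.rw) RWVar.seed =
      t.get (S := S.rw) RWVar.seed := by
  split_ifs
  · exact Stack.get_set_of_kind _ _ (by simp [RWVar.kind])
  · rfl

/-- The rewritten allocation, in corresponding states. -/
theorem Matches.rwAlloc (he : IsRenaming S e) (M : Matches e s h k last a t)
    (hlen : e (h.length + 1) = (h.length + 1 : ℕ)) (inp : S.Var .int) {p : S.Var .addr}
    {b : Expr S S.obj} (hp : ¬ b.Occurs p) :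
    (wArgs (s.get inp) (k + 1 : ℕ) (S.obj.map e (b.eval s)) ∈ I RWPred.W → ∃ t',
      RunsOnly I (rwAlloc (RWVar.orig inp) (RWVar.orig p) b.redeclare) t t' 1 ∧
      Matches e (s.set p (h.allocate (b.eval s)).2) (h.allocate (b.eval s)).1 (k + 1)
        (Function.update last (h.length + 1) (k + 1)) a t' ∧
      t'.get (S := S.rw) RWVar.seed = t.get (S := S.rw) RWVar.seed) ∧
    (wArgs (s.get inp) (k + 1 : ℕ) (S.obj.map e (b.eval s)) ∉ I RWPred.W →
      Errs I (rwAlloc (RWVar.orig inp) (RWVar.orig p) b.redeclare) t) := by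
  have M₁ := M.set_cntAlloc (h.allocate (b.eval s)).1
  have R₁ : RunsOnly I (iassign .cntAlloc (.binop .add (iv .cntAlloc) (.num 1))) t
      (Stack.set (S := S.rw) t RWVar.cntAlloc ((h.allocate (b.eval s)).1.length : ℤ)) 1 :=
    runsOnly_assign (S := S.rw) _
      ((Expr.eval_binop .add (Expr.eval_iv M.cntAlloc) (Expr.eval_num _ _)).trans
        (by simp [BinOp.eval, Heap.allocate]))
  have hs₁ : (Stack.set (S := S.rw) t RWVar.cntAlloc
      ((h.allocate (b.eval s)).1.length : ℤ)).get (S := S.rw) RWVar.seed =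
      t.get (S := S.rw) RWVar.seed := Stack.get_set_of_kind _ _ (by simp [RWVar.kind])
  generalize Stack.set (S := S.rw) t RWVar.cntAlloc
    ((h.allocate (b.eval s)).1.length : ℤ) = t₁ at M₁ R₁ hs₁
  have M₂ := M₁.set_orig p (h.allocate (b.eval s)).2
  -- The encoding stores the plain counter in `p`, so the renaming must fix the new address; this is
  -- `hlen`.
  have R₂ : RunsOnly I (iassign (RWVar.orig p) (iv .cntAlloc)) t₁
      (Stack.set (S := S.rw) t₁ (RWVar.orig p) (Ty.map e .addr (h.allocate (b.eval s)).2)) 1 :=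
    runsOnly_assign (S := S.rw) (RWVar.orig p) ((Expr.eval_iv M₁.cntAlloc).trans
      (by simp only [Heap.allocate, Ty.map, hlen]; simp))
  have hs₂ : (Stack.set (S := S.rw) t₁ (RWVar.orig p)
      (Ty.map e .addr (h.allocate (b.eval s)).2)).get (S := S.rw) RWVar.seed =
      t₁.get (S := S.rw) RWVar.seed := Stack.get_set_of_kind _ _ (by simp [RWVar.kind])
  generalize Stack.set (S := S.rw) t₁ (RWVar.orig p)
    (Ty.map e .addr (h.allocate (b.eval s)).2) = t₂ at M₂ R₂ hs₂
  have M₃ := M₂.set_cnt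
  have R₃ := M₂.runsOnly_cnt (I := I)
  have hs₃ : (Stack.set (S := S.rw) t₂ RWVar.cnt ((k + 1 : ℕ) : ℤ)).get (S := S.rw) RWVar.seed =
      t₂.get (S := S.rw) RWVar.seed := Stack.get_set_of_kind _ _ (by simp [RWVar.kind])
  generalize Stack.set (S := S.rw) t₂ RWVar.cnt ((k + 1 : ℕ) : ℤ) = t₃ at M₃ R₃ hs₃
  have M₄ := M₃.update_last (h.length + 1)
  have R₄ := M₃.runsOnly_cntLast (I := I) he.inj p
  rw [Stack.get_set_same] at R₄
  have hargs : evalArgs t₃ (P := RWPred.W)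
      (argsW (iv (RWVar.orig inp)) (iv .cnt) b.redeclare) =
      wArgs (s.get inp) (k + 1 : ℕ) (S.obj.map e (b.eval s)) := by
    rw [evalArgs_argsW]
    congr 1
    · refine (Expr.eval_iv (M₃.orig inp)).trans ?_
      exact Stack.get_set_of_ne _ _ (by simp)
    · exact Expr.eval_iv M₃.cnt
    -- Here `b` is evaluated after `p` has been overwritten, whereas the program evaluates it
    -- before. The values agree because `p` does not occur in `b`.
    · refine Expr.eval_redeclare he.inj he.zero he.defObj b fun y hy => (M₃.orig y).trans ?_
      rw [Stack.get_set_of_ne]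
      intro hpy
      cases hpy
      exact hp hy
  constructor
  · intro hW
    refine ⟨_, (R₁.seq (R₂.seq (R₃.seq ((runsOnly_assertP (hargs ▸ hW)).seq R₄)))).mono
      (by omega), M₄, ?_⟩
    exact (get_seed_ite _ _ _).trans (hs₃.trans (hs₂.trans hs₁))
  · intro hW
    exact R₁.runs.seq_errs (R₂.runs.seq_errs (R₃.runs.seq_errs
      (errs_assertP (hargs ▸ hW)).seq))

/-- The rewritten write, in corresponding states. -/
theorem Matches.rwWrite (he : IsRenaming S e) (M : Matches e s h k last a t)
    (inp : S.Var .int) (p : S.Var .addr) (b : Expr S S.obj)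
    (hlen : 0 < e (s.get p) ∧ e (s.get p) ≤ h.length ↔
      Heap.Valid h (s.get p)) :
    ((Heap.Valid h (s.get p) →
        wArgs (s.get inp) (k + 1 : ℕ) (S.obj.map e (b.eval s)) ∈ I RWPred.W) → ∃ t',
      RunsOnly I (rwWrite (RWVar.orig inp) (RWVar.orig p) b.redeclare) t t' 2 ∧
      Matches e s (h.write (s.get p) (b.eval s)) (k + 1)
        (if Heap.Valid h (s.get p) then
          Function.update last (s.get p) (k + 1) else last) a t' ∧
      t'.get (S := S.rw) RWVar.seed = t.get (S := S.rw) RWVar.seed) ∧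
    (Heap.Valid h (s.get p) →
      wArgs (s.get inp) (k + 1 : ℕ) (S.obj.map e (b.eval s)) ∉ I RWPred.W →
      Errs I (rwWrite (RWVar.orig inp) (RWVar.orig p) b.redeclare) t) := by
  have M₁ := M.set_cnt
  have R₁ := M.runsOnly_cnt (I := I)
  have hs₁ : (Stack.set (S := S.rw) t RWVar.cnt ((k + 1 : ℕ) : ℤ)).get (S := S.rw) RWVar.seed =
      t.get (S := S.rw) RWVar.seed := Stack.get_set_of_kind _ _ (by simp [RWVar.kind])
  generalize Stack.set (S := S.rw) t RWVar.cnt ((k + 1 : ℕ) : ℤ) = t₁ at M₁ R₁ hs₁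
  have M₂ := M₁.update_last (s.get p)
  have R₂ := M₁.runsOnly_cntLast (I := I) he.inj p
  have hargs : evalArgs t₁ (P := RWPred.W)
      (argsW (iv (RWVar.orig inp)) (iv .cnt) b.redeclare) =
      wArgs (s.get inp) (k + 1 : ℕ) (S.obj.map e (b.eval s)) := by
    rw [evalArgs_argsW]
    congr 1
    · exact Expr.eval_iv (M₁.orig inp)
    · exact Expr.eval_iv M₁.cnt
    · exact he.eval M₁ b
  have hp : (iv (S := S) (RWVar.orig p)).eval t₁ = e (s.get p) := M₁.orig p
  have hc : (Expr.binop .and (.binop .lt (.num 0) (iv (RWVar.orig p)))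
      (.binop .le (iv (RWVar.orig p)) (iv .cntAlloc)) : Expr S.rw .int).Holds t₁ ↔
      Heap.Valid h (s.get p) := by
    rw [← hlen]
    unfold Expr.Holds
    rw [Expr.eval_binop .and (Expr.eval_binop .lt (Expr.eval_num _ _) hp)
      (Expr.eval_binop .le hp (Expr.eval_iv M₁.cntAlloc))]
    simp only [BinOp.eval, truth_ne_zero]
  constructor
  · intro hW
    by_cases hq : Heap.Valid h (s.get p)
    · refine ⟨_, (R₁.seq (RunsOnly.ite_true (hc.mpr hq)
        ((runsOnly_assertP (hargs ▸ hW hq)).seq R₂))).mono (by omega), ?_, ?_⟩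
      · rw [if_pos hq]
        exact M₂.of_heap_length (Heap.length_write _ _ _)
      · exact (get_seed_ite _ _ _).trans hs₁
    · refine ⟨_, (R₁.seq (RunsOnly.ite_false (mt hc.mp hq) (runsOnly_skip _))).mono
        (by omega), ?_, hs₁⟩
      rw [if_neg hq]
      exact M₁.of_heap_length (Heap.length_write _ _ _)
  · intro hq hW
    exact R₁.runs.seq_errs (Errs.ite_true (hc.mpr hq) (errs_assertP (hargs ▸ hW)).seq)

theorem Matches.set_t (M : Matches e s h k last a t) (z : ℤ) :
    Matches e s h k last a (Stack.set (S := S.rw) t RWVar.t z) :=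
  M.of_agree fun y hy => Stack.get_set_of_kind _ _ (by
    intro h
    rw [← h] at hy
    simp [RWVar.kind] at hy)

theorem RWVar.not_isTemp_of_kind {d : ℕ} {τ : Ty} {y : RWVar S τ} (hy : y.kind ≤ 5) :
    ¬ y.IsTemp d := by
  cases y <;> first | exact id | simp [RWVar.kind] at hy

theorem not_havoc_assigns {τ σ : Ty} {x : RWVar S τ.redeclare} {y : RWVar S σ}
    (hy : y.kind ≤ 5) (hxy : (⟨_, x⟩ : Σ τ, S.rw.Var τ) ≠ ⟨_, y⟩) :
    ¬ (havoc τ x).Assigns (S := S.rw) y :=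
  fun h => (havoc_assigns τ x h).elim hxy (RWVar.not_isTemp_of_kind hy)

theorem evalArgs_W_read (M : Matches e s h k last a t) (inp : S.Var .int) {x : S.Var S.obj}
    {c : ℤ} (hc : t.get (S := S.rw) RWVar.t = c) {v : S.obj.redeclare.Val}
    (hv : t.get (S := S.rw) (RWVar.orig x) = v) :
    evalArgs t (P := RWPred.W)
      (argsW (iv (RWVar.orig inp)) (iv .t) (.var (S := S.rw) (RWVar.orig x))) =
      wArgs (s.get inp) c v := by
  rw [evalArgs_argsW]
  congr 1
  exact Expr.eval_iv (M.orig inp)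

theorem evalArgs_R_read (M : Matches e s h k last a t) (inp : S.Var .int) {v : RWVar S .int}
    {c : ℤ} (hc : t.get (S := S.rw) v = c) :
    evalArgs t (P := RWPred.R) (argsR (iv (RWVar.orig inp)) (iv .cnt) (iv v)) =
      rArgs (s.get inp) k c := by
  rw [evalArgs_argsR]
  congr 1
  · exact Expr.eval_iv (M.orig inp)
  · exact Expr.eval_iv M.cnt

/-- With a suitable seed, the rewritten read produces the object on the heap. -/
theorem exists_seed_rwRead (he : IsRenaming S e) (inp : S.Var .int) {x : S.Var S.obj}
    {p : S.Var .addr} (hinp : (⟨_, x⟩ : Σ τ, S.Var τ) ≠ ⟨_, inp⟩)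
    (hR : rArgs (s.get inp) (k + 1 : ℕ) (last (s.get p)) ∈ I RWPred.R)
    (hW : wArgs (s.get inp) (last (s.get p)) (S.obj.map e (h.read (s.get p))) ∈ I RWPred.W)
    (r' : ℤ) : ∃ r : ℤ, ∀ t, Matches e s h k last a t → t.get (S := S.rw) RWVar.seed = r → ∃ t',
      Runs I (rwRead (RWVar.orig inp) (RWVar.orig x) (RWVar.orig p)) t t' ∧
      Matches e (s.set x (h.read (s.get p))) h (k + 1) last a t' ∧
      t'.get (S := S.rw) RWVar.seed = r' := by
  -- The seeds are chosen backwards: `r₂` yields the object and leaves `r'`, while `r₁` first yields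
  -- the write number and then leaves `r₂`.
  obtain ⟨r₂, H₂⟩ := exists_seed_havoc (S := S) S.obj (S.obj.map e (h.read (s.get p))) r'
  obtain ⟨r₁, H₁⟩ := exists_seed_havocInt (S := S) (last (s.get p)) r₂
  have key : ∀ t, Matches e s h (k + 1) last a t →
      t.get (S := S.rw) RWVar.seed = r₂ → t.get (S := S.rw) RWVar.t = (last (s.get p) : ℤ) →
      ∃ t', Runs I (havoc S.obj (RWVar.orig x) ;; .assumeP (S := S.rw) RWPred.W
        (argsW (iv (RWVar.orig inp)) (iv .t) (.var (S := S.rw) (RWVar.orig x)))) t t' ∧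
      Matches e (s.set x (h.read (s.get p))) h (k + 1) last a t' ∧
      t'.get (S := S.rw) RWVar.seed = r' := by
    intro t M hs ht
    obtain ⟨l, t', B, hx, hs'⟩ := H₂ I [] (RWVar.orig x)
      (RWVar.not_isTemp_of_kind (by simp [RWVar.kind])) t hs
    have M' : Matches e (s.set x (h.read (s.get p))) h (k + 1) last a t' :=
      M.of_agree_except x hx fun y hy hxy =>
        B.get_of_not_assigns (S := S.rw) y (not_havoc_assigns (hy.trans (by omega)) hxy)
    have ht' : t'.get (S := S.rw) RWVar.t = (last (s.get p) : ℤ) :=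
      (B.get_of_not_assigns (S := S.rw) RWVar.t (not_havoc_assigns (by simp [RWVar.kind])
        (RWVar.ne_of_kind (by simp [RWVar.kind])))).trans ht
    refine ⟨t', Runs.seq ⟨l, B⟩ (runs_assumeP ?_), M', hs'⟩
    rw [evalArgs_W_read M' inp ht' hx, Stack.get_set_of_ne _ _ hinp]
    exact hW
  -- At the tracked address `t` is copied from `cntLast`, which consumes no seed, so the required
  -- seed depends on the case.
  by_cases ha : a = s.get p
  · refine ⟨r₂, fun t M hs => ?_⟩
    have M₁ := M.set_cnt
    have R₁ := M.runsOnly_cnt (I := I)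
    have hs₁ : (Stack.set (S := S.rw) t RWVar.cnt ((k + 1 : ℕ) : ℤ)).get (S := S.rw)
      RWVar.seed = r₂ := (Stack.get_set_of_kind _ _ (by simp [RWVar.kind])).trans hs
    generalize Stack.set (S := S.rw) t RWVar.cnt ((k + 1 : ℕ) : ℤ) = t₁ at M₁ R₁ hs₁
    have R₂ : RunsOnly I (iassign .t (iv .cntLast)) t₁
        (Stack.set (S := S.rw) t₁ RWVar.t (last a : ℤ)) 1 :=
      runsOnly_assign (S := S.rw) _ (Expr.eval_iv M₁.cntLast)
    obtain ⟨t', R₃, h'⟩ := key _ (M₁.set_t (last a))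
      ((Stack.get_set_of_kind _ _ (by simp [RWVar.kind])).trans hs₁)
      ((Stack.get_set_rw_same _ _ _).trans (by rw [ha]))
    refine ⟨t', R₁.runs.seq (Runs.seq (Runs.ite_true ((M₁.holds_lastAddr he.inj p).mpr ha)
      (Runs.seq (RunsOnly.runs (runsOnly_assertP ?_)) R₂.runs)) R₃), h'⟩
    rw [evalArgs_R_read M₁ inp M₁.cntLast, ha]
    exact hR
  · refine ⟨r₁, fun t M hs => ?_⟩
    have M₁ := M.set_cnt
    have R₁ := M.runsOnly_cnt (I := I)
    have hs₁ : (Stack.set (S := S.rw) t RWVar.cnt ((k + 1 : ℕ) : ℤ)).get (S := S.rw)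
      RWVar.seed = r₁ := (Stack.get_set_of_kind _ _ (by simp [RWVar.kind])).trans hs
    generalize Stack.set (S := S.rw) t RWVar.cnt ((k + 1 : ℕ) : ℤ) = t₁ at M₁ R₁ hs₁
    obtain ⟨l, t₂, B, ht, hs₂⟩ := H₁ I [] .t (by simp [RWVar.kind]) t₁ hs₁
    have M₂ : Matches e s h (k + 1) last a t₂ := M₁.of_agree fun y hy =>
      B.get_of_not_assigns (S := S.rw) y (not_havoc_assigns (τ := .int) (hy.trans (by omega))
        (RWVar.ne_of_kind (by
          intro h
          rw [← h] at hy
          simp [RWVar.kind] at hy)))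
    obtain ⟨t', R₃, h'⟩ := key _ M₂ hs₂ ht
    refine ⟨t', R₁.runs.seq (Runs.seq (Runs.ite_false (mt (M₁.holds_lastAddr he.inj p).mp ha)
      (Runs.seq ⟨l, B⟩ (runs_assumeP ?_))) R₃), h'⟩
    rw [evalArgs_R_read M₂ inp ht]
    exact hR

/-- The rewritten read fails at the tracked address if the predicate `R` is not as expected. -/
theorem Matches.errs_rwRead (he : IsRenaming S e) (M : Matches e s h k last a t)
    (inp : S.Var .int) (x : S.Var S.obj) {p : S.Var .addr} (ha : a = s.get p)
    (hR : rArgs (s.get inp) (k + 1 : ℕ) (last (s.get p)) ∉ I RWPred.R) :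
    Errs I (rwRead (RWVar.orig inp) (RWVar.orig x) (RWVar.orig p)) t := by
  refine (M.runsOnly_cnt (I := I)).runs.seq_errs (Errs.seq (Errs.ite_true
    ((M.set_cnt.holds_lastAddr he.inj p).mpr ha) (Errs.seq (errs_assertP ?_))))
  rw [evalArgs_R_read M.set_cnt inp M.set_cnt.cntLast, ha]
  exact hR

/-- If the predicates `R` and `W` are as expected, then the rewritten read produces the object on
the heap. -/
theorem Matches.eq_of_rwRead (he : IsRenaming S e) (M : Matches e s h k last a t)
    {inp : S.Var .int} {x : S.Var S.obj} {p : S.Var .addr}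
    (hinp : (⟨_, x⟩ : Σ τ, S.Var τ) ≠ ⟨_, inp⟩)
    (hR : ∀ z : ℤ, rArgs (s.get inp) (k + 1 : ℕ) z ∈ I RWPred.R ↔ z = last (s.get p))
    (hW : ∀ v, wArgs (s.get inp) (last (s.get p)) v ∈ I RWPred.W →
      v = S.obj.map e (h.read (s.get p)))
    {l : List AnyVal} {σ : Outcome S.rw} {t' : Stack S.rw} {h' : Heap S.rw}
    (B : BigStep I (rwRead (RWVar.orig inp) (RWVar.orig x) (RWVar.orig p)) t [] l σ t' h') :
    σ = .ok ∧ h' = [] ∧ 1 ≤ l.length ∧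
      Matches e (s.set x (h.read (s.get p))) h (k + 1) last a t' := by
  have M₁ := M.set_cnt
  have R₁ := M.runsOnly_cnt (I := I)
  generalize Stack.set (S := S.rw) t RWVar.cnt ((k + 1 : ℕ) : ℤ) = t₁ at M₁ R₁
  have key : ∀ {l σ t₂ h₂}, BigStep I (.ite (.eq (iv .lastAddr) (iv (RWVar.orig p)))
      (.assertP (S := S.rw) RWPred.R (argsR (iv (RWVar.orig inp)) (iv .cnt) (iv .cntLast)) ;;
        iassign .t (iv .cntLast))
      (havocInt .t ;; .assumeP (S := S.rw) RWPred.R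
        (argsR (iv (RWVar.orig inp)) (iv .cnt) (iv .t)))) t₁ [] l σ t₂ h₂ →
      σ = .ok ∧ h₂ = [] ∧ t₂.get (S := S.rw) RWVar.t = (last (s.get p) : ℤ) ∧
      Matches e s h (k + 1) last a t₂ := by
    intro l σ t₂ h₂ B
    cases B with
    | ite_true hc B =>
      have ha := (M₁.holds_lastAddr he.inj p).mp hc
      have R₂ : RunsOnly I (iassign .t (iv .cntLast)) t₁
          (Stack.set (S := S.rw) t₁ RWVar.t (last a : ℤ)) 1 :=
        runsOnly_assign (S := S.rw) _ (Expr.eval_iv M₁.cntLast)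
      obtain ⟨-, rfl, rfl, rfl⟩ := ((runsOnly_assertP (by
        rw [evalArgs_R_read M₁ inp M₁.cntLast, ha]
        exact (hR _).mpr rfl)).seq R₂).eq B
      exact ⟨rfl, rfl, (Stack.get_set_rw_same _ _ _).trans (by rw [ha]), M₁.set_t _⟩
    | ite_false hc B =>
      cases B with
      | seq_error B hσ =>
        obtain ⟨rfl, -⟩ := B.eq_of_quiet (havocInt_quiet _)
        exact hσ.elim
      | seq_ok B B' =>
        obtain ⟨-, rfl⟩ := B.eq_of_quiet (havocInt_quiet _)
        cases B' with
        | assumeP hm =>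
        have M₂ : Matches e s h (k + 1) last a t₂ := M₁.of_agree fun y hy =>
          B.get_of_not_assigns (S := S.rw) y (not_havoc_assigns (τ := .int)
            (hy.trans (by omega)) (RWVar.ne_of_kind (by
              intro h
              rw [← h] at hy
              simp [RWVar.kind] at hy)))
        refine ⟨rfl, rfl, ?_, M₂⟩
        rw [evalArgs_R_read M₂ inp rfl] at hm
        -- `havoc` leaves `t` arbitrary, and the assumption of `R` pins it to the right write
        -- number.
        exact (hR _).mp hm
  cases B with
  | seq_error B hσ =>
    obtain ⟨-, rfl, -⟩ := R₁.eq B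
    exact hσ.elim
  | seq_ok B B' =>
    obtain ⟨hl, -, rfl, rfl⟩ := R₁.eq B
    cases B' with
    | seq_error B hσ =>
      obtain ⟨rfl, -⟩ := key B
      exact hσ.elim
    | seq_ok B B' =>
      obtain ⟨-, rfl, ht, M₂⟩ := key B
      cases B' with
      | seq_error B hσ =>
        obtain ⟨rfl, -⟩ := B.eq_of_quiet (havoc_quiet _ _)
        exact hσ.elim
      | seq_ok B B' =>
        obtain ⟨-, rfl⟩ := B.eq_of_quiet (havoc_quiet _ _)
        cases B' with
        | assumeP hm =>
        have ht' := (B.get_of_not_assigns (S := S.rw) RWVar.t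
          (not_havoc_assigns (by simp [RWVar.kind])
            (RWVar.ne_of_kind (by simp [RWVar.kind])))).trans ht
        have horig : t'.get (S := S.rw) (RWVar.orig inp) = (s.get inp : ℤ) :=
          (B.get_of_not_assigns (S := S.rw) (RWVar.orig inp)
            (not_havoc_assigns (by simp [RWVar.kind]) (RWVar.orig_ne hinp))).trans (M₂.orig inp)
        refine ⟨rfl, rfl, by rw [List.length_append]; omega, ?_⟩
        refine M₂.of_agree_except x ?_ fun y hy hxy =>
          B.get_of_not_assigns (S := S.rw) y (not_havoc_assigns (hy.trans (by omega)) hxy)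
        rw [evalArgs_argsW, Expr.eval_iv horig, Expr.eval_iv ht'] at hm
        exact hW _ hm

end HeapStatements

/-! ### The state after initialisation -/

section Initialisation

variable {S : Sig}

/-- The start of the encoded program. -/
theorem matches_rwInit {I : Interp S.rw} {e : ℕ → ℤ} {s : Stack S} {a : ℕ} {t : Stack S.rw}
    (inp : S.Var .int)
    (horig : ∀ {τ : Ty} (x : S.Var τ), t.get (S := S.rw) (RWVar.orig x) = τ.map e (s.get x))
    (hlast : t.get (S := S.rw) RWVar.lastAddr = e a) :
    (wArgs (s.get inp) 0 (S.obj.embed S.defObj) ∈ I RWPred.W → ∃ t',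
      RunsOnly I (rwInit (RWVar.orig inp)) t t' 0 ∧ Matches e s [] 0 (fun _ => 0) a t' ∧
      t'.get (S := S.rw) RWVar.seed = t.get (S := S.rw) RWVar.seed) ∧
    (wArgs (s.get inp) 0 (S.obj.embed S.defObj) ∉ I RWPred.W →
      Errs I (rwInit (RWVar.orig inp)) t) := by
  have R : ∀ (v : RWVar S .int) (t : Stack S.rw), RunsOnly I (iassign v (.num 0)) t
      (Stack.set (S := S.rw) t v (0 : ℤ)) 1 := fun v t =>
    runsOnly_assign (S := S.rw) v (Expr.eval_num t 0)
  have R₁ := R .cntAlloc t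
  have R₂ := R .cnt (Stack.set (S := S.rw) t RWVar.cntAlloc (0 : ℤ))
  have R₃ := R .cntLast (Stack.set (S := S.rw) (Stack.set (S := S.rw) t RWVar.cntAlloc (0 : ℤ))
    RWVar.cnt (0 : ℤ))
  have R₄ := R .t (Stack.set (S := S.rw) (Stack.set (S := S.rw) (Stack.set (S := S.rw) t
    RWVar.cntAlloc (0 : ℤ)) RWVar.cnt (0 : ℤ)) RWVar.cntLast (0 : ℤ))
  obtain ⟨t', ht'⟩ : ∃ t', t' = Stack.set (S := S.rw) (Stack.set (S := S.rw) (Stack.set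
    (S := S.rw) (Stack.set (S := S.rw) t RWVar.cntAlloc (0 : ℤ)) RWVar.cnt (0 : ℤ))
    RWVar.cntLast (0 : ℤ)) RWVar.t (0 : ℤ) := ⟨_, rfl⟩
  rw [← ht'] at R₄
  have other : ∀ {τ : Ty} (y : RWVar S τ), y.kind = 0 ∨ y.kind = 4 ∨ y.kind = 6 →
      t'.get (S := S.rw) y = t.get (S := S.rw) y := by
    intro τ y hy
    rw [ht', Stack.get_set_of_kind, Stack.get_set_of_kind, Stack.get_set_of_kind,
      Stack.get_set_of_kind] <;>
    · intro h
      rw [← h] at hy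
      simp [RWVar.kind] at hy
  have M : Matches e s [] 0 (fun _ => 0) a t' := by
    refine ⟨fun x => (other _ (by simp [RWVar.kind])).trans (horig x), ?_, ?_, ?_,
      (other _ (by simp [RWVar.kind])).trans hlast⟩
    · rw [ht', Stack.get_set_of_kind _ _ (by simp [RWVar.kind]),
        Stack.get_set_of_kind _ _ (by simp [RWVar.kind]),
        Stack.get_set_of_kind _ _ (by simp [RWVar.kind]), Stack.get_set_rw_same]
      rfl
    · rw [ht', Stack.get_set_of_kind _ _ (by simp [RWVar.kind]),
        Stack.get_set_of_kind _ _ (by simp [RWVar.kind]), Stack.get_set_rw_same]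
      rfl
    · rw [ht', Stack.get_set_of_kind _ _ (by simp [RWVar.kind]), Stack.get_set_rw_same]
      rfl
  have hargs : evalArgs t' (P := RWPred.W)
      (argsW (iv (RWVar.orig inp)) (.num 0) (Expr.defObj (S := S.rw))) =
      wArgs (s.get inp) 0 (S.obj.embed S.defObj) := by
    rw [evalArgs_argsW]
    congr 1
    exact Expr.eval_iv (M.orig inp)
  constructor
  · intro hW
    exact ⟨t', (R₁.seq (R₂.seq (R₃.seq (R₄.seq (runsOnly_assertP (hargs ▸ hW)))))).mono
      (Nat.zero_le _), M, other _ (by simp [RWVar.kind])⟩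
  · intro hW
    exact R₁.runs.seq_errs (R₂.runs.seq_errs (R₃.runs.seq_errs (R₄.runs.seq_errs
      (errs_assertP (hargs ▸ hW)))))

end Initialisation

/-! ### Soundness -/

section Soundness

variable {S : Sig}

theorem isRenaming_ofNat (S : Sig) : IsRenaming S Int.ofNat :=
  ⟨fun _ _ => Int.ofNat.inj, rfl, Ty.map_ofNat _ _⟩

/-- The interpretation of the predicates of the program that is given by an interpretation of the
predicates of the encoded program. -/
def Interp.pull (I : Interp S.rw) : Interp S :=
  fun P => {v | (fun i => (S.argTy P i).map Int.ofNat (v i) : S.rw.Args (RWPred.orig P)) ∈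
    I (RWPred.orig P)}

/-- For the input `i`, the predicate `W` describes the heap `h`. -/
def Describes (I : Interp S.rw) (i : ℤ) (last : ℕ → ℕ) (h : Heap S) : Prop :=
  ∀ q : ℕ, wArgs i (last q) (S.obj.map Int.ofNat (h.read q)) ∈ I RWPred.W

/-- Whatever address is tracked, the encoded program can follow the program successfully. -/
def Follows (I : Interp S.rw) (inp : S.Var .int) (C : Stmt S) (s : Stack S) (h : Heap S) (k : ℕ)
    (last : ℕ → ℕ) (s' : Stack S) (h' : Heap S) (k' : ℕ) (last' : ℕ → ℕ) : Prop :=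
  ∀ (a : ℕ) (r' : ℤ), ∃ r : ℤ, ∀ t, Matches Int.ofNat s h k last a t →
    t.get (S := S.rw) RWVar.seed = r → ∃ t', Runs I (rwStmt (RWVar.orig inp) C) t t' ∧
    Matches Int.ofNat s' h' k' last' a t' ∧ t'.get (S := S.rw) RWVar.seed = r'

/-- The encoded program ends in an error for a suitable tracked address and seed. -/
def Fails (I : Interp S.rw) (inp : S.Var .int) (C : Stmt S) (s : Stack S) (h : Heap S) (k : ℕ)
    (last : ℕ → ℕ) : Prop :=
  ∃ (a : ℕ) (r : ℤ), ∀ t, Matches Int.ofNat s h k last a t →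
    t.get (S := S.rw) RWVar.seed = r → Errs I (rwStmt (RWVar.orig inp) C) t

theorem Describes.allocate {I : Interp S.rw} {i : ℤ} {last : ℕ → ℕ} {h : Heap S}
    (H : Describes I i last h) {k : ℕ} {o : S.obj.Val}
    (hW : wArgs i k (S.obj.map Int.ofNat o) ∈ I RWPred.W) :
    Describes I i (Function.update last (h.length + 1) k) (h ++ [o]) := by
  intro q
  rw [Heap.read_allocate, Function.update_apply]
  split_ifs
  · exact hW
  · exact H q

theorem Describes.write {I : Interp S.rw} {i : ℤ} {last : ℕ → ℕ} {h : Heap S}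
    (H : Describes I i last h) {k a : ℕ} {o : S.obj.Val} (ha : Heap.Valid h a)
    (hW : wArgs i k (S.obj.map Int.ofNat o) ∈ I RWPred.W) :
    Describes I i (Function.update last a k) (h.write a o) := by
  intro q
  rw [Heap.read_write _ _ ha, Function.update_apply]
  split_ifs
  · exact hW
  · exact H q

/-! ### Composition of `Follows` and `Fails` -/

section Combine

variable {I : Interp S.rw} {inp : S.Var .int} {C D : Stmt S} {s s₁ s₂ : Stack S}
  {h h₁ h₂ : Heap S} {k k₁ k₂ : ℕ} {last last₁ last₂ : ℕ → ℕ} {b : Expr S .int}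

/-- The second statement is consulted first: the first one has to leave exactly the seed that the
second one needs. This is why `Follows` quantifies over the remaining seed `r'`. -/
theorem Follows.seq (H₁ : Follows I inp C s h k last s₁ h₁ k₁ last₁)
    (H₂ : Follows I inp D s₁ h₁ k₁ last₁ s₂ h₂ k₂ last₂) :
    Follows I inp (C ;; D) s h k last s₂ h₂ k₂ last₂ := by
  intro a r'
  obtain ⟨r₁, H₂⟩ := H₂ a r'
  obtain ⟨r, H₁⟩ := H₁ a r₁
  refine ⟨r, fun t M hs => ?_⟩
  obtain ⟨t₁, R₁, M₁, hs₁⟩ := H₁ t M hs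
  obtain ⟨t₂, R₂, h⟩ := H₂ t₁ M₁ hs₁
  exact ⟨t₂, R₁.seq R₂, h⟩

/-- The later failure dictates the tracked address. The first part accommodates it because `Follows`
holds for every address. -/
theorem Follows.seq_fails (H₁ : Follows I inp C s h k last s₁ h₁ k₁ last₁)
    (H₂ : Fails I inp D s₁ h₁ k₁ last₁) : Fails I inp (C ;; D) s h k last := by
  obtain ⟨a, r', H₂⟩ := H₂
  obtain ⟨r, H₁⟩ := H₁ a r'
  refine ⟨a, r, fun t M hs => ?_⟩
  obtain ⟨t₁, R₁, M₁, hs₁⟩ := H₁ t M hs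
  exact R₁.seq_errs (H₂ t₁ M₁ hs₁)

theorem Fails.seq (H : Fails I inp C s h k last) : Fails I inp (C ;; D) s h k last := by
  obtain ⟨a, r, H⟩ := H
  exact ⟨a, r, fun t M hs => (H t M hs).seq⟩

theorem Follows.ite_true (hb : b.Holds s) (H : Follows I inp C s h k last s₁ h₁ k₁ last₁) :
    Follows I inp (.ite b C D) s h k last s₁ h₁ k₁ last₁ := by
  intro a r'
  obtain ⟨r, H⟩ := H a r'
  refine ⟨r, fun t M hs => ?_⟩
  obtain ⟨t₁, R₁, h⟩ := H t M hs
  exact ⟨t₁, R₁.ite_true (((isRenaming_ofNat S).holds M b).mpr hb), h⟩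

theorem Follows.ite_false (hb : ¬ b.Holds s) (H : Follows I inp D s h k last s₁ h₁ k₁ last₁) :
    Follows I inp (.ite b C D) s h k last s₁ h₁ k₁ last₁ := by
  intro a r'
  obtain ⟨r, H⟩ := H a r'
  refine ⟨r, fun t M hs => ?_⟩
  obtain ⟨t₁, R₁, h⟩ := H t M hs
  exact ⟨t₁, R₁.ite_false (mt ((isRenaming_ofNat S).holds M b).mp hb), h⟩

theorem Fails.ite_true (hb : b.Holds s) (H : Fails I inp C s h k last) :
    Fails I inp (.ite b C D) s h k last := by
  obtain ⟨a, r, H⟩ := H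
  exact ⟨a, r, fun t M hs => (H t M hs).ite_true (((isRenaming_ofNat S).holds M b).mpr hb)⟩

theorem Fails.ite_false (hb : ¬ b.Holds s) (H : Fails I inp D s h k last) :
    Fails I inp (.ite b C D) s h k last := by
  obtain ⟨a, r, H⟩ := H
  exact ⟨a, r, fun t M hs => (H t M hs).ite_false (mt ((isRenaming_ofNat S).holds M b).mp hb)⟩

theorem Follows.while_next (hb : b.Holds s) (H₁ : Follows I inp C s h k last s₁ h₁ k₁ last₁)
    (H₂ : Follows I inp (.while b C) s₁ h₁ k₁ last₁ s₂ h₂ k₂ last₂) :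
    Follows I inp (.while b C) s h k last s₂ h₂ k₂ last₂ := by
  intro a r'
  obtain ⟨r₁, H₂⟩ := H₂ a r'
  obtain ⟨r, H₁⟩ := H₁ a r₁
  refine ⟨r, fun t M hs => ?_⟩
  obtain ⟨t₁, ⟨l₁, B₁⟩, M₁, hs₁⟩ := H₁ t M hs
  obtain ⟨t₂, ⟨l₂, B₂⟩, h⟩ := H₂ t₁ M₁ hs₁
  exact ⟨t₂, ⟨_, BigStep.while_next (((isRenaming_ofNat S).holds M b).mpr hb) B₁ B₂⟩, h⟩

theorem Follows.while_fails (hb : b.Holds s) (H₁ : Follows I inp C s h k last s₁ h₁ k₁ last₁)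
    (H₂ : Fails I inp (.while b C) s₁ h₁ k₁ last₁) : Fails I inp (.while b C) s h k last := by
  obtain ⟨a, r', H₂⟩ := H₂
  obtain ⟨r, H₁⟩ := H₁ a r'
  refine ⟨a, r, fun t M hs => ?_⟩
  obtain ⟨t₁, ⟨l₁, B₁⟩, M₁, hs₁⟩ := H₁ t M hs
  obtain ⟨l₂, σ, t₂, h₂, B₂, hσ⟩ := H₂ t₁ M₁ hs₁
  exact ⟨_, _, _, _, BigStep.while_next (((isRenaming_ofNat S).holds M b).mpr hb) B₁ B₂, hσ⟩

theorem Fails.while (hb : b.Holds s) (H : Fails I inp C s h k last) :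
    Fails I inp (.while b C) s h k last := by
  obtain ⟨a, r, H⟩ := H
  refine ⟨a, r, fun t M hs => ?_⟩
  obtain ⟨l, σ, t', h', B, hσ⟩ := H t M hs
  exact ⟨_, _, _, _, BigStep.while_error (((isRenaming_ofNat S).holds M b).mpr hb) B hσ, hσ⟩

/-- For statements that do not touch the seed, the required seed is the remaining one. -/
theorem follows_of_runs (H : ∀ a t, Matches Int.ofNat s h k last a t → ∃ t',
    Runs I (rwStmt (RWVar.orig inp) C) t t' ∧ Matches Int.ofNat s₁ h₁ k₁ last₁ a t' ∧
    t'.get (S := S.rw) RWVar.seed = t.get (S := S.rw) RWVar.seed) :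
    Follows I inp C s h k last s₁ h₁ k₁ last₁ := by
  refine fun a r' => ⟨r', fun t M hs => ?_⟩
  obtain ⟨t', R, M', hs'⟩ := H a t M
  exact ⟨t', R, M', hs'.trans hs⟩

theorem evalArgs_redeclare {e : ℕ → ℤ} (he : IsRenaming S e) {a : ℕ} {t : Stack S.rw}
    (M : Matches e s h k last a t) {P : S.Pred} (es : ∀ i, Expr S (S.argTy P i)) :
    evalArgs t (P := RWPred.orig P) (fun i => (es i).redeclare) =
      fun i => (S.argTy P i).map e (evalArgs s es i) := by
  funext i
  exact he.eval M (es i)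

end Combine

/-- The encoded program follows the program, or it ends in an error for some choice of the tracked
address. -/
theorem BigStep.follows_or_fails {I : Interp S.rw} {inp : S.Var .int} {C : Stmt S}
    {s s' : Stack S} {h h' : Heap S} {l : List AnyVal} {σ : Outcome S}
    (B : BigStep I.pull C s h l σ s' h') (hinp : ¬ C.Assigns inp) (hC : C.AllocNormal) :
    ∀ (k : ℕ) (last : ℕ → ℕ), Describes I (s.get inp) last h →
      (σ = .ok ∧ ∃ k' last', Describes I (s'.get inp) last' h' ∧
        Follows I inp C s h k last s' h' k' last') ∨ Fails I inp C s h k last := by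
  have he := isRenaming_ofNat S
  induction B with
  | assign x b s h =>
    intro k last W
    refine Or.inl ⟨rfl, k, last, ?_, follows_of_runs fun a t M => ⟨_,
      (runsOnly_assign (S := S.rw) (RWVar.orig x) (he.eval M b)).runs,
      M.set_orig x _, Stack.get_set_of_kind _ _ (by simp [RWVar.kind])⟩⟩
    rwa [Stack.get_set_of_ne _ _ hinp]
  | alloc p b s h =>
    intro k last W
    by_cases hW : wArgs (s.get inp) (k + 1 : ℕ) (S.obj.map Int.ofNat (b.eval s)) ∈ I RWPred.W
    · refine Or.inl ⟨rfl, k + 1, Function.update last (h.length + 1) (k + 1), ?_,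
        follows_of_runs fun a t M => ?_⟩
      · rw [Stack.get_set_of_ne _ _ hinp]
        exact W.allocate hW
      · obtain ⟨t', R, h'⟩ := (M.rwAlloc he rfl inp hC).1 hW
        exact ⟨t', R.runs, h'⟩
    -- An allocation asserts `W` whatever the tracked address and the seed are, so any choice fails.
    · exact Or.inr ⟨0, 0, fun t M _ => (M.rwAlloc he rfl inp hC).2 hW⟩
  | read x p s h =>
    intro k last W
    -- If `R` contains the correct pair, every run can guess it, and `W` holds of the object by the
    -- invariant. If not, the run that tracks the address being read reaches a false assertion.
    by_cases hR : rArgs (s.get inp) (k + 1 : ℕ) (last (s.get p)) ∈ I RWPred.R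
    · refine Or.inl ⟨rfl, k + 1, last, ?_, fun a r' =>
        exists_seed_rwRead he inp hinp hR (W _) r'⟩
      rwa [Stack.get_set_of_ne _ _ hinp]
    · exact Or.inr ⟨s.get p, 0, fun t M _ => M.errs_rwRead he inp x rfl hR⟩
  | write p b s h =>
    intro k last W
    have hlen : 0 < Int.ofNat (s.get p) ∧ Int.ofNat (s.get p) ≤ h.length ↔
        Heap.Valid h (s.get p) :=
      and_congr Int.natCast_pos Int.ofNat_le
    by_cases hW : Heap.Valid h (s.get p) →
        wArgs (s.get inp) (k + 1 : ℕ) (S.obj.map Int.ofNat (b.eval s)) ∈ I RWPred.W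
    · refine Or.inl ⟨rfl, k + 1, if Heap.Valid h (s.get p) then
        Function.update last (s.get p) (k + 1) else last, ?_, follows_of_runs fun a t M => ?_⟩
      · split_ifs with hq
        · exact W.write hq (hW hq)
        · unfold Heap.write
          rwa [if_neg hq]
      · obtain ⟨t', R, h'⟩ := (M.rwWrite he inp p b hlen).1 hW
        exact ⟨t', R.runs, h'⟩
    · rw [Classical.not_imp] at hW
      exact Or.inr ⟨0, 0, fun t M _ => (M.rwWrite he inp p b hlen).2 hW.1 hW.2⟩
  | skip s h =>
    intro k last W
    exact Or.inl ⟨rfl, k, last, W, follows_of_runs fun a t M =>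
      ⟨t, (runsOnly_skip t).runs, M, rfl⟩⟩
  | seq_error _ hσ ih =>
    intro k last W
    rcases ih (fun h => hinp (Or.inl h)) hC.1 k last W with ⟨rfl, -⟩ | H
    · exact hσ.elim
    · exact Or.inr H.seq
  | seq_ok B₁ _ ih₁ ih₂ =>
    intro k last W
    rcases ih₁ (fun h => hinp (Or.inl h)) hC.1 k last W with ⟨-, k₁, last₁, W₁, H₁⟩ | H
    · rcases ih₂ (fun h => hinp (Or.inr h)) hC.2 k₁ last₁ W₁ with ⟨hσ, k₂, last₂, W₂, H₂⟩ | H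
      · exact Or.inl ⟨hσ, k₂, last₂, W₂, H₁.seq H₂⟩
      · exact Or.inr (H₁.seq_fails H)
    · exact Or.inr H.seq
  | ite_true hb _ ih =>
    intro k last W
    rcases ih (fun h => hinp (Or.inl h)) hC.1 k last W with ⟨hσ, k₁, last₁, W₁, H₁⟩ | H
    · exact Or.inl ⟨hσ, k₁, last₁, W₁, H₁.ite_true hb⟩
    · exact Or.inr (H.ite_true hb)
  | ite_false hb _ ih =>
    intro k last W
    rcases ih (fun h => hinp (Or.inr h)) hC.2 k last W with ⟨hσ, k₁, last₁, W₁, H₁⟩ | H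
    · exact Or.inl ⟨hσ, k₁, last₁, W₁, H₁.ite_false hb⟩
    · exact Or.inr (H.ite_false hb)
  | while_done hb =>
    intro k last W
    exact Or.inl ⟨rfl, k, last, W, follows_of_runs fun a t M =>
      ⟨t, ⟨_, BigStep.while_done (mt (he.holds M _).mp hb)⟩, M, rfl⟩⟩
  | while_error hb _ hσ ih =>
    intro k last W
    rcases ih hinp hC k last W with ⟨rfl, -⟩ | H
    · exact hσ.elim
    · exact Or.inr (H.while hb)
  | while_next hb _ _ ih₁ ih₂ =>
    intro k last W
    rcases ih₁ hinp hC k last W with ⟨-, k₁, last₁, W₁, H₁⟩ | H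
    · rcases ih₂ hinp hC k₁ last₁ W₁ with ⟨hσ, k₂, last₂, W₂, H₂⟩ | H
      · exact Or.inl ⟨hσ, k₂, last₂, W₂, H₁.while_next hb H₂⟩
      · exact Or.inr (H₁.while_fails hb H)
    · exact Or.inr (H.while hb)
  | assume hb =>
    intro k last W
    exact Or.inl ⟨rfl, k, last, W, follows_of_runs fun a t M =>
      ⟨t, ⟨_, BigStep.assume ((he.holds M _).mpr hb)⟩, M, rfl⟩⟩
  | assert_ok hb =>
    intro k last W
    exact Or.inl ⟨rfl, k, last, W, follows_of_runs fun a t M =>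
      ⟨t, ⟨_, BigStep.assert_ok ((he.holds M _).mpr hb)⟩, M, rfl⟩⟩
  | assert_fail hb =>
    intro k last W
    exact Or.inr ⟨0, 0, fun t M _ =>
      ⟨_, _, _, _, BigStep.assert_fail (mt (he.holds M _).mp hb), trivial⟩⟩
  | assumeP hP =>
    intro k last W
    refine Or.inl ⟨rfl, k, last, W, follows_of_runs fun a t M =>
      ⟨t, runs_assumeP ?_, M, rfl⟩⟩
    rw [evalArgs_redeclare he M]
    exact hP
  | assertP_ok hP =>
    intro k last W
    refine Or.inl ⟨rfl, k, last, W, follows_of_runs fun a t M =>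
      ⟨t, (runsOnly_assertP ?_).runs, M, rfl⟩⟩
    rw [evalArgs_redeclare he M]
    exact hP
  | assertP_fail hP =>
    intro k last W
    refine Or.inr ⟨0, 0, fun t M _ => errs_assertP ?_⟩
    rw [evalArgs_redeclare he M]
    exact hP

/-- An initial stack of the encoded program. -/
def Stack.encode (s : Stack S) (a r : ℤ) : Stack S.rw := fun v =>
  match v with
  | ⟨_, .orig (τ := τ) x⟩ => τ.map Int.ofNat (s.get x)
  | ⟨_, .lastAddr⟩ => a
  | ⟨_, .seed⟩ => r
  | ⟨τ, _⟩ => τ.default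

/-- If the program is unsafe, so is its encoding. -/
theorem safe_of_safe_encRW {inp : S.Var .int} {p : Stmt S} (hinp : ¬ p.Assigns inp)
    (halloc : p.AllocNormal) (H : Safe (encRW inp p)) : Safe p := by
  obtain ⟨I, H⟩ := H
  refine ⟨I.pull, fun s s' h' l σ B hσ => ?_⟩
  have hsafe : ∀ t, ¬ Errs I (encRW inp p) t := fun t ⟨l, σ, t', h', B, hσ⟩ => H t t' h' l σ B hσ
  have hinit := fun (a : ℕ) (r : ℤ) => matches_rwInit (I := I) (e := Int.ofNat) (s := s) (a := a)
    (t := s.encode a r) inp (fun _ => rfl) rfl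
  have hW : wArgs (s.get inp) 0 (S.obj.embed S.defObj) ∈ I RWPred.W := by
    by_contra hW
    exact hsafe _ ((hinit 0 0).2 hW).seq
  -- On the empty heap every address reads as the default object, so the invariant reduces to the
  -- initial assertion of `W` at number `0`.
  rcases B.follows_or_fails hinp halloc 0 (fun _ => 0) (fun q => by
    rw [show Heap.read [] q = S.defObj from dif_neg (by simp; omega), Ty.map_ofNat]
    exact hW) with ⟨rfl, -⟩ | ⟨a, r, F⟩
  · exact hσ
  · obtain ⟨t', R, M, hs⟩ := (hinit a r).1 hW
    exact hsafe _ (R.runs.seq_errs (F t' M hs))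

end Soundness

/-! ### An abstract machine -/

section Machine

variable {S : Sig}

/-- A configuration: the statements that remain to be executed, the stack, the heap, the log, the
number of heap operations so far, and for each address the number of the latest operation that
wrote to it. -/
structure Config (S : Sig) where
  todo : List (Stmt S)
  stack : Stack S
  heap : Heap S
  log : List AnyVal
  cnt : ℕ
  last : ℕ → ℕ

open Classical in
/-- One step of the machine. When it is stuck, nothing remains to be executed. -/
noncomputable def Config.step (I : Interp S) : Config S → Config S
  | ⟨[], s, h, l, k, w⟩ => ⟨[], s, h, l, k, w⟩
  | ⟨.assign x e :: K, s, h, l, k, w⟩ =>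
      ⟨K, s.set x (e.eval s), h, l ++ [⟨_, e.eval s⟩], k, w⟩
  | ⟨.alloc p e :: K, s, h, l, k, w⟩ =>
      ⟨K, s.set p (h.allocate (e.eval s)).2, (h.allocate (e.eval s)).1,
        l ++ [⟨S.obj, e.eval s⟩], k + 1, Function.update w (h.length + 1) (k + 1)⟩
  | ⟨.read x p :: K, s, h, l, k, w⟩ =>
      ⟨K, s.set x (h.read (s.get p)), h, l ++ [⟨.addr, s.get p⟩], k + 1, w⟩
  | ⟨.write p e :: K, s, h, l, k, w⟩ =>
      ⟨K, s, h.write (s.get p) (e.eval s), l ++ [⟨.addr, s.get p⟩, ⟨S.obj, e.eval s⟩], k + 1,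
        if Heap.Valid h (s.get p) then Function.update w (s.get p) (k + 1) else w⟩
  | ⟨.skip :: K, s, h, l, k, w⟩ => ⟨K, s, h, l, k, w⟩
  | ⟨.seq C D :: K, s, h, l, k, w⟩ => ⟨C :: D :: K, s, h, l, k, w⟩
  | ⟨.ite e C D :: K, s, h, l, k, w⟩ =>
      ⟨(if e.Holds s then C else D) :: K, s, h, l ++ [⟨.int, e.eval s⟩], k, w⟩
  | ⟨.while e C :: K, s, h, l, k, w⟩ =>
      ⟨if e.Holds s then C :: .while e C :: K else K, s, h, l ++ [⟨.int, e.eval s⟩], k, w⟩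
  | ⟨.assume e :: K, s, h, l, k, w⟩ =>
      ⟨if e.Holds s then K else [], s, h, l ++ [⟨.int, e.eval s⟩], k, w⟩
  | ⟨.assert e :: K, s, h, l, k, w⟩ =>
      ⟨if e.Holds s then K else [], s, h, l ++ [⟨.int, e.eval s⟩], k, w⟩
  | ⟨.assumeP P es :: K, s, h, l, k, w⟩ =>
      ⟨if evalArgs s es ∈ I P then K else [], s, h, l ++ Sig.argList (evalArgs s es), k, w⟩
  | ⟨.assertP P es :: K, s, h, l, k, w⟩ =>
      ⟨if evalArgs s es ∈ I P then K else [], s, h, l ++ Sig.argList (evalArgs s es), k, w⟩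

/-- The configuration after `n` steps from the empty heap. -/
noncomputable def Config.run (I : Interp S) (p : Stmt S) (s : Stack S) (n : ℕ) : Config S :=
  (Config.step I)^[n] ⟨[p], s, [], [], 0, fun _ => 0⟩

theorem Config.run_succ (I : Interp S) (p : Stmt S) (s : Stack S) (n : ℕ) :
    Config.run I p s (n + 1) = (Config.run I p s n).step I :=
  Function.iterate_succ_apply' _ _ _

/-- The values that the next step logs. -/
theorem Config.exists_step_log (I : Interp S) (c : Config S) :
    ∃ δ, (c.step I).log = c.log ++ δ := by
  obtain ⟨K, s, h, l, k, w⟩ := c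
  rcases K with _ | ⟨C, K⟩
  · exact ⟨[], by simp [Config.step]⟩
  · cases C <;> first
      | exact ⟨_, rfl⟩
      | exact ⟨[], by simp [Config.step]⟩

theorem Config.iterate_log_prefix (I : Interp S) (c : Config S) (n : ℕ) :
    c.log <+: ((Config.step I)^[n] c).log := by
  induction n generalizing c with
  | zero => exact List.prefix_rfl
  | succ n ih =>
    obtain ⟨δ, hδ⟩ := Config.exists_step_log I c
    exact (show c.log <+: (c.step I).log from ⟨δ, hδ.symm⟩).trans (ih _)

/-- The logs of one run form a chain, so among them a log is determined by its length. -/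
theorem Config.run_log_prefix (I : Interp S) (p : Stmt S) (s : Stack S) {m n : ℕ} (h : m ≤ n) :
    (Config.run I p s m).log <+: (Config.run I p s n).log := by
  obtain ⟨d, rfl⟩ := Nat.exists_eq_add_of_le' h
  unfold Config.run
  rw [Function.iterate_add_apply]
  exact Config.iterate_log_prefix _ _ _

theorem Config.iterate_trans {I : Interp S} {c d f : Config S}
    (h₁ : ∃ n, (Config.step I)^[n] c = d) (h₂ : ∃ n, (Config.step I)^[n] d = f) :
    ∃ n, (Config.step I)^[n] c = f := by
  obtain ⟨m, rfl⟩ := h₁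
  obtain ⟨n, rfl⟩ := h₂
  exact ⟨n + m, Function.iterate_add_apply _ _ _ _⟩

theorem Config.iterate_step {I : Interp S} {c d f : Config S} (h₁ : c.step I = d)
    (h₂ : ∃ n, (Config.step I)^[n] d = f) : ∃ n, (Config.step I)^[n] c = f :=
  Config.iterate_trans ⟨1, h₁⟩ h₂

/-- The machine executes a statement as the big-step semantics does. -/
theorem BigStep.machine {I : Interp S} {C : Stmt S} {s s' : Stack S} {h h' : Heap S}
    {l : List AnyVal} {σ : Outcome S} (B : BigStep I C s h l σ s' h') :
    ∀ (K : List (Stmt S)) (l₀ : List AnyVal) (k : ℕ) (w : ℕ → ℕ), ∃ K' k' w',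
      (∃ n, (Config.step I)^[n] ⟨C :: K, s, h, l₀, k, w⟩ = ⟨K', s', h', l₀ ++ l, k', w'⟩) ∧
      (σ = .ok → K' = K) := by
  induction B with
  | skip s h => exact fun K l₀ k w => ⟨K, k, w, ⟨1, by simp [Config.step]⟩, fun _ => rfl⟩
  | seq_error B hσ ih =>
    intro K l₀ k w
    obtain ⟨K', k', w', hn, -⟩ := ih (_ :: K) l₀ k w
    refine ⟨K', k', w', Config.iterate_step rfl hn, ?_⟩
    rintro rfl
    exact hσ.elim
  | seq_ok B₁ B₂ ih₁ ih₂ =>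
    intro K l₀ k w
    obtain ⟨_, k₁, w₁, hn₁, hK⟩ := ih₁ (_ :: K) l₀ k w
    obtain rfl := hK rfl
    obtain ⟨K', k', w', hn₂, hK⟩ := ih₂ K _ k₁ w₁
    rw [List.append_assoc] at hn₂
    exact ⟨K', k', w', Config.iterate_step rfl (Config.iterate_trans hn₁ hn₂), hK⟩
  | ite_true he B ih =>
    intro K l₀ k w
    obtain ⟨K', k', w', hn, hK⟩ := ih K (l₀ ++ [_]) k w
    rw [List.append_assoc] at hn
    exact ⟨K', k', w', Config.iterate_step (by simp only [Config.step, if_pos he]) hn, hK⟩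
  | ite_false he B ih =>
    intro K l₀ k w
    obtain ⟨K', k', w', hn, hK⟩ := ih K (l₀ ++ [_]) k w
    rw [List.append_assoc] at hn
    exact ⟨K', k', w', Config.iterate_step (by simp only [Config.step, if_neg he]) hn, hK⟩
  | while_done he =>
    exact fun K l₀ k w => ⟨_, _, _, ⟨1, by
      simp only [Function.iterate_one, Config.step, if_neg he]; rfl⟩, fun _ => rfl⟩
  | while_error he B hσ ih =>
    intro K l₀ k w
    obtain ⟨K', k', w', hn, -⟩ := ih (_ :: K) (l₀ ++ [_]) k w
    rw [List.append_assoc] at hn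
    refine ⟨K', k', w', Config.iterate_step (by simp only [Config.step, if_pos he]; rfl) hn, ?_⟩
    rintro rfl
    exact hσ.elim
  | while_next he B₁ B₂ ih₁ ih₂ =>
    intro K l₀ k w
    obtain ⟨_, k₁, w₁, hn₁, hK⟩ := ih₁ (_ :: K) (l₀ ++ [_]) k w
    obtain rfl := hK rfl
    obtain ⟨K', k', w', hn₂, hK⟩ := ih₂ K _ k₁ w₁
    have hn := Config.iterate_trans hn₁ hn₂
    rw [List.append_assoc, List.append_assoc] at hn
    exact ⟨K', k', w', Config.iterate_step (by simp only [Config.step, if_pos he]) hn, hK⟩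
  | assume he | assert_ok he =>
    exact fun K l₀ k w => ⟨_, _, _, ⟨1, by
      simp only [Function.iterate_one, Config.step, if_pos he]; rfl⟩, fun _ => rfl⟩
  | assert_fail he => exact fun K l₀ k w => ⟨_, _, _, ⟨1, rfl⟩, nofun⟩
  | assumeP he | assertP_ok he =>
    exact fun K l₀ k w => ⟨_, _, _, ⟨1, by
      simp only [Function.iterate_one, Config.step, if_pos he]; rfl⟩, fun _ => rfl⟩
  | assertP_fail he => exact fun K l₀ k w => ⟨_, _, _, ⟨1, rfl⟩, nofun⟩
  | _ => exact fun K l₀ k w => ⟨_, _, _, ⟨1, rfl⟩, fun _ => rfl⟩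

/-- The machine logs the initial parts of an execution. -/
theorem Partial.machine {I : Interp S} {C : Stmt S} {s : Stack S} {h : Heap S}
    {l : List AnyVal} (H : Partial I C s h l) :
    ∀ (K : List (Stmt S)) (l₀ : List AnyVal) (k : ℕ) (w : ℕ → ℕ), ∃ c : Config S,
      (∃ n, (Config.step I)^[n] ⟨C :: K, s, h, l₀, k, w⟩ = c) ∧ c.log = l₀ ++ l := by
  induction H with
  | start C s h => exact fun K l₀ k w => ⟨_, ⟨0, rfl⟩, (List.append_nil _).symm⟩
  | complete B =>
    intro K l₀ k w
    obtain ⟨K', k', w', hn, -⟩ := B.machine K l₀ k w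
    exact ⟨_, hn, rfl⟩
  | assume e s h => exact fun K l₀ k w => ⟨_, ⟨1, rfl⟩, rfl⟩
  | assumeP P es s h => exact fun K l₀ k w => ⟨_, ⟨1, rfl⟩, rfl⟩
  | seq_left _ ih =>
    intro K l₀ k w
    obtain ⟨c, hn, hc⟩ := ih (_ :: K) l₀ k w
    exact ⟨c, Config.iterate_step rfl hn, hc⟩
  | seq_right B _ ih =>
    intro K l₀ k w
    obtain ⟨_, k₁, w₁, hn₁, hK⟩ := B.machine (_ :: K) l₀ k w
    obtain rfl := hK rfl
    obtain ⟨c, hn, hc⟩ := ih K _ k₁ w₁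
    exact ⟨c, Config.iterate_step rfl (Config.iterate_trans hn₁ hn), by rw [hc, List.append_assoc]⟩
  | ite_true he _ ih =>
    intro K l₀ k w
    obtain ⟨c, hn, hc⟩ := ih K (l₀ ++ [_]) k w
    rw [List.append_assoc] at hc
    exact ⟨c, Config.iterate_step (by simp only [Config.step, if_pos he]) hn, hc⟩
  | ite_false he _ ih =>
    intro K l₀ k w
    obtain ⟨c, hn, hc⟩ := ih K (l₀ ++ [_]) k w
    rw [List.append_assoc] at hc
    exact ⟨c, Config.iterate_step (by simp only [Config.step, if_neg he]) hn, hc⟩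
  | while_body he _ ih =>
    intro K l₀ k w
    obtain ⟨c, hn, hc⟩ := ih (_ :: K) (l₀ ++ [_]) k w
    rw [List.append_assoc] at hc
    exact ⟨c, Config.iterate_step (by simp only [Config.step, if_pos he]; rfl) hn, hc⟩
  | while_next he B _ ih =>
    intro K l₀ k w
    obtain ⟨_, k₁, w₁, hn₁, hK⟩ := B.machine (_ :: K) (l₀ ++ [_]) k w
    obtain rfl := hK rfl
    obtain ⟨c, hn, hc⟩ := ih K _ k₁ w₁
    rw [List.append_assoc, List.append_assoc] at hc
    exact ⟨c, Config.iterate_step (by simp only [Config.step, if_pos he])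
      (Config.iterate_trans hn₁ hn), hc⟩

/-! ### From the machine to the big-step semantics -/

/-- Properties of executions of a statement with a given log that are inherited from the executions
of its parts; `nil l` expresses that they hold of a stuck machine with further log `l`. -/
structure IsInherited (I : Interp S) (Q : Stmt S → Stack S → Heap S → List AnyVal → Prop)
    (nil : List AnyVal → Prop) : Prop where
  seq_left {C D : Stmt S} {s : Stack S} {h : Heap S} {l : List AnyVal} :
    Q C s h l → Q (C ;; D) s h l
  seq_right {C D : Stmt S} {s s₁ : Stack S} {h h₁ : Heap S} {l₁ l₂ : List AnyVal} :
    BigStep I C s h l₁ .ok s₁ h₁ → Q D s₁ h₁ l₂ → Q (C ;; D) s h (l₁ ++ l₂)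
  ite_true {e : Expr S .int} {C D : Stmt S} {s : Stack S} {h : Heap S} {l : List AnyVal} :
    e.Holds s → Q C s h l → Q (.ite e C D) s h (⟨.int, e.eval s⟩ :: l)
  ite_false {e : Expr S .int} {C D : Stmt S} {s : Stack S} {h : Heap S} {l : List AnyVal} :
    ¬ e.Holds s → Q D s h l → Q (.ite e C D) s h (⟨.int, e.eval s⟩ :: l)
  while_body {e : Expr S .int} {C : Stmt S} {s : Stack S} {h : Heap S} {l : List AnyVal} :
    e.Holds s → Q C s h l → Q (.while e C) s h (⟨.int, e.eval s⟩ :: l)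
  while_next {e : Expr S .int} {C : Stmt S} {s s₁ : Stack S} {h h₁ : Heap S}
    {l₁ l₂ : List AnyVal} : e.Holds s → BigStep I C s h l₁ .ok s₁ h₁ →
    Q (.while e C) s₁ h₁ l₂ → Q (.while e C) s h (⟨.int, e.eval s⟩ :: (l₁ ++ l₂))
  assume {e : Expr S .int} {s : Stack S} {h : Heap S} {l : List AnyVal} :
    nil l → Q (.assume e) s h (⟨.int, e.eval s⟩ :: l)
  assert {e : Expr S .int} {s : Stack S} {h : Heap S} {l : List AnyVal} :
    ¬ e.Holds s → nil l → Q (.assert e) s h (⟨.int, e.eval s⟩ :: l)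
  assumeP {P : S.Pred} {es : ∀ i, Expr S (S.argTy P i)} {s : Stack S} {h : Heap S}
    {l : List AnyVal} : nil l → Q (.assumeP P es) s h (Sig.argList (evalArgs s es) ++ l)
  assertP {P : S.Pred} {es : ∀ i, Expr S (S.argTy P i)} {s : Stack S} {h : Heap S}
    {l : List AnyVal} : evalArgs s es ∉ I P → nil l →
    Q (.assertP P es) s h (Sig.argList (evalArgs s es) ++ l)

/-- A finished or stuck machine has nothing further to log, hence the condition `· = []`. -/
theorem isInherited_partial (I : Interp S) : IsInherited I (Partial I) (· = []) where
  seq_left := Partial.seq_left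
  seq_right := Partial.seq_right
  ite_true := Partial.ite_true
  ite_false := Partial.ite_false
  while_body := Partial.while_body
  while_next := Partial.while_next
  assume := by
    rintro e s h _ rfl
    exact Partial.assume e s h
  assert := by
    rintro e s h _ he rfl
    exact Partial.complete (BigStep.assert_fail he)
  assumeP := by
    rintro P es s h _ rfl
    rw [List.append_nil]
    exact Partial.assumeP P es s h
  assertP := by
    rintro P es s h _ he rfl
    rw [List.append_nil]
    exact Partial.complete (BigStep.assertP_fail he)

/-- The error is to come from a statement still pending, so no property is granted to a machine with
nothing left to do. -/
theorem isInherited_error (I : Interp S) : IsInherited I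
    (fun C s h l => ∃ σ s' h', BigStep I C s h l σ s' h' ∧ σ.IsError) (fun _ => False) where
  seq_left := fun ⟨_, _, _, B, hσ⟩ => ⟨_, _, _, BigStep.seq_error B hσ, hσ⟩
  seq_right := fun B₁ ⟨_, _, _, B, hσ⟩ => ⟨_, _, _, BigStep.seq_ok B₁ B, hσ⟩
  ite_true := fun he ⟨_, _, _, B, hσ⟩ => ⟨_, _, _, BigStep.ite_true he B, hσ⟩
  ite_false := fun he ⟨_, _, _, B, hσ⟩ => ⟨_, _, _, BigStep.ite_false he B, hσ⟩
  while_body := fun he ⟨_, _, _, B, hσ⟩ => ⟨_, _, _, BigStep.while_error he B hσ, hσ⟩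
  while_next := fun he B₁ ⟨_, _, _, B, hσ⟩ => ⟨_, _, _, BigStep.while_next he B₁ B, hσ⟩
  assume := False.elim
  assert := fun _ => False.elim
  assumeP := False.elim
  assertP := fun _ => False.elim

/-- The property for a list of statements that are executed one after the other. -/
def Continues (I : Interp S) (Q : Stmt S → Stack S → Heap S → List AnyVal → Prop)
    (nil : List AnyVal → Prop) : List (Stmt S) → Stack S → Heap S → List AnyVal → Prop
  | [], _, _, l => nil l
  | C :: K, s, h, l => Q C s h l ∨ ∃ l₁ l₂ s₁ h₁, BigStep I C s h l₁ .ok s₁ h₁ ∧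
      Continues I Q nil K s₁ h₁ l₂ ∧ l = l₁ ++ l₂

section Continues

variable {I : Interp S} {Q : Stmt S → Stack S → Heap S → List AnyVal → Prop}
  {nil : List AnyVal → Prop}

theorem Continues.next {C : Stmt S} {K : List (Stmt S)} {s s₁ : Stack S} {h h₁ : Heap S}
    {l₁ l₂ : List AnyVal} (B : BigStep I C s h l₁ .ok s₁ h₁)
    (H : Continues I Q nil K s₁ h₁ l₂) : Continues I Q nil (C :: K) s h (l₁ ++ l₂) :=
  Or.inr ⟨l₁, l₂, s₁, h₁, B, H, rfl⟩

/-- A machine step is undone: what is known of the pending statements after the step is reassembled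
into the statement that was decomposed. For a sequence or a loop, two entries of the list are merged
into one. -/
theorem IsInherited.step (hQ : IsInherited I Q nil) (c : Config S) :
    ∃ δ, (c.step I).log = c.log ++ δ ∧ ∀ l,
      Continues I Q nil (c.step I).todo (c.step I).stack (c.step I).heap l →
      Continues I Q nil c.todo c.stack c.heap (δ ++ l) := by
  obtain ⟨K, s, h, l₀, k, w⟩ := c
  rcases K with _ | ⟨C, K⟩
  · exact ⟨[], by simp [Config.step], fun l H => H⟩
  match C with
  | .assign x e => exact ⟨_, rfl, fun l H => Continues.next (BigStep.assign x e s h) H⟩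
  | .alloc p e => exact ⟨_, rfl, fun l H => Continues.next (BigStep.alloc p e s h) H⟩
  | .read x p => exact ⟨_, rfl, fun l H => Continues.next (BigStep.read x p s h) H⟩
  | .write p e => exact ⟨_, rfl, fun l H => Continues.next (BigStep.write p e s h) H⟩
  | .skip => exact ⟨[], by simp [Config.step], fun l H => Continues.next (BigStep.skip s h) H⟩
  | .seq C D =>
    refine ⟨[], by simp [Config.step], fun l H => ?_⟩
    rw [List.nil_append]
    rcases H with H | ⟨l₁, l₂, s₁, h₁, B, H | ⟨l₃, l₄, s₂, h₂, B', H, rfl⟩, rfl⟩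
    · exact Or.inl (hQ.seq_left H)
    · exact Or.inl (hQ.seq_right B H)
    · rw [← List.append_assoc]
      exact Continues.next (BigStep.seq_ok B B') H
  | .ite e C D =>
    refine ⟨_, rfl, fun l H => ?_⟩
    by_cases he : e.Holds s
    · simp only [Config.step, if_pos he] at H
      rcases H with H | ⟨l₁, l₂, s₁, h₁, B, H, rfl⟩
      · exact Or.inl (hQ.ite_true he H)
      · exact Continues.next (l₁ := _ :: l₁) (BigStep.ite_true he B) H
    · simp only [Config.step, if_neg he] at H
      rcases H with H | ⟨l₁, l₂, s₁, h₁, B, H, rfl⟩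
      · exact Or.inl (hQ.ite_false he H)
      · exact Continues.next (l₁ := _ :: l₁) (BigStep.ite_false he B) H
  | .while e C =>
    refine ⟨_, rfl, fun l H => ?_⟩
    by_cases he : e.Holds s
    · simp only [Config.step, if_pos he] at H
      rcases H with H | ⟨l₁, l₂, s₁, h₁, B, H | ⟨l₃, l₄, s₂, h₂, B', H, rfl⟩, rfl⟩
      · exact Or.inl (hQ.while_body he H)
      · exact Or.inl (hQ.while_next (l₁ := l₁) he B H)
      · have H' := Continues.next (BigStep.while_next he B B') H
        simpa only [List.cons_append, List.append_assoc, List.nil_append] using H'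
    · simp only [Config.step, if_neg he] at H
      exact Continues.next (BigStep.while_done he) H
  | .assume e =>
    refine ⟨_, rfl, fun l H => ?_⟩
    by_cases he : e.Holds s
    · simp only [Config.step, if_pos he] at H
      exact Continues.next (BigStep.assume he) H
    · simp only [Config.step, if_neg he] at H
      exact Or.inl (hQ.assume H)
  | .assert e =>
    refine ⟨_, rfl, fun l H => ?_⟩
    by_cases he : e.Holds s
    · simp only [Config.step, if_pos he] at H
      exact Continues.next (BigStep.assert_ok he) H
    · simp only [Config.step, if_neg he] at H
      exact Or.inl (hQ.assert he H)
  | .assumeP P es =>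
    refine ⟨_, rfl, fun l H => ?_⟩
    by_cases he : evalArgs s es ∈ I P
    · simp only [Config.step, if_pos he] at H
      exact Continues.next (BigStep.assumeP he) H
    · simp only [Config.step, if_neg he] at H
      exact Or.inl (hQ.assumeP H)
  | .assertP P es =>
    refine ⟨_, rfl, fun l H => ?_⟩
    by_cases he : evalArgs s es ∈ I P
    · simp only [Config.step, if_pos he] at H
      exact Continues.next (BigStep.assertP_ok he) H
    · simp only [Config.step, if_neg he] at H
      exact Or.inl (hQ.assertP he H)

theorem IsInherited.run (hQ : IsInherited I Q nil) (p : Stmt S) (s : Stack S) (n : ℕ)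
    (l : List AnyVal) (H : Continues I Q nil (Config.run I p s n).todo (Config.run I p s n).stack
      (Config.run I p s n).heap l) :
    Continues I Q nil [p] s [] ((Config.run I p s n).log ++ l) := by
  induction n generalizing l with
  | zero => exact H
  | succ n ih =>
    rw [Config.run_succ] at H ⊢
    obtain ⟨δ, hδ, hc⟩ := hQ.step (Config.run I p s n)
    rw [hδ, List.append_assoc]
    exact ih _ (hc l H)

end Continues

/-- The statements still pending contribute the empty log by `Partial.start`, and undoing all steps
carries this back to the whole program. -/
theorem partial_run_log (I : Interp S) (p : Stmt S) (s : Stack S) (n : ℕ) :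
    Partial I p s [] (Config.run I p s n).log := by
  have H := (isInherited_partial I).run p s n [] (by
    rcases (Config.run I p s n).todo with _ | ⟨C, K⟩
    · rfl
    · exact Or.inl (Partial.start _ _ _))
  rw [List.append_nil] at H
  rcases H with H | ⟨l₁, l₂, s₁, h₁, B, H, hl⟩
  · exact H
  · rw [hl, show l₂ = [] from H, List.append_nil]
    exact Partial.complete B

/-- The initial parts of the execution are those logged by the machine. -/
theorem partial_iff {I : Interp S} {p : Stmt S} {s : Stack S} {l : List AnyVal} :
    Partial I p s [] l ↔ ∃ n, (Config.run I p s n).log = l := by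
  constructor
  · intro H
    obtain ⟨c, ⟨n, hn⟩, hc⟩ := H.machine [] [] 0 (fun _ => 0)
    exact ⟨n, by unfold Config.run; rw [hn, hc]; rfl⟩
  · rintro ⟨n, rfl⟩
    exact partial_run_log I p s n

/-- If the next statement to be executed ends in an error, then so does the program. -/
theorem errs_of_run {I : Interp S} {p : Stmt S} {s : Stack S} {n : ℕ} {C : Stmt S}
    {K : List (Stmt S)} (hK : (Config.run I p s n).todo = C :: K)
    {l : List AnyVal} {σ : Outcome S} {s' : Stack S} {h' : Heap S}
    (B : BigStep I C (Config.run I p s n).stack (Config.run I p s n).heap l σ s' h')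
    (hσ : σ.IsError) : Errs I p s := by
  have H := (isInherited_error I).run p s n l (by
    rw [hK]
    exact Or.inl ⟨_, _, _, B, hσ⟩)
  rcases H with ⟨σ, s', h', B, hσ⟩ | ⟨_, _, _, _, _, H, _⟩
  · exact ⟨_, _, _, _, B, hσ⟩
  · exact H.elim

end Machine

/-! ### Consequences of determinism -/

section Determinism

variable {S : Sig}

/-- The configurations differ only in their stacks. -/
structure Config.Agrees (c d : Config S) : Prop where
  todo : c.todo = d.todo
  heap : c.heap = d.heap
  log : c.log = d.log
  cnt : c.cnt = d.cnt
  last : c.last = d.last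

theorem Sig.argList_injective {P : S.Pred} {v w : S.Args P}
    (h : Sig.argList v = Sig.argList w) : v = w := by
  funext i
  have := congrFun (List.ofFn_injective h) i
  exact eq_of_heq (Sigma.mk.inj this).2

theorem anyVal_inj {τ : Ty} {v w : τ.Val} (h : (⟨τ, v⟩ : AnyVal) = ⟨τ, w⟩) : v = w :=
  eq_of_heq (Sigma.mk.inj h).2

/-- The number of logged values depends on the statement alone and not on the values. This keeps the
logs of two runs aligned. -/
theorem Config.step_log_length (I : Interp S) {c d : Config S} (ht : c.todo = d.todo)
    (hl : c.log = d.log) : (c.step I).log.length = (d.step I).log.length := by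
  obtain ⟨K, s, h, l, k, w⟩ := c
  obtain ⟨K', s', h', l', k', w'⟩ := d
  obtain rfl : K = K' := ht
  obtain rfl : l = l' := hl
  rcases K with _ | ⟨C, K⟩
  · rfl
  · cases C <;> simp [Config.step, Sig.argList]

/-- The logged operands fix everything a step does outside the stack: conditions select the branch,
and addresses and objects determine the change of the heap. -/
theorem Config.Agrees.step (I : Interp S) {c d : Config S} (H : c.Agrees d)
    (hlog : (c.step I).log = (d.step I).log) : (c.step I).Agrees (d.step I) := by
  obtain ⟨K, s, h, l, k, w⟩ := c
  obtain ⟨K', s', h', l', k', w'⟩ := d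
  obtain rfl : K = K' := H.todo
  obtain rfl : h = h' := H.heap
  obtain rfl : l = l' := H.log
  obtain rfl : k = k' := H.cnt
  obtain rfl : w = w' := H.last
  rcases K with _ | ⟨C, K⟩
  · exact ⟨rfl, rfl, rfl, rfl, rfl⟩
  match C with
  | .assign x e => exact ⟨rfl, rfl, hlog, rfl, rfl⟩
  | .alloc q e =>
    have hv := anyVal_inj (List.cons.inj (List.append_cancel_left hlog)).1
    exact ⟨rfl, by simp only [Config.step, hv], hlog, rfl, rfl⟩
  | .read x q => exact ⟨rfl, rfl, hlog, rfl, rfl⟩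
  | .write q e =>
    have hv := List.cons.inj (List.append_cancel_left hlog)
    have hq : s.get q = s'.get q := anyVal_inj hv.1
    have ho := anyVal_inj (List.cons.inj hv.2).1
    exact ⟨rfl, by simp only [Config.step, hq, ho], hlog, rfl, by simp only [Config.step, hq]⟩
  | .skip => exact ⟨rfl, rfl, rfl, rfl, rfl⟩
  | .seq C D => exact ⟨rfl, rfl, rfl, rfl, rfl⟩
  | .ite e C D | .while e C | .assume e | .assert e =>
    have hv := anyVal_inj (List.cons.inj (List.append_cancel_left hlog)).1
    have he : e.Holds s = e.Holds s' := by
      unfold Expr.Holds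
      rw [hv]
    exact ⟨by simp only [Config.step]; rw [he], rfl, hlog, rfl, rfl⟩
  | .assumeP P es | .assertP P es =>
    have hv := Sig.argList_injective (List.append_cancel_left hlog)
    exact ⟨by simp only [Config.step]; rw [hv], rfl, hlog, rfl, rfl⟩

/-- Executions of a deterministic program from the same input agree step by step. -/
theorem Deterministic.run_agrees {inp : S.Var .int} {p : Stmt S} (hdet : Deterministic inp p)
    (I : Interp S) {s s' : Stack S} (hs : s.get inp = s'.get inp) (n : ℕ) :
    (Config.run I p s n).Agrees (Config.run I p s' n) := by
  induction n with
  | zero => exact ⟨rfl, rfl, rfl, rfl, rfl⟩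
  | succ n ih =>
    -- Determinism gives the log after `n + 1` steps as a log of the other run, but after some
    -- unknown number `m` of steps. Equal lengths in a chain of prefixes identify it with the log
    -- after `n + 1` steps.
    obtain ⟨m, hm⟩ := partial_iff.mp ((hdet I s s' hs _).mp (partial_run_log I p s (n + 1)))
    have hlen : (Config.run I p s' m).log.length = (Config.run I p s' (n + 1)).log.length := by
      rw [hm, Config.run_succ, Config.run_succ]
      exact Config.step_log_length I ih.todo ih.log
    have hlog : (Config.run I p s' m).log = (Config.run I p s' (n + 1)).log := by
      rcases le_total m (n + 1) with h | h
      · exact (Config.run_log_prefix I p s' h).eq_of_length hlen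
      · exact ((Config.run_log_prefix I p s' h).eq_of_length hlen.symm).symm
    rw [hm, Config.run_succ, Config.run_succ] at hlog
    rw [Config.run_succ, Config.run_succ]
    exact ih.step I hlog

/-! ### Bounds on the addresses in an execution -/

/-- Every allocation logs the allocated object. -/
theorem Config.heap_length_le (I : Interp S) (p : Stmt S) (s : Stack S) (n : ℕ) :
    (Config.run I p s n).heap.length ≤ (Config.run I p s n).log.length := by
  induction n with
  | zero => exact le_rfl
  | succ n ih =>
    rw [Config.run_succ]
    generalize Config.run I p s n = c at ih
    obtain ⟨K, s, h, l, k, w⟩ := c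
    rcases K with _ | ⟨C, K⟩
    · exact ih
    · have ih' : h.length ≤ l.length := ih
      cases C <;> simp [Config.step, Heap.allocate, Heap.length_write] <;> omega

/-- All addresses in the stack, the heap and the log are at most `N`. -/
structure Config.Bdd (N : ℕ) (c : Config S) : Prop where
  stack : ∀ {τ : Ty} (x : S.Var τ), τ.Bdd N (c.stack.get x)
  heap : ∀ o ∈ c.heap, S.obj.Bdd N o
  log : ∀ v ∈ c.log, Ty.Bdd N v.1 v.2

theorem Stack.bdd_set {N : ℕ} {s : Stack S} (h : ∀ {τ : Ty} (x : S.Var τ), τ.Bdd N (s.get x))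
    {σ : Ty} {y : S.Var σ} {v : σ.Val} (hv : σ.Bdd N v) {τ : Ty} (x : S.Var τ) :
    τ.Bdd N ((s.set y v).get x) := by
  by_cases hxy : (⟨σ, y⟩ : Σ τ, S.Var τ) = ⟨τ, x⟩
  · cases hxy
    rwa [Stack.get_set_same]
  · rw [Stack.get_set_of_ne _ _ hxy]
    exact h x

theorem Heap.bdd_read {N : ℕ} (hdef : S.obj.Bdd N S.defObj) {h : Heap S}
    (hh : ∀ o ∈ h, S.obj.Bdd N o) (q : ℕ) : S.obj.Bdd N (h.read q) := by
  unfold Heap.read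
  split_ifs
  · exact hh _ (List.getElem_mem _)
  · exact hdef

/-- The only new address is the one returned by an allocation, and it is at most the length of the
log after the step. -/
theorem Config.Bdd.step (I : Interp S) {N : ℕ} (hdef : S.obj.Bdd N S.defObj) {c : Config S}
    (H : c.Bdd N) (hlen : c.heap.length ≤ c.log.length) (hN : (c.step I).log.length ≤ N) :
    (c.step I).Bdd N := by
  have heval : ∀ {τ : Ty} (e : Expr S τ), τ.Bdd N (e.eval c.stack) :=
    fun e => Expr.bdd_eval hdef H.stack e
  have hlog : ∀ {vs : List AnyVal}, (∀ v ∈ vs, Ty.Bdd N v.1 v.2) →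
      ∀ v ∈ c.log ++ vs, Ty.Bdd N v.1 v.2 := fun hvs v hv =>
    (List.mem_append.mp hv).elim (H.log v) (hvs v)
  have hone : ∀ {τ : Ty} {u : τ.Val}, τ.Bdd N u →
      ∀ v ∈ [(⟨τ, u⟩ : AnyVal)], Ty.Bdd N v.1 v.2 := by
    intro τ u hu v hv
    obtain rfl := List.mem_singleton.mp hv
    exact hu
  have hargs : ∀ {P : S.Pred} (es : ∀ i, Expr S (S.argTy P i)),
      ∀ v ∈ Sig.argList (evalArgs c.stack es), Ty.Bdd N v.1 v.2 := by
    intro P es v hv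
    obtain ⟨i, rfl⟩ := (List.mem_ofFn' _ _).mp hv
    exact heval (es i)
  obtain ⟨K, s, h, l, k, w⟩ := c
  rcases K with _ | ⟨C, K⟩
  · exact H
  match C with
  | .assign x e => exact ⟨Stack.bdd_set H.stack (heval e), H.heap, hlog (hone (heval e))⟩
  | .alloc q e =>
    have ha : h.length + 1 ≤ N := by
      simp only [Config.step, List.length_append, List.length_singleton] at hN hlen
      omega
    refine ⟨Stack.bdd_set H.stack (σ := .addr) ha, fun o ho => ?_, hlog (hone (heval e))⟩
    rcases List.mem_append.mp ho with ho | ho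
    · exact H.heap o ho
    · obtain rfl := List.mem_singleton.mp ho
      exact heval e
  | .read x q =>
    exact ⟨Stack.bdd_set H.stack (Heap.bdd_read hdef H.heap _), H.heap, hlog (hone (H.stack q))⟩
  | .write q e =>
    refine ⟨H.stack, fun o ho => ?_, hlog fun v hv => ?_⟩
    · simp only [Config.step, Heap.write] at ho
      split_ifs at ho
      · rcases List.mem_or_eq_of_mem_set ho with ho | rfl
        · exact H.heap o ho
        · exact heval e
      · exact H.heap o ho
    · rcases List.mem_cons.mp hv with rfl | hv
      · exact H.stack q
      · exact hone (heval e) v hv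
  | .skip => exact ⟨H.stack, H.heap, H.log⟩
  | .seq C D => exact ⟨H.stack, H.heap, H.log⟩
  | .ite e C D | .while e C | .assume e | .assert e =>
    exact ⟨H.stack, H.heap, hlog (hone (heval e))⟩
  | .assumeP P es | .assertP P es => exact ⟨H.stack, H.heap, hlog (hargs es)⟩

/-- The addresses that a deterministic program handles are bounded. -/
theorem Deterministic.run_bdd {inp : S.Var .int} {p : Stmt S} (hdet : Deterministic inp p)
    (I : Interp S) (s : Stack S) {N D n : ℕ} (hD : S.obj.Bdd D S.defObj)
    (hN : D + (Config.run I p s n).log.length ≤ N) :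
    (∀ o ∈ (Config.run I p s n).heap, S.obj.Bdd N o) ∧
      ∀ v ∈ (Config.run I p s n).log, Ty.Bdd N v.1 v.2 := by
  have hdef := hD.mono ((Nat.le_add_right D _).trans hN)
  -- From default values, which contain no address but `null`, the whole configuration stays
  -- bounded. The stack of the given run may be unbounded, but its heap and log agree with those of
  -- this run.
  let s₀ : Stack S := Stack.set (fun v => v.1.default) inp (s.get inp)
  have hag := fun m => hdet.run_agrees I (s := s) (s' := s₀) (Stack.get_set_same _ _ _).symm m
  rw [(hag n).log] at hN
  have H : ∀ m ≤ n, (Config.run I p s₀ m).Bdd N := by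
    intro m
    induction m with
    | zero =>
      exact fun _ => ⟨Stack.bdd_set (fun x => Ty.bdd_default N _) (σ := .int) trivial,
        nofun, nofun⟩
    | succ m ih =>
      intro hm
      rw [Config.run_succ]
      refine (ih (by omega)).step I hdef (Config.heap_length_le I p s₀ m) ?_
      rw [← Config.run_succ]
      have := (Config.run_log_prefix I p s₀ hm).length_le
      omega
  rw [(hag n).log, (hag n).heap]
  exact ⟨(H n le_rfl).heap, (H n le_rfl).log⟩

/-! ### Reads and writes of an execution -/

/-- The object that the next step writes to the heap. -/
noncomputable def Config.written (c : Config S) : Option S.obj.Val :=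
  match c.todo with
  | .alloc _ e :: _ => some (e.eval c.stack)
  | .write q e :: _ => if Heap.Valid c.heap (c.stack.get q) then some (e.eval c.stack) else none
  | _ => none

/-- The number of the operation that wrote the object that the next step reads. -/
def Config.source (c : Config S) : Option ℕ :=
  match c.todo with
  | .read _ q :: _ => some (c.last (c.stack.get q))
  | _ => none

theorem Config.cnt_step_of_written (I : Interp S) {c : Config S} {o : S.obj.Val}
    (h : c.written = some o) : (c.step I).cnt = c.cnt + 1 := by
  obtain ⟨K, s, h', l, k, w⟩ := c
  rcases K with _ | ⟨C, K⟩
  · cases h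
  · cases C <;> first | rfl | cases h

theorem Config.cnt_step_of_source (I : Interp S) {c : Config S} {a : ℕ}
    (h : c.source = some a) : (c.step I).cnt = c.cnt + 1 := by
  obtain ⟨K, s, h', l, k, w⟩ := c
  rcases K with _ | ⟨C, K⟩
  · cases h
  · cases C <;> first | rfl | cases h

theorem Config.cnt_le_step (I : Interp S) (c : Config S) : c.cnt ≤ (c.step I).cnt := by
  obtain ⟨K, s, h, l, k, w⟩ := c
  rcases K with _ | ⟨C, K⟩
  · exact le_rfl
  · cases C <;> first | exact le_rfl | exact Nat.le_succ _

theorem Config.cnt_run_mono (I : Interp S) (p : Stmt S) (s : Stack S) :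
    Monotone fun n => (Config.run I p s n).cnt := by
  refine monotone_nat_of_le_succ fun n => ?_
  rw [Config.run_succ]
  exact Config.cnt_le_step I _

theorem Config.Agrees.written_eq (I : Interp S) {c d : Config S} (H : c.Agrees d)
    (hlog : (c.step I).log = (d.step I).log) : c.written = d.written := by
  obtain ⟨K, s, h, l, k, w⟩ := c
  obtain ⟨K', s', h', l', k', w'⟩ := d
  obtain rfl : K = K' := H.todo
  obtain rfl : h = h' := H.heap
  obtain rfl : l = l' := H.log
  rcases K with _ | ⟨C, K⟩
  · rfl
  match C with
  | .alloc q e =>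
    have hv := anyVal_inj (List.cons.inj (List.append_cancel_left hlog)).1
    simp only [Config.written, hv]
  | .write q e =>
    have hv := List.cons.inj (List.append_cancel_left hlog)
    have hq : s.get q = s'.get q := anyVal_inj hv.1
    have ho := anyVal_inj (List.cons.inj hv.2).1
    simp only [Config.written, hq, ho]
  | .assign _ _ | .read _ _ | .skip | .seq _ _ | .ite _ _ _ | .while _ _ | .assume _ | .assert _
  | .assumeP _ _ | .assertP _ _ => rfl

theorem Config.Agrees.source_eq (I : Interp S) {c d : Config S} (H : c.Agrees d)
    (hlog : (c.step I).log = (d.step I).log) : c.source = d.source := by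
  obtain ⟨K, s, h, l, k, w⟩ := c
  obtain ⟨K', s', h', l', k', w'⟩ := d
  obtain rfl : K = K' := H.todo
  obtain rfl : l = l' := H.log
  obtain rfl : w = w' := H.last
  rcases K with _ | ⟨C, K⟩
  · rfl
  match C with
  | .read x q =>
    have hq : s.get q = s'.get q :=
      anyVal_inj (List.cons.inj (List.append_cancel_left hlog)).1
    simp only [Config.source, hq]
  | .assign _ _ | .alloc _ _ | .write _ _ | .skip | .seq _ _ | .ite _ _ _ | .while _ _
  | .assume _ | .assert _ | .assumeP _ _ | .assertP _ _ => rfl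

variable {I : Interp S} {inp : S.Var .int} {p : Stmt S} {i : ℤ} {k : ℕ}

/-- In the execution on input `i`, the heap operation number `k` writes `o`; the number `0` stands
for the default object. -/
def Writes (I : Interp S) (inp : S.Var .int) (p : Stmt S) (i : ℤ) (k : ℕ) (o : S.obj.Val) :
    Prop :=
  (k = 0 ∧ o = S.defObj) ∨ ∃ s n, s.get inp = i ∧ k = (Config.run I p s n).cnt + 1 ∧
    (Config.run I p s n).written = some o

/-- In the execution on input `i`, the heap operation number `k` reads what the operation
number `a` wrote. -/
def Reads (I : Interp S) (inp : S.Var .int) (p : Stmt S) (i : ℤ) (k a : ℕ) : Prop :=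
  ∃ s n, s.get inp = i ∧ k = (Config.run I p s n).cnt + 1 ∧
    (Config.run I p s n).source = some a

/-- The counter never decreases and grows at both steps, so its value identifies the step. -/
theorem Config.eq_of_cnt_eq {s : Stack S} {m n : ℕ}
    (h : (Config.run I p s m).cnt = (Config.run I p s n).cnt)
    (hm : (Config.run I p s (m + 1)).cnt = (Config.run I p s m).cnt + 1)
    (hn : (Config.run I p s (n + 1)).cnt = (Config.run I p s n).cnt + 1) : m = n := by
  rcases lt_trichotomy m n with hlt | rfl | hlt
  · have := Config.cnt_run_mono I p s (Nat.succ_le_of_lt hlt)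
    simp only [Nat.succ_eq_add_one] at this
    omega
  · rfl
  · have := Config.cnt_run_mono I p s (Nat.succ_le_of_lt hlt)
    simp only [Nat.succ_eq_add_one] at this
    omega

/-- Both writes may come from different initial stacks with the same input. Determinism makes the
counters agree, so the operation number selects the same step in both runs, and the logged operands
give the same object. -/
theorem Deterministic.writes_unique (hdet : Deterministic inp p) {o o' : S.obj.Val}
    (h : Writes I inp p i k o) (h' : Writes I inp p i k o') : o = o' := by
  rcases h with ⟨rfl, rfl⟩ | ⟨s, n, hs, hk, ho⟩
  -- Operations are numbered from `1`, so the number `0` of the default object cannot clash.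
  · rcases h' with ⟨-, rfl⟩ | ⟨s, n, hs, hk, ho⟩
    · rfl
    · omega
  · rcases h' with ⟨rfl, -⟩ | ⟨s', n', hs', hk', ho'⟩
    · omega
    · have hag := hdet.run_agrees I (hs.trans hs'.symm)
      have h₁ := Config.cnt_step_of_written I ho
      have h₂ := Config.cnt_step_of_written I ho'
      rw [← Config.run_succ] at h₁ h₂
      obtain rfl : n = n' := by
        rw [(hag n).cnt, (hag (n + 1)).cnt] at h₁
        rw [(hag n).cnt] at hk
        exact Config.eq_of_cnt_eq (by omega) h₁ h₂
      have hlog := (hag (n + 1)).log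
      rw [Config.run_succ, Config.run_succ] at hlog
      rw [(hag n).written_eq I hlog, ho'] at ho
      exact (Option.some.inj ho).symm

theorem Deterministic.reads_unique (hdet : Deterministic inp p) {a a' : ℕ}
    (h : Reads I inp p i k a) (h' : Reads I inp p i k a') : a = a' := by
  obtain ⟨s, n, hs, hk, ha⟩ := h
  obtain ⟨s', n', hs', hk', ha'⟩ := h'
  have hag := hdet.run_agrees I (hs.trans hs'.symm)
  have h₁ := Config.cnt_step_of_source I ha
  have h₂ := Config.cnt_step_of_source I ha'
  rw [← Config.run_succ] at h₁ h₂
  obtain rfl : n = n' := by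
    rw [(hag n).cnt, (hag (n + 1)).cnt] at h₁
    rw [(hag n).cnt] at hk
    exact Config.eq_of_cnt_eq (by omega) h₁ h₂
  have hlog := (hag (n + 1)).log
  rw [Config.run_succ, Config.run_succ] at hlog
  rw [(hag n).source_eq I hlog, ha'] at ha
  exact (Option.some.inj ha).symm

/-- The object at an address was written by the latest operation that wrote to the address. -/
theorem writes_run (I : Interp S) (inp : S.Var .int) (p : Stmt S) (s : Stack S) (n q : ℕ) :
    Writes I inp p (s.get inp) ((Config.run I p s n).last q)
      ((Config.run I p s n).heap.read q) := by
  induction n generalizing q with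
  | zero => exact Or.inl ⟨rfl, dif_neg (by simp [Config.run]; omega)⟩
  | succ n ih =>
    rw [Config.run_succ]
    have hw : ∀ {o}, (Config.run I p s n).written = some o →
        Writes I inp p (s.get inp) ((Config.run I p s n).cnt + 1) o :=
      fun ho => Or.inr ⟨s, n, rfl, rfl, ho⟩
    generalize Config.run I p s n = c at ih hw
    obtain ⟨K, s, h, l, k, w⟩ := c
    rcases K with _ | ⟨C, K⟩
    · exact ih q
    match C with
    | .alloc x e =>
      simp only [Config.step, Heap.allocate, Heap.read_allocate, Function.update_apply]
      split_ifs
      · exact hw rfl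
      · exact ih q
    | .write x e =>
      simp only [Config.step]
      by_cases hv : Heap.Valid h (s.get x)
      · rw [if_pos hv, Heap.read_write _ _ hv, Function.update_apply]
        split_ifs
        · exact hw (if_pos hv)
        · exact ih q
      · unfold Heap.write
        rw [if_neg hv, if_neg hv]
        exact ih q
    | .assign _ _ | .read _ _ | .skip | .seq _ _ | .ite _ _ _ | .while _ _ | .assume _ | .assert _
    | .assumeP _ _ | .assertP _ _ => exact ih q

end Determinism

/-! ### Completeness -/

section Completeness

variable {S : Sig}

/-- The interpretation of the predicates of the encoded program that describes the reads and
writes of the program. -/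
def Interp.push (I : Interp S) (inp : S.Var .int) (p : Stmt S) : Interp S.rw
  | .orig P => {v | ∃ w ∈ I P, v = fun i => (S.argTy P i).embed (w i)}
  | .R => {v | ∃ i k c, v = rArgs i (k : ℕ) (c : ℕ) ∧ Reads I inp p i k c}
  | .W => {v | ∃ i k o, v = wArgs i (k : ℕ) (S.obj.embed o) ∧ Writes I inp p i k o}

theorem wArgs_inj {i i' k k' : ℤ} {o o' : S.obj.redeclare.Val}
    (h : wArgs i k o = wArgs i' k' o') : i = i' ∧ k = k' ∧ o = o' :=
  ⟨congrFun h (0 : Fin 3), congrFun h (1 : Fin 3), congrFun h (2 : Fin 3)⟩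

theorem rArgs_inj {i i' k k' c c' : ℤ} (h : rArgs (S := S) i k c = rArgs i' k' c') :
    i = i' ∧ k = k' ∧ c = c' :=
  ⟨congrFun h (0 : Fin 3), congrFun h (1 : Fin 3), congrFun h (2 : Fin 3)⟩

variable {I : Interp S} {inp : S.Var .int} {p : Stmt S}

theorem Interp.mem_push_W {i : ℤ} {k : ℕ} {v : S.obj.redeclare.Val} :
    wArgs i k v ∈ I.push inp p RWPred.W ↔ ∃ o, v = S.obj.embed o ∧ Writes I inp p i k o := by
  constructor
  · rintro ⟨i', k', o, h, H⟩
    obtain ⟨rfl, hk, rfl⟩ := wArgs_inj h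
    obtain rfl := Int.ofNat.inj hk
    exact ⟨o, rfl, H⟩
  · rintro ⟨o, rfl, H⟩
    exact ⟨i, k, o, rfl, H⟩

theorem Interp.mem_push_R {i : ℤ} {k : ℕ} {z : ℤ} :
    rArgs i k z ∈ I.push inp p RWPred.R ↔ ∃ c : ℕ, z = c ∧ Reads I inp p i k c := by
  constructor
  · rintro ⟨i', k', c, h, H⟩
    obtain ⟨rfl, hk, rfl⟩ := rArgs_inj h
    obtain rfl := Int.ofNat.inj hk
    exact ⟨c, rfl, H⟩
  · rintro ⟨c, rfl, H⟩
    exact ⟨i, k, c, rfl, H⟩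

theorem Ty.embed_injective (τ : Ty) : Function.Injective τ.embed := by
  intro v w h
  rw [← Ty.map_ofNat, ← Ty.map_ofNat] at h
  exact Ty.map_injective (fun _ _ => Int.ofNat.inj) τ h

theorem Interp.mem_push_orig {P : S.Pred} {v : S.Args P} :
    ((fun i => (S.argTy P i).embed (v i) : S.rw.Args (RWPred.orig P)) ∈
      I.push inp p (RWPred.orig P)) ↔ v ∈ I P := by
  constructor
  · rintro ⟨w, hw, h⟩
    obtain rfl : v = w := funext fun i => Ty.embed_injective _ (congrFun h i)
    exact hw
  · exact fun h => ⟨v, h, rfl⟩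

/-- The lower bound is available before the rest of the run is understood, as needed to bound
addresses ahead of the assertion of `W`. -/
theorem RunsOnly.le_length_seq {S : Sig} {I : Interp S} {C D : Stmt S} {s s' s₁ : Stack S}
    {h₁ : Heap S} {n : ℕ} {l : List AnyVal} {σ : Outcome S} (H : RunsOnly I C s s' n)
    (B : BigStep I (C ;; D) s [] l σ s₁ h₁) : n ≤ l.length := by
  cases B with
  | seq_error B _ => exact (H.eq B).1
  | seq_ok B _ =>
    rw [List.length_append]
    exact (H.eq B).1.trans (Nat.le_add_right _ _)

theorem BigStep.one_le_length_ite {S : Sig} {I : Interp S} {e : Expr S .int} {C D : Stmt S}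
    {s s₁ : Stack S} {h h₁ : Heap S} {l : List AnyVal} {σ : Outcome S}
    (B : BigStep I (.ite e C D) s h l σ s₁ h₁) : 1 ≤ l.length := by
  cases B <;> simp

variable {g : ℕ → ℤ} {N D : ℕ} {s₀ : Stack S}

/-- The encoded program, in the state `t` and with the tracked address `a`, has reached the
configuration `c` of the program. -/
structure Reaches (I : Interp S) (inp : S.Var .int) (p : Stmt S) (g : ℕ → ℤ) (s₀ : Stack S)
    (a : ℕ) (t : Stack S.rw) (c : Config S) : Prop where
  run : ∃ n, Config.run I p s₀ n = c
  sync : Matches g c.stack c.heap c.cnt c.last a t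
  inp : c.stack.get inp = s₀.get inp

theorem Reaches.step {a : ℕ} {t t' : Stack S.rw} {c : Config S}
    (H : Reaches I inp p g s₀ a t c)
    (M : Matches g (c.step I).stack (c.step I).heap (c.step I).cnt (c.step I).last a t')
    (hi : (c.step I).stack.get inp = c.stack.get inp) :
    Reaches I inp p g s₀ a t' (c.step I) := by
  obtain ⟨n, rfl⟩ := H.run
  exact ⟨⟨n + 1, Config.run_succ _ _ _ _⟩, M, hi.trans H.inp⟩

/-- The encoded program simulates the execution of the statement `C` of the program. -/
def Simulates (I : Interp S) (inp : S.Var .int) (p : Stmt S) (g : ℕ → ℤ) (N D : ℕ)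
    (s₀ : Stack S) (C : Stmt S) : Prop :=
  ∀ (a : ℕ) (t : Stack S.rw) (K : List (Stmt S)) (c : Config S), Reaches I inp p g s₀ a t c →
    c.todo = C :: K → ∀ (l : List AnyVal) (σ : Outcome S.rw) (t' : Stack S.rw) (h' : Heap S.rw),
    D + c.log.length + l.length ≤ N →
    BigStep (I.push inp p) (rwStmt (RWVar.orig inp) C) t [] l σ t' h' →
    σ = .ok ∧ h' = [] ∧ ∃ c', Reaches I inp p g s₀ a t' c' ∧ c'.todo = K ∧
      c'.log.length ≤ c.log.length + l.length

theorem simulates_seq {C₁ C₂ : Stmt S} (H₁ : Simulates I inp p g N D s₀ C₁)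
    (H₂ : Simulates I inp p g N D s₀ C₂) : Simulates I inp p g N D s₀ (C₁ ;; C₂) := by
  intro a t K c R hK l σ t' h' hN B
  have R' : Reaches I inp p g s₀ a t (c.step I) ∧ (c.step I).todo = C₁ :: C₂ :: K ∧
      (c.step I).log = c.log := by
    obtain ⟨_, s, h, l₀, k, w⟩ := c
    obtain rfl := hK
    exact ⟨R.step R.sync rfl, rfl, rfl⟩
  generalize c.step I = c₁ at R'
  obtain ⟨R', hK', hl⟩ := R'
  rw [← hl] at hN ⊢
  cases B with
  | seq_error B hσ =>
    obtain ⟨rfl, -⟩ := H₁ a t _ c₁ R' hK' _ _ _ _ hN B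
    exact hσ.elim
  | seq_ok B₁ B₂ =>
    rw [List.length_append] at hN ⊢
    obtain ⟨-, rfl, c₂, R₂, hK₂, hl₂⟩ := H₁ a t _ c₁ R' hK' _ _ _ _ (by omega) B₁
    obtain ⟨hσ, hh, c₃, R₃, hK₃, hl₃⟩ := H₂ a _ _ c₂ R₂ hK₂ _ _ _ _ (by omega) B₂
    exact ⟨hσ, hh, c₃, R₃, hK₃, by omega⟩

theorem simulates_ite (hg : IsRenaming S g) {e : Expr S .int} {C₁ C₂ : Stmt S}
    (H₁ : Simulates I inp p g N D s₀ C₁) (H₂ : Simulates I inp p g N D s₀ C₂) :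
    Simulates I inp p g N D s₀ (.ite e C₁ C₂) := by
  intro a t K c R hK l σ t' h' hN B
  have R' : Reaches I inp p g s₀ a t (c.step I) ∧
      (e.Holds c.stack → (c.step I).todo = C₁ :: K) ∧
      (¬ e.Holds c.stack → (c.step I).todo = C₂ :: K) ∧
      (c.step I).log.length = c.log.length + 1 := by
    obtain ⟨_, s, h, l₀, k, w⟩ := c
    obtain rfl := hK
    exact ⟨R.step R.sync rfl, fun he => by simp [Config.step, he],
      fun he => by simp [Config.step, he], by simp [Config.step]⟩
  generalize c.step I = c₁ at R'
  obtain ⟨R', ht, hf, hl⟩ := R'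
  cases B with
  | ite_true he B =>
    rw [List.length_cons] at hN ⊢
    obtain ⟨hσ, hh, c₃, R₃, hK₃, hl₃⟩ := H₁ a t K c₁ R' (ht ((hg.holds R.sync e).mp he))
      _ _ _ _ (by omega) B
    exact ⟨hσ, hh, c₃, R₃, hK₃, by omega⟩
  | ite_false he B =>
    rw [List.length_cons] at hN ⊢
    obtain ⟨hσ, hh, c₃, R₃, hK₃, hl₃⟩ := H₂ a t K c₁ R' (hf (mt (hg.holds R.sync e).mpr he))
      _ _ _ _ (by omega) B
    exact ⟨hσ, hh, c₃, R₃, hK₃, by omega⟩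

/-- The iterations are handled by induction on the big-step derivation of the encoded loop, with the
statement and the heap generalised and held fixed by equations. -/
theorem simulates_while (hg : IsRenaming S g) {e : Expr S .int} {C : Stmt S}
    (H : Simulates I inp p g N D s₀ C) : Simulates I inp p g N D s₀ (.while e C) := by
  intro a t K c R hK l σ t' h' hN B
  have key : ∀ {c : Config S} {t : Stack S.rw}, Reaches I inp p g s₀ a t c →
      c.todo = .while e C :: K → Reaches I inp p g s₀ a t (c.step I) ∧
      (e.redeclare.Holds t → (c.step I).todo = C :: .while e C :: K) ∧
      (¬ e.redeclare.Holds t → (c.step I).todo = K) ∧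
      (c.step I).log.length = c.log.length + 1 := by
    intro c t R hK
    rw [hg.holds R.sync e]
    obtain ⟨_, s, h, l₀, k, w⟩ := c
    obtain rfl := hK
    exact ⟨R.step R.sync rfl, fun he => by simp [Config.step, he],
      fun he => by simp [Config.step, he], by simp [Config.step]⟩
  have hnil : ∀ {h : Heap S.rw}, h = [] → ∀ {E t l σ t' h'},
      BigStep (I.push inp p) E t h l σ t' h' → E = rwStmt (RWVar.orig inp) (.while e C) →
      ∀ c : Config S, Reaches I inp p g s₀ a t c → c.todo = .while e C :: K →
      D + c.log.length + l.length ≤ N →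
      σ = .ok ∧ h' = [] ∧ ∃ c', Reaches I inp p g s₀ a t' c' ∧ c'.todo = K ∧
        c'.log.length ≤ c.log.length + l.length := by
    intro h hh E t l σ t' h' B hE
    induction B with
    | while_done he =>
      intro c R hK hN
      cases hE
      obtain ⟨R', -, hf, hl⟩ := key R hK
      exact ⟨rfl, hh, _, R', hf he, by simp [hl]⟩
    | while_error he B hσ _ =>
      intro c R hK hN
      cases hE
      subst hh
      obtain ⟨R', ht, -, hl⟩ := key R hK
      rw [List.length_cons] at hN
      obtain ⟨rfl, -⟩ := H a _ _ _ R' (ht he) _ _ _ _ (by omega) B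
      exact hσ.elim
    | while_next he B _ _ ih =>
      intro c R hK hN
      cases hE
      subst hh
      obtain ⟨R', ht, -, hl⟩ := key R hK
      rw [List.length_cons, List.length_append] at hN ⊢
      obtain ⟨-, rfl, c₂, R₂, hK₂, hl₂⟩ := H a _ _ _ R' (ht he) _ _ _ _ (by omega) B
      obtain ⟨hσ, hh, c₃, R₃, hK₃, hl₃⟩ := ih rfl rfl c₂ R₂ hK₂ (by omega)
      exact ⟨hσ, hh, c₃, R₃, hK₃, by omega⟩
    | _ => cases hE
  exact hnil rfl B rfl c R hK hN

/-- The encoded program simulates every statement that does not assign to the input. -/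
theorem simulates (hdet : Deterministic inp p) (hsafe : ∀ s, ¬ Errs I p s)
    (hD : S.obj.Bdd D S.defObj) (hg : IsRenaming S g) (hgN : ∀ a ≤ N, g a = a) (C : Stmt S)
    (hinp : ¬ C.Assigns inp) (hC : C.AllocNormal) : Simulates I inp p g N D s₀ C := by
  have hbdd : ∀ {c : Config S} {a : ℕ} {t : Stack S.rw}, Reaches I inp p g s₀ a t c →
      D + c.log.length ≤ N → (∀ o ∈ c.heap, S.obj.Bdd N o) ∧ ∀ v ∈ c.log, Ty.Bdd N v.1 v.2 := by
    intro c a t R hN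
    obtain ⟨n, rfl⟩ := R.run
    exact hdet.run_bdd I s₀ hD hN
  have hbdd' : ∀ {c : Config S} {a : ℕ} {t : Stack S.rw}, Reaches I inp p g s₀ a t c →
      D + (c.step I).log.length ≤ N → ∀ v ∈ (c.step I).log, Ty.Bdd N v.1 v.2 := by
    intro c a t R hN
    obtain ⟨n, rfl⟩ := R.run
    rw [← Config.run_succ] at hN ⊢
    exact (hdet.run_bdd I s₀ hD hN).2
  have hlen : ∀ {c : Config S} {a : ℕ} {t : Stack S.rw}, Reaches I inp p g s₀ a t c →
      c.heap.length ≤ c.log.length := by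
    intro c a t R
    obtain ⟨n, rfl⟩ := R.run
    exact Config.heap_length_le _ _ _ _
  -- `Interp.push` contains embedded tuples, whereas the simulation yields renamed ones. Arguments
  -- of a predicate are logged, hence bounded by `N`, where renaming and embedding coincide.
  have hpred : ∀ {c : Config S} {a : ℕ} {t : Stack S.rw} {P : S.Pred}
      {es : ∀ i, Expr S (S.argTy P i)}, Reaches I inp p g s₀ a t c →
      (c.step I).log = c.log ++ Sig.argList (evalArgs c.stack es) →
      D + c.log.length + S.arity P ≤ N →
      (evalArgs t (P := RWPred.orig P) (fun i => (es i).redeclare) ∈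
        I.push inp p (RWPred.orig P) ↔ evalArgs c.stack es ∈ I P) := by
    intro c a t P es R hlog hN
    have hb := hbdd' R (by rw [hlog]; simp [Sig.argList]; omega)
    rw [evalArgs_redeclare hg R.sync, ← Interp.mem_push_orig (inp := inp) (p := p)]
    have : ∀ i, (S.argTy P i).map g (evalArgs c.stack es i) =
        (S.argTy P i).embed (evalArgs c.stack es i) := fun i =>
      Ty.map_eq_embed hgN (hb ⟨_, evalArgs c.stack es i⟩ (by
        rw [hlog]
        exact List.mem_append_right _ ((List.mem_ofFn' _ _).mpr ⟨i, rfl⟩)))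
    simp only [this]
  induction C with
  | seq C₁ C₂ ih₁ ih₂ =>
    exact simulates_seq (ih₁ (fun h => hinp (Or.inl h)) hC.1)
      (ih₂ (fun h => hinp (Or.inr h)) hC.2)
  | ite e C₁ C₂ ih₁ ih₂ =>
    exact simulates_ite hg (ih₁ (fun h => hinp (Or.inl h)) hC.1)
      (ih₂ (fun h => hinp (Or.inr h)) hC.2)
  | assign x e =>
    intro a t K c R hK l σ t' h' hN B
    obtain ⟨hl, rfl, rfl, rfl⟩ :=
      (runsOnly_assign (S := S.rw) (RWVar.orig x) (hg.eval R.sync e)).eq B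
    obtain ⟨_, s, h, l₀, k, w⟩ := c
    obtain rfl := hK
    refine ⟨rfl, rfl, _, R.step (R.sync.set_orig x _) (Stack.get_set_of_ne _ _ hinp), rfl, ?_⟩
    simpa [Config.step] using hl
  | alloc q e =>
    intro a t K c R hK l σ t' h' hN B
    -- The encoded run logs at least one value, which pays for the value logged by the program: its
    -- log after this step still fits under `N`, and so do the allocated object and the new address.
    have hl := RunsOnly.le_length_seq (runsOnly_assign (S := S.rw) RWVar.cntAlloc rfl) B
    have hlen := hlen R
    have hb := hbdd' R
    obtain ⟨n, hn⟩ := R.run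
    obtain ⟨_, s, h, l₀, k, w⟩ := c
    obtain rfl := hK
    simp only at hN hlen
    have hb' := hb (by simp [Config.step]; omega) ⟨S.obj, e.eval s⟩ (by simp [Config.step])
    obtain ⟨t₁, Ro, M, -⟩ := (R.sync.rwAlloc (I := I.push inp p) hg
      (hgN _ (show h.length + 1 ≤ N by omega)) inp hC).1 (by
        rw [Interp.mem_push_W, R.inp]
        refine ⟨e.eval s, Ty.map_eq_embed hgN hb', Or.inr ⟨s₀, n, rfl, by rw [hn], by
          rw [hn]; rfl⟩⟩)
    obtain ⟨-, rfl, rfl, rfl⟩ := Ro.eq B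
    refine ⟨rfl, rfl, _, R.step M (Stack.get_set_of_ne _ _ hinp), rfl, ?_⟩
    simpa [Config.step] using hl
  | read x q =>
    intro a t K c R hK l σ t' h' hN B
    have hh := (hbdd R (by omega)).1
    obtain ⟨n, hn⟩ := R.run
    have hw := writes_run I inp p s₀ n (c.stack.get q)
    rw [hn] at hw
    obtain ⟨_, s, h, l₀, k, w⟩ := c
    obtain rfl := hK
    simp only at hN hw hh
    have hr : Reads I inp p (s.get inp) (k + 1) (w (s.get q)) :=
      ⟨s₀, n, R.inp.symm, by rw [hn], by rw [hn]; rfl⟩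
    -- By determinism `R` admits only the actual write number and `W` only the actual object, so a
    -- run that passes the assumptions has guessed correctly.
    obtain ⟨rfl, rfl, hl, M⟩ := R.sync.eq_of_rwRead hg hinp (fun z => by
        rw [Interp.mem_push_R]
        constructor
        · rintro ⟨c, rfl, hc⟩
          rw [hdet.reads_unique hc hr]
        · rintro rfl
          exact ⟨_, rfl, hr⟩) (fun v hv => by
        obtain ⟨o, rfl, ho⟩ := Interp.mem_push_W.mp hv
        rw [R.inp] at ho
        rw [hdet.writes_unique ho hw]
        exact (Ty.map_eq_embed hgN (Heap.bdd_read (hD.mono (by omega)) hh _)).symm) B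
    refine ⟨rfl, rfl, _, R.step M (Stack.get_set_of_ne _ _ hinp), rfl, ?_⟩
    simpa [Config.step] using hl
  | write q e =>
    intro a t K c R hK l σ t' h' hN B
    -- A write of the program logs an address and an object. The increment of `cnt` and the bounds
    -- check of the encoding match these two values.
    have hl : 2 ≤ l.length := by
      have hc := R.sync.runsOnly_cnt (I := I.push inp p)
      cases B with
      | seq_error B hσ =>
        obtain ⟨-, rfl, -⟩ := hc.eq B
        exact hσ.elim
      | seq_ok B₁ B₂ =>
        have h₁ := (hc.eq B₁).1
        have h₂ := B₂.one_le_length_ite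
        rw [List.length_append]
        omega
    have hlen := hlen R
    have hb := hbdd' R
    obtain ⟨n, hn⟩ := R.run
    obtain ⟨_, s, h, l₀, k, w⟩ := c
    obtain rfl := hK
    simp only at hN hlen
    have hb' := hb (by simp [Config.step]; omega) ⟨S.obj, e.eval s⟩ (by simp [Config.step])
    -- The renaming must not move an address above `N` into the allocated range. Integers from `0`
    -- to `N` are already images of the addresses up to `N`, so injectivity forbids it.
    have hvalid : 0 < g (s.get q) ∧ g (s.get q) ≤ h.length ↔ Heap.Valid h (s.get q) := by
      have hq : ∀ b : ℕ, 0 < g b ∧ g b ≤ h.length ↔ Heap.Valid h b := by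
        intro b
        rcases le_or_gt b N with hb | hb
        · rw [hgN b hb, Heap.Valid]
          omega
        · constructor
          · rintro ⟨h₁, h₂⟩
            have h₃ := hgN (g b).toNat (by omega)
            rw [Int.toNat_of_nonneg h₁.le] at h₃
            have := hg.inj h₃
            omega
          · rintro ⟨-, h₂⟩
            omega
      exact hq _
    obtain ⟨t₁, Ro, M, -⟩ := (R.sync.rwWrite (I := I.push inp p) hg inp q e hvalid).1 (by
      intro hv
      rw [Interp.mem_push_W, R.inp]
      refine ⟨e.eval s, Ty.map_eq_embed hgN hb', Or.inr ⟨s₀, n, rfl, by rw [hn], by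
        rw [hn]; exact if_pos hv⟩⟩)
    obtain ⟨-, rfl, rfl, rfl⟩ := Ro.eq B
    refine ⟨rfl, rfl, _, R.step M rfl, rfl, ?_⟩
    simpa [Config.step] using hl
  | skip =>
    intro a t K c R hK l σ t' h' hN B
    obtain ⟨hl, rfl, rfl, rfl⟩ := (runsOnly_skip t).eq B
    obtain ⟨_, s, h, l₀, k, w⟩ := c
    obtain rfl := hK
    exact ⟨rfl, rfl, _, R.step R.sync rfl, rfl, by simp [Config.step]⟩
  | assume e =>
    intro a t K c R hK l σ t' h' hN B
    cases B with
    | assume he =>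
    rw [hg.holds R.sync] at he
    obtain ⟨_, s, h, l₀, k, w⟩ := c
    obtain rfl := hK
    exact ⟨rfl, rfl, _, R.step R.sync rfl, if_pos he, by simp [Config.step]⟩
  | assert e =>
    intro a t K c R hK l σ t' h' hN B
    cases B with
    | assert_ok he =>
      rw [hg.holds R.sync] at he
      obtain ⟨_, s, h, l₀, k, w⟩ := c
      obtain rfl := hK
      exact ⟨rfl, rfl, _, R.step R.sync rfl, if_pos he, by simp [Config.step]⟩
    | assert_fail he =>
      rw [hg.holds R.sync] at he
      obtain ⟨n, rfl⟩ := R.run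
      -- A failed assertion in the encoding would be a failed assertion of the program from the
      -- stack `s₀`, against its safety.
      exact (hsafe s₀ (errs_of_run hK (BigStep.assert_fail he) trivial)).elim
  | assumeP P es =>
    intro a t K c R hK l σ t' h' hN B
    have hp := hpred (es := es) R (by
      obtain ⟨_, s, h, l₀, k, w⟩ := c
      obtain rfl := hK
      rfl)
    cases B with
    | assumeP he =>
    rw [hp (by simpa [Sig.argList] using hN)] at he
    obtain ⟨_, s, h, l₀, k, w⟩ := c
    obtain rfl := hK
    exact ⟨rfl, rfl, _, R.step R.sync rfl, if_pos he, by simp [Config.step, Sig.argList]⟩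
  | assertP P es =>
    intro a t K c R hK l σ t' h' hN B
    have hp := hpred (es := es) R (by
      obtain ⟨_, s, h, l₀, k, w⟩ := c
      obtain rfl := hK
      rfl)
    cases B with
    | assertP_ok he =>
      rw [hp (by simpa [Sig.argList] using hN)] at he
      obtain ⟨_, s, h, l₀, k, w⟩ := c
      obtain rfl := hK
      exact ⟨rfl, rfl, _, R.step R.sync rfl, if_pos he, by simp [Config.step, Sig.argList]⟩
    | assertP_fail he =>
      rw [hp (by simpa [Sig.argList] using hN)] at he
      obtain ⟨n, rfl⟩ := R.run
      exact (hsafe s₀ (errs_of_run hK (BigStep.assertP_fail he) trivial)).elim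
  | _ e C ih => exact simulates_while hg (ih hinp hC)

/-- If the encoding of a deterministic program is unsafe, so is the program. -/
theorem safe_encRW_of_safe (hdet : Deterministic inp p) (hinp : ¬ p.Assigns inp)
    (halloc : p.AllocNormal) (H : Safe p) : Safe (encRW inp p) := by
  obtain ⟨I, H⟩ := H
  have hsafe : ∀ s, ¬ Errs I p s := fun s ⟨l, σ, s', h', B, hσ⟩ => H s s' h' l σ B hσ
  refine ⟨I.push inp p, fun t t' h' l σ B hσ => ?_⟩
  obtain ⟨D, hD⟩ := S.obj.exists_bdd S.defObj
  -- The renaming depends on the run at hand: `D` bounds the addresses in the default object, and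
  -- the length of the log bounds the number of allocations.
  obtain ⟨g, hg, hgN⟩ := exists_bijective_fixing (D + l.length)
  have hr : IsRenaming S g := ⟨hg.1, hgN 0 (Nat.zero_le _),
    Ty.map_eq_embed hgN (hD.mono (Nat.le_add_right _ _))⟩
  -- This is the initial stack of the program: the redeclared variables are pulled back along the
  -- bijection, whatever integers they hold.
  choose f hf using fun v : Σ τ, S.Var τ =>
    Ty.map_surjective hg.2 v.1 (t.get (S := S.rw) (RWVar.orig v.2))
  obtain ⟨a, ha⟩ := hg.2 (t.get (S := S.rw) RWVar.lastAddr)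
  obtain ⟨t₁, R, M, -⟩ := (matches_rwInit (I := I.push inp p) (s := f) (t := t) inp
    (fun x => (hf ⟨_, x⟩).symm) ha.symm).1 (Interp.mem_push_W.mpr ⟨_, rfl, Or.inl ⟨rfl, rfl⟩⟩)
  cases B with
  | seq_error B _ =>
    obtain ⟨-, rfl, -⟩ := R.eq B
    exact hσ
  | seq_ok B₁ B₂ =>
    obtain ⟨-, -, rfl, rfl⟩ := R.eq B₁
    obtain ⟨rfl, -⟩ := simulates hdet hsafe hD hr hgN p hinp halloc a _ []
      ⟨[p], f, [], [], 0, fun _ => 0⟩ ⟨⟨0, rfl⟩, M, rfl⟩ rfl _ _ _ _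
      (by simp only [List.length_append, List.length_nil]; omega) B₂
    exact hσ

end Completeness

end UPLang

/-! ### Equi-safety -/

theorem theoremA2 (S : UPLang.Sig) (inp : S.Var UPLang.Ty.int) (p : UPLang.Stmt S)
    (hdet : UPLang.Deterministic inp p) (hinp : ¬ p.Assigns inp) (halloc : p.AllocNormal) :
    UPLang.EquiSafe p (UPLang.encRW inp p) :=
  ⟨UPLang.safe_encRW_of_safe hdet hinp halloc, UPLang.safe_of_safe_encRW hinp halloc⟩
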